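/- Let $A\in\mathbb{R}^{d\times n}$, $N\in\mathbb{R}^{m\times n}$ with $m\ge 2$, let $b\in\operatorname{im}(A)$, and let $p\ge 2$ be real with $p\le \mathrm{poly}(m)$, and $\epsilon>0$. Consider $\min_{Ax=b}\|Nx\|_p^p$, and let $f_k(x)=\|Nx\|_k^k$. A *linear system solver* returns, for each $(B,c)$, a solution of $Bx=c$ if there is one; only calls to it are counted. A problem $\min\{\Delta^\top Q\Delta: C\Delta=c\}$ with $Q\succeq 0$ is solved, or found infeasible, by one call, on $\begin{pmatrix}Q&C^\top\\C&0\end{pmatrix}\binom{\Delta}{y}=\binom{0}{c}$. $\log$ is the natural logarithm. **MWU$_q(C,R,N',c,\zeta)$** (for $\min\{\Delta^\top R\Delta+\|N'\Delta\|_q^q: C\Delta=c\}$). Put $X=m^{\frac{q-2}{3q-2}}$, $T=\lceil X\rceil$, $\beta=X/2$, $\rho=m^{\frac{q^2-4q+2}{q(3q-2)}}$, $\alpha=\frac{1}{64q}m^{-\frac{q^2-5q+2}{q(3q-2)}}$, $\tau=32^q m^{\frac{(q-1)(q-2)}{3q-2}}$. Start with $w=\mathbf 1$, $x=0$, $i=k=0$.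 While $i<T$ and $k\le T$: let $\Delta$ minimize $m^{\frac{q-2}{q}}\zeta^{-\frac{q-2}{q}}\Delta^\top R\Delta+\sum_e w_e^{q-2}(N'\Delta)_e^2$ subject to $C\Delta=c$ (stop if infeasible). If $\|N'\Delta\|_q^q\le\tau\zeta$, set $w\leftarrow w+\alpha|N'\Delta|/\zeta^{1/q}$, $x\leftarrow x+\Delta$, $i\leftarrow i+1$; otherwise multiply $w_e$ by $2^{1/(q-2)}$ for all $e$ with $|N'\Delta|_e\ge\rho\zeta^{1/q}$ and $w_e^{q-2}\le\beta$, and set $k\leftarrow k+1$. Return $x/T$ if $i=T$, and $0$ otherwise. **Residual solver** at $x$ for the norm $p$ with parameter $\nu$. Let $g=N^\top \mathrm{Diag}(|Nx|^{p-2})Nx$, $R=2N^\top\mathrm{Diag}(|Nx|^{p-2})N$ and $\mathrm{res}_p(\Delta)=g^\top\Delta-\Delta^\top R\Delta-\|N\Delta\|_p^p$. If $p<\log m$, put $q=p$, $N_\zeta=N$, $s=(2^{30}p)^{-1}$ and $\kappa=2^{32}p$; if $p\ge\log m$, put $q=\max\{2,\log m\}$, $N_\zeta=4^{-1/q}\zeta^{\frac1q-\frac1p}m^{\min\{\frac1p-\frac1q,0\}}N$,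 $s=(2^{30}q)^{-1}m^{-\frac1{p-1}}$ and $\kappa=2^{32}q\,m^{\frac{1}{p-1}}$. For each $\zeta=\nu,\nu/2,\nu/4,\dots$ with $\zeta>\nu/(32p)$ let $\Delta_\zeta$ be the output of MWU$_q$ for $R$, $N_\zeta$, $\zeta$ and the constraints $A\Delta=0$, $g^\top\Delta=\zeta/2$. Return, among $0$ and all $s\Delta_\zeta$, a vector with the largest value of $\mathrm{res}_p$. **$\ell_p$-Solver$(x^{(0)},\epsilon')$.** Put $x=x^{(0)}$, $\nu=f_p(x^{(0)})$. While $\nu>\epsilon'$: let $\tilde\Delta$ be the output of the residual solver at $x$ with parameter $\nu$; if $\mathrm{res}_p(\tilde\Delta)\ge\frac{\nu}{32p\kappa}$ set $x\leftarrow x-\tilde\Delta/p$, otherwise set $\nu\leftarrow\nu/2$. Return $x$. **Homotopy.** Let $x$ minimize $\|Nx\|_2^2$ subject to $Ax=b$ (one call). For $k=4,8,16,\dots$ with $k\le 2^{\lfloor\log_2 p-1\rfloor}$ replace $x$ by the output of the $\ell_k$-Solver started at $x$ with $\epsilon'=f_k(x)/(4m)$. Return $x^{(0)}=x$. **Theorem.**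 For every linear system solver, the homotopy followed by the $\ell_p$-Solver started at $x^{(0)}$ with $\epsilon'=\epsilon f_p(x^{(0)})/(16m^3)$ terminates and returns $x$ with $Ax=b$ and $$\|Nx\|_p^p\le(1+\epsilon)\min_{Ay=b}\|Ny\|_p^p ,$$ and makes in total $$O\!\left(p\,m^{\frac{p-2}{3p-2}}\,\log^2 p\,\log m\,\log\frac{m}{\min\{\epsilon,1\}}\right)$$ calls to the linear system solver. That is: for every $c\in\mathbb{R}$ there is a constant depending only on $c$ such that the bound holds with this constant for all $d,n,m,A,N,b,\epsilon$ and all $p$ with $2\le p\le m^c$. -/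

import Mathlib

/-! ### Exact linear system solvers and computations that call them -/

/-- An exact linear system solver: from `B` and `c` it returns a solution of `B x = c` whenever
there is one (and an arbitrary vector otherwise). -/
structure LinearSolver where
  solve : ∀ {ι κ : Type} [Fintype ι] [Fintype κ], Matrix ι κ ℝ → (ι → ℝ) → (κ → ℝ)
  solve_spec : ∀ {ι κ : Type} [Fintype ι] [Fintype κ] (B : Matrix ι κ ℝ) (c : ι → ℝ),
    (∃ x, B.mulVec x = c) → B.mulVec (solve B c) = c

/-- Linear system solvers exist. -/
theorem LinearSolver.nonempty : Nonempty LinearSolver := by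
  classical
  exact ⟨{ solve := fun B c => if h : ∃ x, B.mulVec x = c then h.choose else 0
           solve_spec := fun B c h => by
             simp only [dif_pos h]
             exact h.choose_spec }⟩

/-- A (possibly diverging, deterministic) computation with result in `α`. The state is the number
of calls to the linear system solver made so far: `(a, t) ∈ prog 0` says that `prog` terminates
with result `a` after exactly `t` calls. -/
abbrev Comp (α : Type) : Type := StateT ℕ Part α

/-- One call to the linear system solver; this is the only operation that is counted. -/
noncomputable def linSolve (S : LinearSolver) {ι κ : Type} [Fintype ι] [Fintype κ]
    (B : Matrix ι κ ℝ) (c : ι → ℝ) : Comp (κ → ℝ) :=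
  fun t => Part.some (S.solve B c, t + 1)

open scoped Classical in
/-- One test of the condition of a loop, and one execution of its body if the condition holds. -/
noncomputable def whileIter {σ : Type} (cond : σ → Prop) (body : σ → Comp σ) :
    (σ × ℕ) →. (σ × ℕ) ⊕ (σ × ℕ) :=
  fun st => if cond st.1 then (body st.1 st.2).map Sum.inr else Part.some (Sum.inl st)

/-- `while cond do body`, started in the state `s`; it diverges if `cond` never becomes false. -/
noncomputable def whileLoop {σ : Type} (cond : σ → Prop) (body : σ → Comp σ) (s : σ) : Comp σ :=
  fun t => (whileIter cond body).fix (s, t)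

open scoped Classical in
/-- Minimize `Δᵀ Q Δ` subject to `C Δ = c`, for a positive semidefinite `Q`, by one call to the
linear system solver (the optimality conditions `Q Δ + Cᵀ y = 0`, `C Δ = c`). The result is `none`
if the constraints are infeasible. -/
noncomputable def quadMin (S : LinearSolver) {n : ℕ} {ι : Type} [Fintype ι]
    (Q : Matrix (Fin n) (Fin n) ℝ) (C : Matrix ι (Fin n) ℝ) (c : ι → ℝ) :
    Comp (Option (Fin n → ℝ)) := do
  let z ← linSolve S (Matrix.fromBlocks Q C.transpose C 0) (Sum.elim 0 c)
  let Δ : Fin n → ℝ := fun j => z (Sum.inl j)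
  pure (if C.mulVec Δ = c then some Δ else none)

/-! ### The objective and its residual problem -/

/-- `‖v‖_p^p`. -/
noncomputable def lpPow {m : ℕ} (p : ℝ) (v : Fin m → ℝ) : ℝ := ∑ e, |v e| ^ p

/-- The vector `g = Nᵀ Diag(|N x|^(p-2)) N x` of the residual problem at `x`. -/
noncomputable def resGrad {m n : ℕ} (N : Matrix (Fin m) (Fin n) ℝ) (p : ℝ) (x : Fin n → ℝ) :
    Fin n → ℝ :=
  N.transpose.mulVec (fun e => |N.mulVec x e| ^ (p - 2) * N.mulVec x e)

/-- The matrix `R = 2 Nᵀ Diag(|N x|^(p-2)) N` of the residual problem at `x`. -/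
noncomputable def resQuad {m n : ℕ} (N : Matrix (Fin m) (Fin n) ℝ) (p : ℝ) (x : Fin n → ℝ) :
    Matrix (Fin n) (Fin n) ℝ :=
  (2 : ℝ) • (N.transpose * Matrix.diagonal (fun e => |N.mulVec x e| ^ (p - 2)) * N)

/-- The residual objective `res_p(Δ) = gᵀ Δ - Δᵀ R Δ - ‖N Δ‖_p^p` at `x`. -/
noncomputable def resObj {m n : ℕ} (N : Matrix (Fin m) (Fin n) ℝ) (p : ℝ)
    (x Δ : Fin n → ℝ) : ℝ :=
  dotProduct (resGrad N p x) Δ - dotProduct Δ ((resQuad N p x).mulVec Δ) - lpPow p (N.mulVec Δ)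

/-! ### The width reduced multiplicative weight update solver -/

/-- Oracle: minimize `m^((p-2)/p) ζ^(-(p-2)/p) Δᵀ R Δ + ∑ₑ wₑ^(p-2) (N Δ)ₑ²` subject to
`C Δ = c`. -/
noncomputable def mwuOracle (S : LinearSolver) {m n : ℕ} {ι : Type} [Fintype ι]
    (C : Matrix ι (Fin n) ℝ) (R : Matrix (Fin n) (Fin n) ℝ) (N : Matrix (Fin m) (Fin n) ℝ)
    (c : ι → ℝ) (ζ p : ℝ) (w : Fin m → ℝ) : Comp (Option (Fin n → ℝ)) :=
  quadMin S
    (((m : ℝ) ^ ((p - 2) / p) * ζ ^ (-((p - 2) / p))) • R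
      + N.transpose * Matrix.diagonal (fun e => w e ^ (p - 2)) * N) C c

/-- Width parameter `ρ`. -/
noncomputable def mwuRho (m : ℕ) (p : ℝ) : ℝ :=
  (m : ℝ) ^ ((p ^ 2 - 4 * p + 2) / (p * (3 * p - 2)))

/-- Resistance threshold `β`. -/
noncomputable def mwuBeta (m : ℕ) (p : ℝ) : ℝ := (m : ℝ) ^ ((p - 2) / (3 * p - 2)) / 2

/-- Step size `α`. -/
noncomputable def mwuAlpha (m : ℕ) (p : ℝ) : ℝ :=
  (64 * p)⁻¹ * (m : ℝ) ^ (-((p ^ 2 - 5 * p + 2) / (p * (3 * p - 2))))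

/-- `ℓ_p` threshold `τ`. -/
noncomputable def mwuTau (m : ℕ) (p : ℝ) : ℝ :=
  (32 : ℝ) ^ p * (m : ℝ) ^ ((p - 1) * (p - 2) / (3 * p - 2))

/-- Number `T` of primal steps. -/
noncomputable def mwuT (m : ℕ) (p : ℝ) : ℕ := ⌈(m : ℝ) ^ ((p - 2) / (3 * p - 2))⌉₊

/-- State of the multiplicative weight update loop: weights `w`, sum `x` of the primal steps,
number `i` of primal steps, number `k` of width reduction steps, and whether the oracle has
reported that the constraints are infeasible. -/
structure MWUState (m n : ℕ) where
  w : Fin m → ℝ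
  x : Fin n → ℝ
  i : ℕ
  k : ℕ
  infeasible : Prop

open scoped Classical in
/-- One iteration of the multiplicative weight update loop: a primal step if
`‖N Δ‖_p^p ≤ τ ζ`, and a width reduction step otherwise. -/
noncomputable def mwuStep (S : LinearSolver) {m n : ℕ} {ι : Type} [Fintype ι]
    (C : Matrix ι (Fin n) ℝ) (R : Matrix (Fin n) (Fin n) ℝ) (N : Matrix (Fin m) (Fin n) ℝ)
    (c : ι → ℝ) (ζ p : ℝ) (s : MWUState m n) : Comp (MWUState m n) := do
  let o ← mwuOracle S C R N c ζ p s.w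
  match o with
  | none => pure { s with infeasible := True }
  | some Δ =>
    if lpPow p (N.mulVec Δ) ≤ mwuTau m p * ζ then
      pure { s with
        w := fun e => s.w e + mwuAlpha m p * |N.mulVec Δ e| / ζ ^ (1 / p)
        x := s.x + Δ
        i := s.i + 1 }
    else
      pure { s with
        w := fun e =>
          if mwuRho m p * ζ ^ (1 / p) ≤ |N.mulVec Δ e| ∧ s.w e ^ (p - 2) ≤ mwuBeta m p then
            (2 : ℝ) ^ (1 / (p - 2)) * s.w e
          else s.w e
        k := s.k + 1 }

open scoped Classical in
/-- The multiplicative weight update solver for `min Δᵀ R Δ + ‖N Δ‖_p^p` subject to `C Δ = c`, with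
`ζ` as a guess for an upper bound on the optimum. It gives up, and returns `0`, if the constraints
are infeasible or if there are more than `T` width reduction steps. -/
noncomputable def mwuSolver (S : LinearSolver) {m n : ℕ} {ι : Type} [Fintype ι]
    (C : Matrix ι (Fin n) ℝ) (R : Matrix (Fin n) (Fin n) ℝ) (N : Matrix (Fin m) (Fin n) ℝ)
    (c : ι → ℝ) (ζ p : ℝ) : Comp (Fin n → ℝ) := do
  let s ← whileLoop (fun s : MWUState m n => ¬ s.infeasible ∧ s.i < mwuT m p ∧ s.k ≤ mwuT m p)
    (mwuStep S C R N c ζ p)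
    { w := fun _ => 1, x := 0, i := 0, k := 0, infeasible := False }
  pure (if s.i = mwuT m p then (mwuT m p : ℝ)⁻¹ • s.x else 0)

/-! ### The residual solvers -/

open scoped Classical in
/-- Binary search on the linear term of the residual problem at `x`: for `ζ = ν, ν/2, ν/4, …`, as
long as `ζ > ν/(32p)`, the solver is run for the norm `q` and the matrix `Ntil ζ` with the
constraints `A Δ = 0`, `gᵀ Δ = ζ/2`, and its output is multiplied by `scale`. Of `0` and all these
vectors, one with the largest residual objective is returned. -/
noncomputable def residualSearch (S : LinearSolver) {d m n : ℕ}
    (A : Matrix (Fin d) (Fin n) ℝ) (N : Matrix (Fin m) (Fin n) ℝ) (p : ℝ) (x : Fin n → ℝ) (ν : ℝ)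
    (q : ℝ) (Ntil : ℝ → Matrix (Fin m) (Fin n) ℝ) (scale : ℝ) : Comp (Fin n → ℝ) := do
  let s ← whileLoop (fun s : ℝ × (Fin n → ℝ) => ν / (32 * p) < s.1)
    (fun s => do
      let Δ ← mwuSolver S
        (Matrix.fromRows A (Matrix.replicateRow Unit (resGrad N p x))) (resQuad N p x) (Ntil s.1)
        (Sum.elim 0 (fun _ => s.1 / 2)) s.1 q
      pure (s.1 / 2,
        if resObj N p x s.2 < resObj N p x (scale • Δ) then scale • Δ else s.2))
    (ν, 0)
  pure s.2

/-- The residual solver that works with the norm `p` itself. -/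
noncomputable def residualSolver (S : LinearSolver) {d m n : ℕ}
    (A : Matrix (Fin d) (Fin n) ℝ) (N : Matrix (Fin m) (Fin n) ℝ) (p : ℝ) (x : Fin n → ℝ) (ν : ℝ) :
    Comp (Fin n → ℝ) :=
  residualSearch S A N p x ν p (fun _ => N) (2 ^ 30 * p)⁻¹

/-- The exponent `log m` (raised to `2` for the few `m` with `log m < 2`). -/
noncomputable def logExp (m : ℕ) : ℝ := max 2 (Real.log m)

/-- The residual solver that works with the norm `q = log m` instead of `p`. -/
noncomputable def logResidualSolver (S : LinearSolver) {d m n : ℕ}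
    (A : Matrix (Fin d) (Fin n) ℝ) (N : Matrix (Fin m) (Fin n) ℝ) (p : ℝ) (x : Fin n → ℝ) (ν : ℝ) :
    Comp (Fin n → ℝ) :=
  residualSearch S A N p x ν (logExp m)
    (fun ζ => ((4 : ℝ) ^ (-(1 / logExp m)) * ζ ^ (1 / logExp m - 1 / p)
      * (m : ℝ) ^ (min (1 / p - 1 / logExp m) 0)) • N)
    ((2 ^ 30 * logExp m)⁻¹ * (m : ℝ) ^ (-(1 / (p - 1))))

open scoped Classical in
/-- The approximation factor `κ` up to which the residual problems are solved. -/
noncomputable def resApprox (m : ℕ) (p : ℝ) : ℝ :=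
  if Real.log m ≤ p then 2 ^ 32 * logExp m * (m : ℝ) ^ (1 / (p - 1)) else 2 ^ 32 * p

/-! ### The complete algorithm -/

open scoped Classical in
/-- Iterative refinement for `min_{A x = b} ‖N x‖_p^p` from the starting solution `x₀`, to additive
accuracy `ε`, with the residual solver for the norm `log m` if `p ≥ log m`, and the one for the
norm `p` otherwise. The state is the pair `(x, ν)`. -/
noncomputable def lpSolver (S : LinearSolver) {d m n : ℕ}
    (A : Matrix (Fin d) (Fin n) ℝ) (N : Matrix (Fin m) (Fin n) ℝ) (p ε : ℝ) (x₀ : Fin n → ℝ) :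
    Comp (Fin n → ℝ) := do
  let s ← whileLoop (fun s : (Fin n → ℝ) × ℝ => ε < s.2)
    (fun s => do
      let Δ ← if Real.log m ≤ p then logResidualSolver S A N p s.1 s.2
        else residualSolver S A N p s.1 s.2
      pure (if s.2 / (32 * p * resApprox m p) ≤ resObj N p s.1 Δ then (s.1 - p⁻¹ • Δ, s.2)
        else (s.1, s.2 / 2)))
    (x₀, lpPow p (N.mulVec x₀))
  pure s.1

/-- The homotopy on `p`: the `ℓ_2` problem is solved by one linear system, and then, for
`k = 4, 8, 16, …, 2^⌊log₂ p - 1⌋`, the `ℓ_k` problem is solved to a factor of `2`, starting from the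
previous solution `x`, which is a `4m`-approximate solution of the `ℓ_k` problem (so that the
additive accuracy `‖N x‖_k^k / (4m)` is at most the optimum). -/
noncomputable def startSolution (S : LinearSolver) {d m n : ℕ}
    (A : Matrix (Fin d) (Fin n) ℝ) (N : Matrix (Fin m) (Fin n) ℝ) (b : Fin d → ℝ) (p : ℝ) :
    Comp (Fin n → ℝ) := do
  let o ← quadMin S (N.transpose * N) A b
  let s ← whileLoop (fun s : (Fin n → ℝ) × ℝ => s.2 ≤ (2 : ℝ) ^ ⌊Real.logb 2 p - 1⌋)
    (fun s => do
      let x ← lpSolver S A N s.2 (lpPow s.2 (N.mulVec s.1) / (4 * m)) s.1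
      pure (x, 2 * s.2))
    (o.getD 0, 4)
  pure s.1

/-- The whole algorithm for `min_{A x = b} ‖N x‖_p^p` to relative accuracy `ε`: the homotopy gives a
`16m³`-approximate solution `x₀`, from which iterative refinement is run to additive accuracy
`ε ‖N x₀‖_p^p / (16m³)`. -/
noncomputable def pureLpSolver (S : LinearSolver) {d m n : ℕ}
    (A : Matrix (Fin d) (Fin n) ℝ) (N : Matrix (Fin m) (Fin n) ℝ) (b : Fin d → ℝ) (p ε : ℝ) :
    Comp (Fin n → ℝ) := do
  let x₀ ← startSolution S A N b p
  lpSolver S A N p (ε * lpPow p (N.mulVec x₀) / (16 * (m : ℝ) ^ 3)) x₀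

/-! Correctness and cost are proved together: `Returns` asserts termination, a postcondition and a
bound on the calls, and every loop is bounded by a rank function that drops by at least one per
round. Four mechanisms are combined.

Refinement. The scalar bounds `abs_add_rpow_le` and `le_abs_add_rpow` compare `|a + h|^p` with its
linearization plus a quadratic and a `p`-th power term. Summed over coordinates they say that a step
`Δ/p` gains at least `res_p(Δ)` (`resObj_le`), and that the whole gap to any competitor is at most
`16p` times the residual value at some direction (`sub_le_resObj`). A residual solver with
approximation factor `κ` therefore needs `O(pκ)` steps to halve the gap.

Residual problem. Maximizing along a ray and rescaling puts the linear term at exactly `ζ/2` for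
some `ζ` in a list of `O(log p)` dyadic scales (`exists_residualScale`). This leaves the
minimization of a quadratic plus a `q`-th power under linear constraints.

Multiplicative weights. Each oracle call solves a weighted least squares problem. The potential `∑
wₑ^q` stays at most `256 m`, so by Hölder the energy of a feasible point of scale `ζ` stays below
`energyBound`. A primal step adds `O(m/T)` to the potential. If `‖NΔ‖_q^q` is too large, the
coordinates that are wide but still light carry most of it; doubling their resistances raises the
energy of every feasible point by at least `energyBound / X`, so there are at most `X` width
reductions, and each adds at most `200 m / (T + 1)` to the potential. After `T` primal steps the
weights dominate the accumulated iterate, which bounds the norm of the average. This costs `O(X)`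
calls, `X = m^((q-2)/(3q-2))`.

Large exponents and the start. For `p ≥ log m` the exponent `q = max(2, log m)` replaces `p`; since
`m^(1/q) ≤ e`, the change of norm leaves `κ = O(log m)`. The homotopy doubles the exponent, so that
comparison of norms loses only a factor `4m` per stage and `16m³` at the end. One `log p` in the
count comes from the dyadic scales, one from the homotopy; `p log m` comes from `pκ`. -/

open scoped Matrix

/-! ### A cost calculus for computations -/

/-- From every state, `prog` terminates after at most `c` calls with a result satisfying `P`. -/
def Returns {α : Type} (prog : Comp α) (P : α → Prop) (c : ℝ) : Prop :=
  ∀ t : ℕ, ∃ (a : α) (t' : ℕ), (a, t') ∈ prog t ∧ P a ∧ (t' : ℝ) ≤ t + c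

theorem Returns.mono {α : Type} {prog : Comp α} {P Q : α → Prop} {c c' : ℝ}
    (h : Returns prog P c) (hPQ : ∀ a, P a → Q a) (hc : c ≤ c') : Returns prog Q c' := by
  intro t
  obtain ⟨a, t', h1, h2, h3⟩ := h t
  exact ⟨a, t', h1, hPQ a h2, by linarith⟩

theorem Returns.pure {α : Type} {a : α} {P : α → Prop} (h : P a) :
    Returns (pure a : Comp α) P 0 := by
  intro t
  exact ⟨a, t, Part.mem_some _, h, by simp⟩

theorem Returns.bind {α β : Type} {prog : Comp α} {f : α → Comp β} {P : α → Prop} {Q : β → Prop}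
    {c₁ c₂ : ℝ} (h : Returns prog P c₁) (hf : ∀ a, P a → Returns (f a) Q c₂) :
    Returns (prog >>= f) Q (c₁ + c₂) := by
  intro t
  obtain ⟨a, t', h1, h2, h3⟩ := h t
  obtain ⟨b, t'', h4, h5, h6⟩ := hf a h2 t'
  refine ⟨b, t'', ?_, h5, by linarith⟩
  exact Part.mem_bind (g := fun q : α × ℕ => f q.1 q.2) h1 h4

theorem returns_linSolve (S : LinearSolver) {ι κ : Type} [Fintype ι] [Fintype κ]
    (B : Matrix ι κ ℝ) (c : ι → ℝ) : Returns (linSolve S B c) (fun z => z = S.solve B c) 1 := by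
  intro t
  exact ⟨_, t + 1, Part.mem_some _, rfl, by push_cast; linarith⟩

/-- Total correctness of `while` loops, with invariant `I` and rank function `V`. -/
theorem Returns.whileLoop {σ : Type} {cond : σ → Prop} {body : σ → Comp σ} (I : σ → Prop)
    (V : σ → ℝ) {c B : ℝ} {s : σ} (hc : 0 ≤ c) (hB : 0 ≤ B)
    (hV : ∀ s, I s → cond s → 0 ≤ V s)
    (hbody : ∀ s, I s → cond s → Returns (body s) (fun s' => I s' ∧ V s' ≤ V s - 1) c)
    (hs : I s) (hsB : V s ≤ B) :
    Returns (whileLoop cond body s) (fun s' => I s' ∧ ¬ cond s') (c * (B + 1)) := by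
  have key : ∀ (k : ℕ) (s : σ), I s → V s < k →
      Returns (_root_.whileLoop cond body s) (fun s' => I s' ∧ ¬ cond s') (c * k) := by
    intro k
    induction k with
    | zero =>
      intro s hs hVs t
      have hn : ¬ cond s := fun h => by
        have := hV s hs h
        simp at hVs
        linarith
      refine ⟨s, t, ?_, ⟨hs, hn⟩, by simp⟩
      refine PFun.mem_fix_iff.2 (Or.inl ?_)
      simp [whileIter, hn]
    | succ k ih =>
      intro s hs hVs t
      by_cases hn : cond s
      · obtain ⟨s', t', h1, ⟨h2, h3⟩, h4⟩ := hbody s hs hn t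
        obtain ⟨s'', t'', h5, h6, h7⟩ := ih s' h2 (by push_cast at hVs; linarith) t'
        refine ⟨s'', t'', ?_, h6, by push_cast; linarith⟩
        refine PFun.mem_fix_iff.2 (Or.inr ⟨(s', t'), ?_, h5⟩)
        simp only [whileIter, hn, if_true]
        exact Part.mem_map _ h1
      · refine ⟨s, t, ?_, ⟨hs, hn⟩, ?_⟩
        · refine PFun.mem_fix_iff.2 (Or.inl ?_)
          simp [whileIter, hn]
        · have : 0 ≤ c * ((k + 1 : ℕ) : ℝ) := by positivity
          linarith
  -- A real rank at most `B` that loses one per round and is nonnegative while the loop runs allows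
  -- at most `⌊B⌋ + 1` rounds.
  refine (key (⌊B⌋₊ + 1) s hs ?_).mono (fun _ h => h) ?_
  · push_cast
    exact lt_of_le_of_lt hsB (Nat.lt_floor_add_one B)
  · push_cast
    gcongr
    exact Nat.floor_le hB

/-! ### Equality constrained quadratic minimization -/

/-- The Fredholm alternative for symmetric real matrices. -/
theorem Matrix.IsSymm.exists_mulVec_eq {κ : Type*} [Fintype κ] {M : Matrix κ κ ℝ} (hM : M.IsSymm)
    {r : κ → ℝ} (h : ∀ u, M *ᵥ u = 0 → r ⬝ᵥ u = 0) : ∃ z, M *ᵥ z = r := by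
  classical
  let T := Matrix.toEuclideanLin M
  have hT : ∀ z, WithLp.ofLp (T z) = M *ᵥ WithLp.ofLp z := fun z => rfl
  have hmem : (WithLp.toLp 2 r : EuclideanSpace ℝ κ) ∈ LinearMap.range T := by
    rw [← Submodule.orthogonal_orthogonal (LinearMap.range T), Submodule.mem_orthogonal]
    intro u hu
    rw [Submodule.mem_orthogonal] at hu
    have h0 : M *ᵥ (WithLp.ofLp u) = 0 := by
      -- Testing orthogonality to the range against `M (M u)` gives `‖M u‖² = 0`, so the orthogonal
      -- complement of the range lies in the kernel.
      have h1 := hu (T (T u)) ⟨_, rfl⟩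
      rw [EuclideanSpace.inner_eq_star_dotProduct, hT, star_trivial, Matrix.dotProduct_mulVec,
        ← Matrix.mulVec_transpose, hM.eq, hT] at h1
      exact dotProduct_self_eq_zero.1 h1
    rw [EuclideanSpace.inner_eq_star_dotProduct, star_trivial]
    exact h _ h0
  obtain ⟨z, hz⟩ := hmem
  exact ⟨WithLp.ofLp z, by rw [← hT, hz]⟩

theorem mulVec_eq_zero_of_quadForm_eq_zero {κ : Type*} [Fintype κ] {Q : Matrix κ κ ℝ}
    (hQ : Q.IsSymm) (hpos : ∀ v, 0 ≤ v ⬝ᵥ Q *ᵥ v) {u : κ → ℝ} (hu : u ⬝ᵥ Q *ᵥ u = 0) :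
    Q *ᵥ u = 0 := by
  have hps : Q.PosSemidef := .of_dotProduct_mulVec_nonneg
    (by rw [Matrix.IsHermitian, Matrix.conjTranspose_eq_transpose_of_trivial, hQ.eq]) (by simpa using hpos)
  exact (hps.dotProduct_mulVec_zero_iff u).1 (by simpa using hu)

theorem Matrix.IsSymm.dotProduct_mulVec_comm {κ : Type*} [Fintype κ] {Q : Matrix κ κ ℝ}
    (hQ : Q.IsSymm) (u v : κ → ℝ) : u ⬝ᵥ Q *ᵥ v = v ⬝ᵥ Q *ᵥ u := by
  rw [Matrix.dotProduct_mulVec, ← Matrix.mulVec_transpose, hQ.eq, dotProduct_comm]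

/-- `quadMin` detects infeasibility, and its result satisfies the Pythagorean identity that
characterizes minimizers. -/
theorem returns_quadMin (S : LinearSolver) {n : ℕ} {ι : Type} [Fintype ι]
    {Q : Matrix (Fin n) (Fin n) ℝ} (C : Matrix ι (Fin n) ℝ) (c : ι → ℝ) (hQ : Q.IsSymm)
    (hpos : ∀ v, 0 ≤ v ⬝ᵥ Q *ᵥ v) :
    Returns (quadMin S Q C c) (fun o =>
      (∀ Δ, o = some Δ → C *ᵥ Δ = c ∧ ∀ Δ', C *ᵥ Δ' = c →
        Δ' ⬝ᵥ Q *ᵥ Δ' = Δ ⬝ᵥ Q *ᵥ Δ + (Δ' - Δ) ⬝ᵥ Q *ᵥ (Δ' - Δ)) ∧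
      (o = none → ∀ Δ, C *ᵥ Δ ≠ c)) 1 := by
  -- A feasible point makes the optimality system solvable: a kernel vector `(u, v)` has `uᵀ Q u =
  -- 0`, hence `Q u = 0` and `Cᵀ v = 0`, so it is orthogonal to `(0, C Δ₀)`.
  have key : ∀ Δ₀, C *ᵥ Δ₀ = c →
      Matrix.fromBlocks Q C.transpose C 0 *ᵥ S.solve (Matrix.fromBlocks Q C.transpose C 0)
        (Sum.elim 0 c) = Sum.elim (0 : Fin n → ℝ) c := by
    intro Δ₀ hΔ₀
    refine S.solve_spec _ _ (Matrix.IsSymm.exists_mulVec_eq ?_ ?_)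
    · rw [Matrix.IsSymm, Matrix.fromBlocks_transpose, hQ.eq]
      simp
    · intro z hz
      obtain ⟨u, v, rfl⟩ : ∃ u v, z = Sum.elim u v := ⟨z ∘ Sum.inl, z ∘ Sum.inr, by simp⟩
      rw [Matrix.fromBlocks_mulVec] at hz
      simp only [Sum.elim_comp_inl, Sum.elim_comp_inr, Matrix.zero_mulVec, add_zero] at hz
      have h1 : Q *ᵥ u + Cᵀ *ᵥ v = 0 := by
        funext i; simpa using congrFun hz (Sum.inl i)
      have h2 : C *ᵥ u = 0 := by
        funext i; simpa using congrFun hz (Sum.inr i)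
      have h3 : u ⬝ᵥ Q *ᵥ u = 0 := by
        have := congrArg (fun y => u ⬝ᵥ y) h1
        simpa [dotProduct_add, Matrix.dotProduct_mulVec u Cᵀ, Matrix.vecMul_transpose, h2] using this
      have h4 : Cᵀ *ᵥ v = 0 := by
        simpa [mulVec_eq_zero_of_quadForm_eq_zero hQ hpos h3] using h1
      rw [← hΔ₀]
      simp only [sumElim_dotProduct_sumElim, zero_dotProduct, zero_add]
      rw [dotProduct_comm, Matrix.dotProduct_mulVec, ← Matrix.mulVec_transpose, h4, zero_dotProduct]
  refine (Returns.bind (c₁ := 1) (c₂ := 0) (returns_linSolve S _ _) ?_).mono (fun _ h => h)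
    (by norm_num)
  rintro z rfl
  refine Returns.pure ?_
  set z := S.solve (Matrix.fromBlocks Q C.transpose C 0) (Sum.elim 0 c) with hz
  have hzz : z = Sum.elim (z ∘ Sum.inl) (z ∘ Sum.inr) := by simp
  have key2 : ∀ Δ₀, C *ᵥ Δ₀ = c → Q *ᵥ (z ∘ Sum.inl) + Cᵀ *ᵥ (z ∘ Sum.inr) = 0 ∧
      C *ᵥ (z ∘ Sum.inl) = c := by
    intro Δ₀ h
    have h1 := key Δ₀ h
    rw [Matrix.fromBlocks_mulVec] at h1
    simp only [Matrix.zero_mulVec, add_zero] at h1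
    exact ⟨by funext i; simpa using congrFun h1 (Sum.inl i),
      by funext i; simpa using congrFun h1 (Sum.inr i)⟩
  constructor
  · intro Δ hΔ
    split_ifs at hΔ with hC
    obtain rfl : (fun j => z (Sum.inl j)) = Δ := by simpa using hΔ
    refine ⟨hC, fun Δ' hΔ' => ?_⟩
    obtain ⟨h1, -⟩ := key2 _ hC
    change _ = (z ∘ Sum.inl) ⬝ᵥ Q *ᵥ (z ∘ Sum.inl) +
      (Δ' - (z ∘ Sum.inl)) ⬝ᵥ Q *ᵥ (Δ' - (z ∘ Sum.inl))
    -- Stationarity puts `Q z` in the range of `Cᵀ`, while differences of feasible points lie in the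
    -- kernel of `C`: the cross term vanishes.
    have h2 : (Δ' - (z ∘ Sum.inl)) ⬝ᵥ Q *ᵥ (z ∘ Sum.inl) = 0 := by
      rw [eq_neg_of_add_eq_zero_left h1, dotProduct_neg, Matrix.dotProduct_mulVec,
        Matrix.vecMul_transpose, Matrix.mulVec_sub, hΔ']
      have : C *ᵥ (z ∘ Sum.inl) = c := hC
      simp [this]
    have h3 := hQ.dotProduct_mulVec_comm (z ∘ Sum.inl) Δ'
    simp only [Matrix.mulVec_sub, dotProduct_sub, sub_dotProduct] at h2 ⊢
    linarith
  · intro hnone Δ₀ hΔ₀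
    have := (key2 Δ₀ hΔ₀).2
    have h5 : C *ᵥ (fun j => z (Sum.inl j)) = c := this
    simp [h5] at hnone

/-! ### Scalar inequalities for powers -/

theorem one_add_div_rpow_le_exp {y p : ℝ} (hp : 0 < p) (hy : 0 ≤ 1 + y / p) :
    (1 + y / p) ^ p ≤ Real.exp y := by
  have h1 : 1 + y / p ≤ Real.exp (y / p) := by linarith [Real.add_one_le_exp (y / p)]
  calc (1 + y / p) ^ p ≤ Real.exp (y / p) ^ p := Real.rpow_le_rpow hy h1 hp.le
    _ = Real.exp y := by rw [← Real.exp_mul]; congr 1; field_simp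

/-- With `y = p h` the right side is `1 + y + 2y² + |y|^p`. For small `y` compare with `exp y`; for
large `|y|` the base `|1 + y/p|` is at most `max 1 |y|`, and the term `|y|^p` takes over. -/
theorem abs_one_add_rpow_le {p : ℝ} (hp : 2 ≤ p) (h : ℝ) :
    |1 + h| ^ p ≤ 1 + p * h + 2 * p ^ 2 * h ^ 2 + p ^ p * |h| ^ p := by
  have hp0 : 0 < p := by linarith
  obtain ⟨y, rfl⟩ : ∃ y, h = y / p := ⟨p * h, by field_simp⟩
  have e1 : p ^ p * |y / p| ^ p = |y| ^ p := by
    rw [← Real.mul_rpow hp0.le (abs_nonneg _), abs_div, abs_of_pos hp0]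
    congr 1; field_simp
  have e2 : 1 + p * (y / p) + 2 * p ^ 2 * (y / p) ^ 2 = 1 + y + 2 * y ^ 2 := by field_simp
  rw [e1, e2]
  have hyp : 0 ≤ |y| ^ p := by positivity
  have hle : y / p ≤ |y| / 2 := by
    rw [div_le_div_iff₀ hp0 two_pos]
    nlinarith [le_abs_self y, abs_nonneg y]
  have hge : -(|y| / 2) ≤ y / p := by
    rw [neg_le, ← neg_div, div_le_div_iff₀ hp0 two_pos]
    nlinarith [neg_le_abs y, abs_nonneg y]
  rcases le_total |y| 1 with hy | hy
  · have h0 : 0 ≤ 1 + y / p := by linarith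
    rw [abs_of_nonneg h0]
    have := (abs_le.1 (Real.abs_exp_sub_one_sub_id_le hy)).2
    nlinarith [one_add_div_rpow_le_exp hp0 h0]
  rcases le_total y 0 with hn | hn
  · rw [abs_of_nonpos hn] at hy hyp ⊢
    have hlast : 0 ≤ y + 2 * y ^ 2 := by nlinarith
    have h1 : |1 + y / p| ≤ max 1 (-y) := by
      rw [abs_le]
      have : y / p ≤ 0 := div_nonpos_of_nonpos_of_nonneg hn hp0.le
      rw [abs_of_nonpos hn] at hge
      exact ⟨by linarith [le_max_right 1 (-y)], by linarith [le_max_left 1 (-y)]⟩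
    have h2 : |1 + y / p| ^ p ≤ (max 1 (-y)) ^ p := Real.rpow_le_rpow (abs_nonneg _) h1 hp0.le
    rw [max_eq_right hy] at h2
    linarith
  · rw [abs_of_nonneg hn] at hy hyp hle ⊢
    have h0 : 0 ≤ 1 + y / p := by positivity
    rw [abs_of_nonneg h0]
    have hsq : y ^ 2 ≤ y ^ p := by
      rw [← Real.rpow_natCast y 2]
      exact Real.rpow_le_rpow_of_exponent_le hy (by simpa using hp)
    rcases le_total y 2 with h2 | h2
    · have h3 : Real.exp (y / 2) ≤ 1 + y / 2 + (y / 2) ^ 2 := by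
        have := (abs_le.1 (Real.abs_exp_sub_one_sub_id_le (x := y / 2)
          (by rw [abs_le]; constructor <;> linarith))).2
        linarith
      have h4 : Real.exp y ≤ (1 + y / 2 + (y / 2) ^ 2) ^ 2 := by
        calc Real.exp y = Real.exp (y / 2) ^ 2 := by rw [← Real.exp_nat_mul]; congr 1; push_cast; ring
          _ ≤ _ := by gcongr
      have h5 : (1 + y / 2 + (y / 2) ^ 2) ^ 2 ≤ 1 + y + 3 * y ^ 2 := by
        have : y ^ 3 ≤ 2 * y ^ 2 := by nlinarith [sq_nonneg y]
        nlinarith [sq_nonneg y]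
      linarith [one_add_div_rpow_le_exp hp0 h0]
    · have h3 : 1 + y / p ≤ y := by linarith
      have h4 : (1 + y / p) ^ p ≤ y ^ p := Real.rpow_le_rpow h0 h3 hp0.le
      nlinarith

/-- For `|h| ≤ 16`, Bernoulli with exponent `p/2` applied to `(1 + h)² = 1 + (2h + h²)` yields
`(p/2) h²`, more than enough for both higher terms. For larger `|h|`, the growth of `15^p` wins. The
scale `16` makes the terms match `16p` times the residual objective at `h/16`. -/
theorem le_abs_one_add_rpow {p : ℝ} (hp : 2 ≤ p) (h : ℝ) :
    1 + p * h + p / 8 * h ^ 2 + 16 * p * |h / 16| ^ p ≤ |1 + h| ^ p := by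
  have hp0 : 0 < p := by linarith
  rcases le_total |h / 16| 1 with hh | hh
  · have h1 : |h / 16| ^ p ≤ |h / 16| ^ (2 : ℝ) :=
      Real.rpow_le_rpow_of_exponent_ge' (abs_nonneg _) hh (by norm_num) hp
    have h2 : 1 + p / 2 * (2 * h + h ^ 2) ≤ (1 + (2 * h + h ^ 2)) ^ (p / 2) :=
      one_add_mul_self_le_rpow_one_add (by nlinarith [sq_nonneg (1 + h)]) (by linarith)
    have h3 : (1 + (2 * h + h ^ 2)) ^ (p / 2) = |1 + h| ^ p := by
      rw [show 1 + (2 * h + h ^ 2) = |1 + h| ^ (2 : ℝ) by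
        rw [Real.rpow_two, sq_abs]; ring, ← Real.rpow_mul (abs_nonneg _)]
      congr 1; ring
    rw [Real.rpow_two, sq_abs] at h1
    have h4 : 16 * p * |h / 16| ^ p ≤ 16 * p * (h / 16) ^ 2 := by gcongr
    rw [h3] at h2
    nlinarith [mul_nonneg hp0.le (sq_nonneg h)]
  · set u := |h / 16| with hu
    have hhu : |h| = 16 * u := by rw [hu, abs_div]; norm_num; ring
    have h1 : 15 * u ≤ |1 + h| := by
      have := abs_sub_abs_le_abs_sub h (-1)
      rw [abs_neg, abs_one, sub_neg_eq_add, add_comm h] at this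
      linarith
    have h2 : (15 * u) ^ p ≤ |1 + h| ^ p := Real.rpow_le_rpow (by linarith) h1 hp0.le
    rw [Real.mul_rpow (by norm_num) (by linarith)] at h2
    have h3 : u ^ 2 ≤ u ^ p := by
      rw [← Real.rpow_natCast u 2]
      exact Real.rpow_le_rpow_of_exponent_le hh (by simpa using hp)
    -- In units of `p u^p` the linear, quadratic and power terms cost at most `16`, `32` and `16`;
    -- their sum is `64`.
    have h4 : 1 + 64 * p ≤ (15 : ℝ) ^ p := by
      have := one_add_mul_self_le_rpow_one_add (s := 14) (by norm_num) (p := p - 1) (by linarith)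
      have h5 : (15 : ℝ) ^ p = 15 ^ (p - 1) * 15 := by
        rw [← Real.rpow_add_one (by norm_num)]; congr 1; ring
      rw [h5]
      norm_num at this
      linarith
    have h6 : h ^ 2 = 256 * u ^ 2 := by rw [← sq_abs, hhu]; ring
    have h7 : h ≤ 16 * u := by rw [← hhu]; exact le_abs_self h
    have h8 : (1 + 64 * p) * u ^ p ≤ 15 ^ p * u ^ p := by gcongr
    rw [h6]
    have h9 : p * h ≤ 16 * (p * u ^ p) := by
      have h10 : u ≤ u ^ p := by nlinarith
      nlinarith [mul_le_mul_of_nonneg_left h7 hp0.le, mul_le_mul_of_nonneg_left h10 hp0.le]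
    have h10 : p * u ^ 2 ≤ p * u ^ p := by gcongr
    have h11 : 1 ≤ u ^ p := Real.one_le_rpow hh hp0.le
    nlinarith

theorem abs_rpow_eq_mul_sq {p : ℝ} {a : ℝ} (ha : a ≠ 0) : |a| ^ p = |a| ^ (p - 2) * a ^ 2 := by
  have ha' : 0 < |a| := abs_pos.2 ha
  rw [← sq_abs, ← Real.rpow_natCast |a| 2, ← Real.rpow_add ha']
  congr 1; push_cast; ring

theorem abs_add_rpow_le {p : ℝ} (hp : 2 ≤ p) (a h : ℝ) :
    |a + h| ^ p ≤ |a| ^ p + p * (|a| ^ (p - 2) * a * h) + 2 * p ^ 2 * (|a| ^ (p - 2) * h ^ 2)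
      + p ^ p * |h| ^ p := by
  have hp0 : 0 < p := by linarith
  rcases eq_or_ne a 0 with rfl | ha
  · have h1 : (1 : ℝ) ≤ p ^ p := Real.one_le_rpow (by linarith) hp0.le
    have h2 : 0 ≤ 2 * p ^ 2 * (|(0 : ℝ)| ^ (p - 2) * h ^ 2) := by positivity
    have h3 : |(0 : ℝ)| ^ p = 0 := by rw [abs_zero, Real.zero_rpow hp0.ne']
    rw [zero_add, h3]
    have h4 : 0 ≤ |h| ^ p := by positivity
    nlinarith
  · obtain ⟨t, rfl⟩ : ∃ t, h = a * t := ⟨h / a, by field_simp⟩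
    have e1 : a + a * t = a * (1 + t) := by ring
    rw [e1, abs_mul, abs_mul, Real.mul_rpow (abs_nonneg _) (abs_nonneg _),
      Real.mul_rpow (abs_nonneg _) (abs_nonneg _)]
    have h1 := mul_le_mul_of_nonneg_left (abs_one_add_rpow_le hp t)
      (by positivity : (0 : ℝ) ≤ |a| ^ p)
    refine h1.trans (le_of_eq ?_)
    have h2 := abs_rpow_eq_mul_sq (p := p) ha
    linear_combination (p * t + 2 * p ^ 2 * t ^ 2) * h2

theorem le_abs_add_rpow {p : ℝ} (hp : 2 ≤ p) (a h : ℝ) :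
    |a| ^ p + p * (|a| ^ (p - 2) * a * h) + p / 8 * (|a| ^ (p - 2) * h ^ 2)
      + 16 * p * |h / 16| ^ p ≤ |a + h| ^ p := by
  have hp0 : 0 < p := by linarith
  rcases eq_or_ne a 0 with rfl | ha
  · have h3 : |(0 : ℝ)| ^ p = 0 := by rw [abs_zero, Real.zero_rpow hp0.ne']
    have h5 : p / 8 * (|(0 : ℝ)| ^ (p - 2) * h ^ 2) + 16 * p * |h / 16| ^ p ≤ |h| ^ p := by
      -- The factor `0^(p-2)` vanishes except at `p = 2`, where it is `0^0 = 1`.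
      have h1 : |(0 : ℝ)| ^ (p - 2) * h ^ 2 ≤ |h| ^ p * if p = 2 then 1 else 0 := by
        split_ifs with h2
        · subst h2; simp
        · rw [abs_zero, Real.zero_rpow (by contrapose! h2; linarith)]; simp
      have h2 : |h / 16| ^ p = |h| ^ p / 16 ^ p := by
        rw [abs_div, Real.div_rpow (abs_nonneg _) (abs_nonneg _)]; norm_num
      have h4 : 1 + 15 * (p - 1) ≤ (16 : ℝ) ^ (p - 1) := by
        have := one_add_mul_self_le_rpow_one_add (s := 15) (by norm_num) (p := p - 1) (by linarith)
        norm_num at this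
        linarith
      have h6 : (16 : ℝ) ^ p = 16 ^ (p - 1) * 16 := by
        rw [← Real.rpow_add_one (by norm_num)]; congr 1; ring
      have h7 : 16 * p * |h / 16| ^ p ≤ |h| ^ p / 4 := by
        have hh : 0 ≤ |h| ^ p := by positivity
        have h8 : 64 * p ≤ (16 : ℝ) ^ p := by rw [h6]; linarith
        rw [h2, ← mul_div_assoc, div_le_div_iff₀ (by positivity) (by norm_num)]
        nlinarith
      have hh : 0 ≤ |h| ^ p := by positivity
      have h9 : p / 8 * (|(0 : ℝ)| ^ (p - 2) * h ^ 2) ≤ |h| ^ p / 4 := by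
        refine (mul_le_mul_of_nonneg_left h1 (by positivity)).trans ?_
        split_ifs with h2
        · rw [h2]; linarith
        · simp; linarith
      linarith
    have h6 : p * (|(0 : ℝ)| ^ (p - 2) * 0 * h) = 0 := by ring
    rw [h3, zero_add h, h6]
    linarith
  · obtain ⟨t, rfl⟩ : ∃ t, h = a * t := ⟨h / a, by field_simp⟩
    have e1 : a + a * t = a * (1 + t) := by ring
    rw [e1, mul_div_assoc, abs_mul, abs_mul, Real.mul_rpow (abs_nonneg _) (abs_nonneg _),
      Real.mul_rpow (abs_nonneg _) (abs_nonneg _)]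
    have h1 := mul_le_mul_of_nonneg_left (le_abs_one_add_rpow hp t)
      (by positivity : (0 : ℝ) ≤ |a| ^ p)
    refine (le_of_eq ?_).trans h1
    have h2 := abs_rpow_eq_mul_sq (p := p) ha
    linear_combination -(p * t + p / 8 * t ^ 2) * h2

/-! ### Comparison of power sums -/

theorem sum_rpow_le_rpow_sum {ι : Type*} (s : Finset ι) {f : ι → ℝ} (hf : ∀ i ∈ s, 0 ≤ f i)
    {r : ℝ} (hr : 1 ≤ r) : ∑ i ∈ s, f i ^ r ≤ (∑ i ∈ s, f i) ^ r := by
  have hS : 0 ≤ ∑ i ∈ s, f i := Finset.sum_nonneg hf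
  have key : ∀ x : ℝ, 0 ≤ x → x ^ r = x * x ^ (r - 1) := by
    intro x hx
    rw [← Real.rpow_one_add' hx (by linarith)]
    congr 1; ring
  rw [key _ hS, Finset.sum_mul]
  refine Finset.sum_le_sum fun i hi => ?_
  rw [key _ (hf i hi)]
  exact mul_le_mul_of_nonneg_left (Real.rpow_le_rpow (hf i hi)
    (Finset.single_le_sum hf hi) (by linarith)) (hf i hi)

theorem lpPow_nonneg {m : ℕ} (p : ℝ) (v : Fin m → ℝ) : 0 ≤ lpPow p v :=
  Finset.sum_nonneg fun _ _ => by positivity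

theorem lpPow_smul {m : ℕ} (p t : ℝ) (v : Fin m → ℝ) :
    lpPow p (t • v) = |t| ^ p * lpPow p v := by
  simp only [lpPow, Finset.mul_sum, Pi.smul_apply, smul_eq_mul, abs_mul]
  exact Finset.sum_congr rfl fun _ _ => Real.mul_rpow (abs_nonneg _) (abs_nonneg _)

theorem lpPow_rpow_eq {m : ℕ} {q p : ℝ} (hq : 0 < q) (v : Fin m → ℝ) :
    lpPow p v = ∑ e, (|v e| ^ q) ^ (p / q) := by
  refine Finset.sum_congr rfl fun e _ => ?_
  rw [← Real.rpow_mul (abs_nonneg _)]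
  congr 1; field_simp

theorem lpPow_le_rpow_lpPow {m : ℕ} {q p : ℝ} (hq : 0 < q) (hqp : q ≤ p) (v : Fin m → ℝ) :
    lpPow p v ≤ lpPow q v ^ (p / q) := by
  rw [lpPow_rpow_eq hq]
  exact sum_rpow_le_rpow_sum _ (fun _ _ => by positivity) ((one_le_div hq).2 hqp)

theorem rpow_lpPow_le_mul_lpPow {m : ℕ} {q p : ℝ} (hq : 0 < q) (hqp : q ≤ p) (v : Fin m → ℝ) :
    lpPow q v ^ (p / q) ≤ (m : ℝ) ^ (p / q - 1) * lpPow p v := by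
  rw [lpPow_rpow_eq (p := p) hq]
  have := Real.rpow_sum_le_const_mul_sum_rpow_of_nonneg (s := Finset.univ)
    (f := fun e => |v e| ^ q) ((one_le_div hq).2 hqp) (fun _ _ => by positivity)
  simpa [lpPow] using this

/-- Hölder's inequality for the exponents `p / (p - 2)` and `p / 2`. -/
theorem sum_rpow_sub_two_mul_sq_le {m : ℕ} {p : ℝ} (hp : 2 ≤ p) {w v : Fin m → ℝ}
    (hw : ∀ e, 0 < w e) :
    ∑ e, w e ^ (p - 2) * v e ^ 2 ≤ (∑ e, w e ^ p) ^ ((p - 2) / p) * lpPow p v ^ (2 / p) := by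
  have hp0 : 0 < p := by linarith
  rcases hp.eq_or_lt with rfl | hp2
  · simp [lpPow]
  · have hconj : Real.HolderConjugate (p / (p - 2)) (p / 2) := by
      rw [Real.holderConjugate_iff]
      refine ⟨(one_lt_div (by linarith)).2 (by linarith), ?_⟩
      field_simp
      ring
    have h := Real.inner_le_Lp_mul_Lq_of_nonneg Finset.univ hconj
      (f := fun e => w e ^ (p - 2)) (g := fun e => v e ^ 2)
      (fun e _ => Real.rpow_nonneg (hw e).le _) (fun e _ => sq_nonneg _)
    refine h.trans (le_of_eq ?_)
    have e1 : ∀ e, (w e ^ (p - 2)) ^ (p / (p - 2)) = w e ^ p := by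
      intro e
      rw [← Real.rpow_mul (hw e).le]
      congr 1
      have : p - 2 ≠ 0 := by linarith
      field_simp
    have e2 : ∀ e, (v e ^ 2) ^ (p / 2) = |v e| ^ p := by
      intro e
      rw [← sq_abs, ← Real.rpow_two, ← Real.rpow_mul (abs_nonneg _)]
      congr 1
      field_simp
    simp only [e1, e2, one_div_div, lpPow]

/-! ### The parameters of the multiplicative weight update solver -/

/-- The width scale: `T = ⌈X⌉` and `β = X / 2`. -/
noncomputable def mwuX (m : ℕ) (p : ℝ) : ℝ := (m : ℝ) ^ ((p - 2) / (3 * p - 2))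

theorem mwuX_pos {m : ℕ} (hm : 0 < m) (p : ℝ) : 0 < mwuX m p := by
  have : (0 : ℝ) < m := by exact_mod_cast hm
  exact Real.rpow_pos_of_pos this _

theorem one_le_mwuX {m : ℕ} (hm : 0 < m) {p : ℝ} (hp : 2 ≤ p) : 1 ≤ mwuX m p := by
  have : (1 : ℝ) ≤ m := by exact_mod_cast hm
  exact Real.one_le_rpow this (div_nonneg (by linarith) (by linarith))

theorem mwuX_le_mwuT (m : ℕ) (p : ℝ) : mwuX m p ≤ mwuT m p := Nat.le_ceil _

theorem mwuT_lt {m : ℕ} (hm : 0 < m) (p : ℝ) : (mwuT m p : ℝ) < mwuX m p + 1 :=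
  Nat.ceil_lt_add_one (mwuX_pos hm p).le

theorem mwuT_pos {m : ℕ} (hm : 0 < m) (p : ℝ) : 0 < mwuT m p :=
  Nat.ceil_pos.2 (mwuX_pos hm p)

theorem mwuX_mono {m : ℕ} (hm : 0 < m) {q p : ℝ} (hq : 2 ≤ q) (hqp : q ≤ p) :
    mwuX m q ≤ mwuX m p := by
  have : (1 : ℝ) ≤ m := by exact_mod_cast hm
  refine Real.rpow_le_rpow_of_exponent_le this ?_
  rw [div_le_div_iff₀ (by linarith) (by linarith)]
  nlinarith

/-- This fixes `α`: over about `X` primal steps the accumulated increments have the size `m^(1/p)/p`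
up to a constant, so the potential moves by `O(m)` and the final weights still control the average
iterate. -/
theorem mul_mwuAlpha_mul_mwuX {m : ℕ} (hm : 0 < m) {p : ℝ} (hp : 2 ≤ p) :
    p * mwuAlpha m p * mwuX m p = (m : ℝ) ^ (1 / p) / 64 := by
  have hm' : (0 : ℝ) < m := by exact_mod_cast hm
  have h3 : 3 * p - 2 ≠ 0 := by linarith
  have h0 : p ≠ 0 := by linarith
  have e : (m : ℝ) ^ (1 / p) = (m : ℝ) ^ (-((p ^ 2 - 5 * p + 2) / (p * (3 * p - 2)))) *
      (m : ℝ) ^ ((p - 2) / (3 * p - 2)) := by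
    rw [← Real.rpow_add hm']
    congr 1
    obtain ⟨D, hD⟩ : ∃ D, 3 * p - 2 = D := ⟨_, rfl⟩
    rw [hD] at h3 ⊢
    field_simp
    subst hD
    ring
  rw [e, mwuAlpha, mwuX]
  field_simp

theorem mwuAlpha_pos {m : ℕ} (hm : 0 < m) {p : ℝ} (hp : 2 ≤ p) : 0 < mwuAlpha m p := by
  have hm' : (0 : ℝ) < m := by exact_mod_cast hm
  have : 0 < p := by linarith
  unfold mwuAlpha
  positivity

theorem mul_mwuAlpha_le {m : ℕ} (hm : 0 < m) {p : ℝ} (hp : 2 ≤ p) :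
    p * mwuAlpha m p ≤ (m : ℝ) ^ (1 / p) / 64 := by
  rw [← mul_mwuAlpha_mul_mwuX hm hp]
  exact le_mul_of_one_le_right (mul_nonneg (by linarith) (mwuAlpha_pos hm hp).le)
    (one_le_mwuX hm hp)

theorem mul_mwuAlpha_mul_mwuT_le {m : ℕ} (hm : 0 < m) {p : ℝ} (hp : 2 ≤ p) :
    p * mwuAlpha m p * mwuT m p ≤ (m : ℝ) ^ (1 / p) / 32 := by
  have h1 := mul_mwuAlpha_mul_mwuX hm hp
  have h2 : (mwuT m p : ℝ) ≤ 2 * mwuX m p := by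
    linarith [mwuT_lt hm p, one_le_mwuX hm hp]
  have h3 : 0 ≤ p * mwuAlpha m p := mul_nonneg (by linarith) (mwuAlpha_pos hm hp).le
  nlinarith [mul_le_mul_of_nonneg_left h2 h3]

/-- This fixes `τ`: the `p`-th power term of the expansion, at the threshold and over `X` primal
steps, costs only a fraction of `m`. -/
theorem mul_mwuAlpha_rpow_mul_mwuTau {m : ℕ} (hm : 0 < m) {p : ℝ} (hp : 2 ≤ p) :
    (p * mwuAlpha m p) ^ p * mwuTau m p * mwuX m p = (1 / 2 : ℝ) ^ p * m := by
  have hm' : (0 : ℝ) < m := by exact_mod_cast hm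
  have h3 : 3 * p - 2 ≠ 0 := by linarith
  have h0 : p ≠ 0 := by linarith
  have e1 : p * mwuAlpha m p = 1 / 64 * (m : ℝ) ^ (-((p ^ 2 - 5 * p + 2) / (p * (3 * p - 2)))) := by
    rw [mwuAlpha]; field_simp
  have e2 : (1 / 2 : ℝ) ^ p = (1 / 64) ^ p * 32 ^ p := by
    rw [← Real.mul_rpow (by norm_num) (by norm_num)]; norm_num
  have e3 : (m : ℝ) = (m : ℝ) ^ (-((p ^ 2 - 5 * p + 2) / (p * (3 * p - 2))) * p) *
      (m : ℝ) ^ ((p - 1) * (p - 2) / (3 * p - 2)) * (m : ℝ) ^ ((p - 2) / (3 * p - 2)) := by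
    rw [← Real.rpow_add hm', ← Real.rpow_add hm']
    conv_lhs => rw [← Real.rpow_one (m : ℝ)]
    congr 1
    obtain ⟨D, hD⟩ : ∃ D, 3 * p - 2 = D := ⟨_, rfl⟩
    rw [hD] at h3 ⊢
    field_simp
    subst hD
    ring
  rw [e1, Real.mul_rpow (by norm_num) (by positivity), ← Real.rpow_mul hm'.le, mwuTau, mwuX, e2]
  conv_rhs => rw [e3]
  ring

theorem mwuRho_pos {m : ℕ} (hm : 0 < m) (p : ℝ) : 0 < mwuRho m p := by
  have hm' : (0 : ℝ) < m := by exact_mod_cast hm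
  unfold mwuRho
  positivity

theorem mwuTau_pos {m : ℕ} (hm : 0 < m) (p : ℝ) : 0 < mwuTau m p := by
  have hm' : (0 : ℝ) < m := by exact_mod_cast hm
  unfold mwuTau
  positivity

/-- This fixes `ρ`: growth of the potential in a width step is charged to the energy at rate
`m^(2/(3p-2))/ρ²`, which this identity turns into `O(m/X²)` per unit of normalized energy. -/
theorem rpow_mul_sq_mwuX_eq {m : ℕ} (hm : 0 < m) {p : ℝ} (hp : 2 ≤ p) :
    (m : ℝ) ^ (2 / (3 * p - 2)) * (m : ℝ) ^ ((p - 2) / p) * mwuX m p ^ 2 = m * mwuRho m p ^ 2 := by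
  have hm' : (0 : ℝ) < m := by exact_mod_cast hm
  have h3 : 3 * p - 2 ≠ 0 := by linarith
  have h0 : p ≠ 0 := by linarith
  rw [mwuX, mwuRho, ← Real.rpow_two, ← Real.rpow_two, ← Real.rpow_mul hm'.le,
    ← Real.rpow_mul hm'.le, ← Real.rpow_add hm', ← Real.rpow_add hm', ← Real.rpow_one_add' hm'.le]
  · congr 1
    obtain ⟨D, hD⟩ : ∃ D, 3 * p - 2 = D := ⟨_, rfl⟩
    rw [hD] at h3 ⊢
    field_simp
    subst hD
    ring
  · have : 1 + (p ^ 2 - 4 * p + 2) / (p * (3 * p - 2)) * 2 = (5 * p ^ 2 - 10 * p + 4) / (p * (3 * p - 2)) := by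
      obtain ⟨D, hD⟩ : ∃ D, 3 * p - 2 = D := ⟨_, rfl⟩
      rw [hD] at h3 ⊢
      field_simp
      subst hD
      ring
    rw [this]
    exact div_ne_zero (by nlinarith) (mul_ne_zero h0 h3)

/-- Coordinates below the width `ρ` contribute at most `ρ^(p-2)` times the energy to the `p`-th
power sum; this is a small part of `τ`. -/
theorem mwuRho_rpow_mul {m : ℕ} (hm : 0 < m) {p : ℝ} (hp : 2 ≤ p) :
    mwuRho m p ^ (p - 2) * (m : ℝ) ^ ((p - 2) / p) = mwuTau m p / 32 ^ p := by
  have hm' : (0 : ℝ) < m := by exact_mod_cast hm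
  have h3 : 3 * p - 2 ≠ 0 := by linarith
  have h0 : p ≠ 0 := by linarith
  rw [mwuRho, mwuTau, mul_div_cancel_left₀ _ (by positivity), ← Real.rpow_mul hm'.le,
    ← Real.rpow_add hm']
  congr 1
  obtain ⟨D, hD⟩ : ∃ D, 3 * p - 2 = D := ⟨_, rfl⟩
  rw [hD] at h3 ⊢
  field_simp
  subst hD
  ring

/-- Coordinates with resistance above `β` contribute at most `(energy/β)^(p/2)`; this too is a small
part of `τ`. -/
theorem rpow_div_mwuX_rpow {m : ℕ} (hm : 0 < m) {p : ℝ} (hp : 2 ≤ p) :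
    ((m : ℝ) ^ ((p - 2) / p) / mwuX m p) ^ (p / 2) = mwuTau m p / 32 ^ p := by
  have hm' : (0 : ℝ) < m := by exact_mod_cast hm
  have h3 : 3 * p - 2 ≠ 0 := by linarith
  have h0 : p ≠ 0 := by linarith
  rw [mwuX, mwuTau, mul_div_cancel_left₀ _ (by positivity), ← Real.rpow_sub hm',
    ← Real.rpow_mul hm'.le]
  congr 1
  obtain ⟨D, hD⟩ : ∃ D, 3 * p - 2 = D := ⟨_, rfl⟩
  rw [hD] at h3 ⊢
  field_simp
  subst hD
  ring

/-- `256^((p-2)/p)`, the energy of weights with `∑ wₑ^p = 256 m` relative to `m^((p-2)/p)`. -/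
noncomputable def energyGrowth (p : ℝ) : ℝ := (256 : ℝ) ^ ((p - 2) / p)

/-- Upper bound for the energies that occur while `∑ wₑ^p ≤ 256 m`. -/
noncomputable def energyBound (m : ℕ) (p : ℝ) : ℝ := 2 * (energyGrowth p * (m : ℝ) ^ ((p - 2) / p))

theorem energyGrowth_pos (p : ℝ) : 0 < energyGrowth p := by
  unfold energyGrowth; positivity

theorem energyGrowth_mul {p : ℝ} (hp : 2 ≤ p) : energyGrowth p * 256 ^ (2 / p) = 256 := by
  have h0 : p ≠ 0 := by linarith
  rw [energyGrowth, ← Real.rpow_add (by norm_num)]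
  conv_rhs => rw [← Real.rpow_one (256 : ℝ)]
  congr 1
  field_simp
  ring

theorem energyGrowth_mul_two_rpow_le {p : ℝ} (hp : 2 ≤ p) :
    energyGrowth p * 2 ^ (2 / p) ≤ 256 := by
  rw [← energyGrowth_mul hp]
  have : 0 ≤ 2 / p := by positivity
  exact mul_le_mul_of_nonneg_left (Real.rpow_le_rpow (by norm_num) (by norm_num) this)
    (energyGrowth_pos p).le

theorem energyGrowth_le {p : ℝ} (hp : 2 ≤ p) : energyGrowth p ≤ 256 := by
  refine le_trans ?_ (energyGrowth_mul_two_rpow_le hp)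
  exact le_mul_of_one_le_right (energyGrowth_pos p).le
    (Real.one_le_rpow (by norm_num) (by positivity))

theorem energyGrowth_rpow {p : ℝ} (hp : 2 ≤ p) : energyGrowth p ^ (p / 2) = 16 ^ (p - 2) := by
  have h0 : p ≠ 0 := by linarith
  rw [energyGrowth, ← Real.rpow_mul (by norm_num), show (256 : ℝ) = 16 ^ (2 : ℝ) by norm_num,
    ← Real.rpow_mul (by norm_num)]
  congr 1
  field_simp

theorem energyGrowth_le_rpow {p : ℝ} (hp : 2 ≤ p) : energyGrowth p ≤ 16 ^ (p - 2) := by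
  rw [← energyGrowth_rpow hp]
  refine Real.self_le_rpow_of_one_le ?_ (by linarith)
  exact Real.one_le_rpow (by norm_num) (div_nonneg (by linarith) (by linarith))

theorem energyBound_pos {m : ℕ} (hm : 0 < m) (p : ℝ) : 0 < energyBound m p := by
  have hm' : (0 : ℝ) < m := by exact_mod_cast hm
  have := energyGrowth_pos p
  unfold energyBound
  positivity

theorem rpow_one_div_sq_mul {m : ℕ} (hm : 0 < m) {p : ℝ} (hp : 2 ≤ p) :
    ((m : ℝ) ^ (1 / p)) ^ 2 * (m : ℝ) ^ ((p - 2) / p) = m := by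
  have hm' : (0 : ℝ) < m := by exact_mod_cast hm
  have h0 : p ≠ 0 := by linarith
  rw [← Real.rpow_two, ← Real.rpow_mul hm'.le, ← Real.rpow_add hm']
  conv_rhs => rw [← Real.rpow_one (m : ℝ)]
  congr 1
  field_simp
  ring

/-- The exponents `p` used by the solver are `2` or at most `log m`; for them width reduction is
cheap in terms of `∑ wₑ^p`. -/
theorem energyGrowth_le_mul_mwuX {m : ℕ} (hm : 0 < m) {p : ℝ} (hp : 2 ≤ p)
    (hpm : (p - 2) * p ≤ (p - 2) * Real.log m) : 12 * energyGrowth p ≤ 200 * mwuX m p := by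
  have hm' : (0 : ℝ) < m := by exact_mod_cast hm
  have h0 : 0 < p := by linarith
  -- Here `X ≥ exp((p-2)/3)`, because `p = 2` or `p ≤ log m`, and `256^(2/p) ≥ exp(11/p)`. The
  -- exponents add up to at least `3` since `p² - 11p + 33 > 0`, and `e³ > 16`.
  have key : 16 ≤ 256 ^ (2 / p) * mwuX m p := by
    have e1 : (256 : ℝ) ^ (2 / p) * mwuX m p =
        Real.exp (Real.log 2 * 16 / p + (p - 2) * Real.log m / (3 * p - 2)) := by
      rw [mwuX, Real.rpow_def_of_pos (by norm_num), Real.rpow_def_of_pos hm', ← Real.exp_add,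
        show (256 : ℝ) = 2 ^ (8 : ℕ) by norm_num, Real.log_pow]
      congr 1
      push_cast
      ring
    rw [e1]
    have h1 : (p - 2) / 3 ≤ (p - 2) * Real.log m / (3 * p - 2) := by
      refine le_trans ?_ (div_le_div_of_nonneg_right hpm (by linarith))
      rw [div_le_div_iff₀ (by norm_num) (by linarith)]
      nlinarith
    have h2 : 11 / p ≤ Real.log 2 * 16 / p := by
      gcongr
      linarith [Real.log_two_gt_d9]
    have h3 : 3 ≤ 11 / p + (p - 2) / 3 := by
      rw [div_add_div _ _ h0.ne' (by norm_num), le_div_iff₀ (by positivity)]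
      nlinarith [sq_nonneg (p - 11 / 2)]
    have h4 : (2.7 : ℝ) ^ 3 ≤ Real.exp 3 := by
      have : Real.exp 3 = Real.exp 1 ^ 3 := by rw [← Real.exp_nat_mul]; norm_num
      rw [this]
      have := Real.exp_one_gt_d9
      gcongr
      linarith
    have h5 := Real.exp_le_exp.2 (h3.trans (add_le_add h2 h1))
    norm_num at h4
    linarith
  have h6 := energyGrowth_mul hp
  have h7 := energyGrowth_pos p
  nlinarith [mul_le_mul_of_nonneg_left key h7.le, mwuX_pos hm p]

/-! ### One step of the solver -/

/-- Effect of a primal step on `∑ wₑ^p`. -/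
theorem sum_rpow_primal_le {m : ℕ} (hm : 0 < m) {p : ℝ} (hp : 2 ≤ p) {w δ : Fin m → ℝ}
    (hw : ∀ e, 0 < w e) (hδ : ∀ e, 0 ≤ δ e) (hΦ : ∑ e, w e ^ p ≤ 256 * m)
    (hE : ∑ e, w e ^ (p - 2) * δ e ^ 2 ≤ energyBound m p) (hτ : lpPow p δ ≤ mwuTau m p) :
    ∑ e, (w e + mwuAlpha m p * δ e) ^ p ≤ ∑ e, w e ^ p + 17 * m / mwuT m p := by
  have hm' : (0 : ℝ) < m := by exact_mod_cast hm
  have h0 : 0 < p := by linarith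
  have hα := mwuAlpha_pos hm hp
  have hT : (0 : ℝ) < mwuT m p := by exact_mod_cast mwuT_pos hm p
  set α := mwuAlpha m p with hαdef
  set T : ℝ := ((mwuT m p : ℕ) : ℝ) with hTdef
  set F := ∑ e, w e ^ (p - 2) * w e * δ e with hF
  set E := ∑ e, w e ^ (p - 2) * δ e ^ 2 with hEdef
  have hstep : ∑ e, (w e + α * δ e) ^ p ≤
      ∑ e, w e ^ p + p * α * F + 2 * (p * α) ^ 2 * E + (p * α) ^ p * lpPow p δ := by
    rw [hF, hEdef, lpPow, Finset.mul_sum, Finset.mul_sum, Finset.mul_sum, ← Finset.sum_add_distrib,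
      ← Finset.sum_add_distrib, ← Finset.sum_add_distrib]
    refine Finset.sum_le_sum fun e _ => ?_
    have h1 := abs_add_rpow_le hp (w e) (α * δ e)
    have h2 : 0 ≤ w e + α * δ e := by have := hw e; have := hδ e; positivity
    rw [abs_of_nonneg h2, abs_of_pos (hw e), abs_mul α, Real.mul_rpow (abs_nonneg _) (abs_nonneg _),
      abs_of_pos hα] at h1
    refine h1.trans (le_of_eq ?_)
    rw [Real.mul_rpow h0.le hα.le]
    ring
  have hpα : 0 ≤ p * α := by positivity
  have hpαT : p * α * T ≤ (m : ℝ) ^ (1 / p) / 32 := mul_mwuAlpha_mul_mwuT_le hm hp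
  have hM := rpow_one_div_sq_mul hm hp
  have hG := energyGrowth_le hp
  have hG0 := energyGrowth_pos p
  have hM0 : (0 : ℝ) ≤ (m : ℝ) ^ (1 / p) := by positivity
  have hY0 : (0 : ℝ) < (m : ℝ) ^ ((p - 2) / p) := by positivity
  have hE0 : 0 ≤ E := Finset.sum_nonneg fun e _ => by have := hw e; positivity
  have hL0 := lpPow_nonneg p δ
  -- Cauchy–Schwarz with weights `w^(p-2)` bounds the first order term by potential times energy.
  have hF1 : F ^ 2 ≤ (256 * m) * energyBound m p := by
    have h1 : F ^ 2 ≤ (∑ e, w e ^ p) * E := by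
      have := Finset.sum_mul_sq_le_sq_mul_sq Finset.univ
        (fun e => Real.sqrt (w e ^ (p - 2)) * w e) (fun e => Real.sqrt (w e ^ (p - 2)) * δ e)
      refine le_trans (le_of_eq ?_) (this.trans (le_of_eq ?_))
      · rw [hF]
        congr 1
        refine Finset.sum_congr rfl fun e _ => ?_
        have := Real.mul_self_sqrt (Real.rpow_nonneg (hw e).le (p - 2))
        linear_combination -(w e * δ e) * this
      · rw [hEdef]
        congr 1
        · refine Finset.sum_congr rfl fun e _ => ?_
          rw [mul_pow, Real.sq_sqrt (Real.rpow_nonneg (hw e).le _)]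
          have := abs_rpow_eq_mul_sq (p := p) (hw e).ne'
          rw [abs_of_pos (hw e)] at this
          exact this.symm
        · refine Finset.sum_congr rfl fun e _ => ?_
          rw [mul_pow, Real.sq_sqrt (Real.rpow_nonneg (hw e).le _)]
    exact h1.trans (mul_le_mul hΦ hE hE0 (by positivity))
  -- Multiplied by `T`, the linear, quadratic and power terms are at most `16m`, `m/2` and `m/2`:
  -- the `17m` of the statement.
  have t1 : T * (p * α * F) ≤ 16 * m := by
    refine abs_le_of_sq_le_sq' ?_ (by positivity) |>.2
    have h1 : (p * α * T) ^ 2 ≤ ((m : ℝ) ^ (1 / p) / 32) ^ 2 := by gcongr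
    calc (T * (p * α * F)) ^ 2 = (p * α * T) ^ 2 * F ^ 2 := by ring
      _ ≤ ((m : ℝ) ^ (1 / p) / 32) ^ 2 * ((256 * m) * energyBound m p) := by gcongr
      _ = (((m : ℝ) ^ (1 / p)) ^ 2 * (m : ℝ) ^ ((p - 2) / p)) * m * energyGrowth p / 2 := by
        rw [energyBound]; ring
      _ ≤ m * m * 256 / 2 := by rw [hM]; gcongr
      _ ≤ (16 * m) ^ 2 := by nlinarith
  have t2 : T * (2 * (p * α) ^ 2 * E) ≤ m / 2 := by
    have h1 : p * α ≤ (m : ℝ) ^ (1 / p) / 64 := mul_mwuAlpha_le hm hp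
    calc T * (2 * (p * α) ^ 2 * E) = 2 * ((p * α) * (p * α * T)) * E := by ring
      _ ≤ 2 * ((m : ℝ) ^ (1 / p) / 64 * ((m : ℝ) ^ (1 / p) / 32)) * energyBound m p := by gcongr
      _ = (((m : ℝ) ^ (1 / p)) ^ 2 * (m : ℝ) ^ ((p - 2) / p)) * energyGrowth p / 512 := by
        rw [energyBound]; ring
      _ ≤ m * 256 / 512 := by rw [hM]; gcongr
      _ = m / 2 := by ring
  have t3 : T * ((p * α) ^ p * lpPow p δ) ≤ m / 2 := by
    have h1 := mul_mwuAlpha_rpow_mul_mwuTau hm hp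
    have h2 : T ≤ 2 * mwuX m p := by linarith [mwuT_lt hm p, one_le_mwuX hm hp]
    have h3 : (1 / 2 : ℝ) ^ p ≤ (1 / 2) ^ (2 : ℝ) :=
      Real.rpow_le_rpow_of_exponent_ge (by norm_num) (by norm_num) hp
    have h4 : 0 ≤ (p * α) ^ p := by positivity
    have h5 := mwuX_pos hm p
    have h6 := mwuTau_pos hm p
    calc T * ((p * α) ^ p * lpPow p δ) ≤ 2 * mwuX m p * ((p * α) ^ p * mwuTau m p) := by gcongr
      _ = 2 * ((1 / 2 : ℝ) ^ p * m) := by rw [← h1]; ring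
      _ ≤ 2 * ((1 / 2) ^ (2 : ℝ) * m) := by gcongr
      _ = m / 2 := by norm_num; ring
  refine hstep.trans ?_
  rw [add_assoc, add_assoc, add_le_add_iff_left, le_div_iff₀ hT]
  linarith

open scoped Classical in
/-- The weights after a width reduction step. -/
noncomputable def widthUpdate {m : ℕ} (p : ℝ) (w δ : Fin m → ℝ) (e : Fin m) : ℝ :=
  if mwuRho m p ≤ δ e ∧ w e ^ (p - 2) ≤ mwuBeta m p then (2 : ℝ) ^ (1 / (p - 2)) * w e else w e

/-- At `p = 2` every resistance is `x^0 = 1` and `β = 1/2`, so no coordinate is ever doubled and the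
meaningless exponent `1/(p-2)` is never used. -/
theorem two_lt_of_rpow_le_mwuBeta {m : ℕ} {p : ℝ} (hp : 2 ≤ p) {x : ℝ}
    (h : x ^ (p - 2) ≤ mwuBeta m p) : 2 < p := by
  rcases hp.eq_or_lt with rfl | h2
  · norm_num [mwuBeta] at h
  · exact h2

theorem rpow_two_mul_rpow {p : ℝ} (hp : 2 < p) {x : ℝ} (hx : 0 ≤ x) :
    ((2 : ℝ) ^ (1 / (p - 2)) * x) ^ (p - 2) = 2 * x ^ (p - 2) := by
  have : p - 2 ≠ 0 := by linarith
  rw [Real.mul_rpow (by positivity) hx, ← Real.rpow_mul (by norm_num), one_div_mul_cancel this,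
    Real.rpow_one]

theorem widthUpdate_ge {m : ℕ} {p : ℝ} (hp : 2 ≤ p) {w δ : Fin m → ℝ} {e : Fin m}
    (hw : 0 ≤ w e) : w e ≤ widthUpdate p w δ e := by
  unfold widthUpdate
  split_ifs with h
  · exact le_mul_of_one_le_left hw (Real.one_le_rpow (by norm_num)
      (one_div_nonneg.2 (by linarith)))
  · exact le_rfl

/-- Effect of a width reduction step on `∑ wₑ^p`. -/
theorem sum_rpow_widthUpdate_le {m : ℕ} (hm : 0 < m) {p : ℝ} (hp : 2 ≤ p)
    (hpm : (p - 2) * p ≤ (p - 2) * Real.log m) {w δ : Fin m → ℝ} (hw : ∀ e, 0 < w e)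
    (hE : ∑ e, w e ^ (p - 2) * δ e ^ 2 ≤ energyBound m p) :
    ∑ e, widthUpdate p w δ e ^ p ≤ ∑ e, w e ^ p + 200 * m / (mwuT m p + 1) := by
  have hm' : (0 : ℝ) < m := by exact_mod_cast hm
  have hX := mwuX_pos hm p
  have hρ := mwuRho_pos hm p
  set b := 2 * (m : ℝ) ^ (2 / (3 * p - 2)) / mwuRho m p ^ 2 with hb
  have hb0 : 0 ≤ b := by positivity
  have h1 : ∀ e, widthUpdate p w δ e ^ p ≤ w e ^ p + b * (w e ^ (p - 2) * δ e ^ 2) := by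
    intro e
    have hwe := hw e
    unfold widthUpdate
    split_ifs with h
    · have hp2 := two_lt_of_rpow_le_mwuBeta hp h.2
      have hne : p - 2 ≠ 0 := by linarith
      set w' := (2 : ℝ) ^ (1 / (p - 2)) * w e with hw'
      have hw'0 : 0 < w' := by positivity
      have e1 : w' ^ (p - 2) = 2 * w e ^ (p - 2) := rpow_two_mul_rpow hp2 hwe.le
      -- A doubled resistance is at most `2β = X`; its power `2/(p-2)` is the square of the weight.
      have e2 : w' ^ 2 ≤ (m : ℝ) ^ (2 / (3 * p - 2)) := by
        have h3 : w' ^ (p - 2) ≤ mwuX m p := by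
          rw [e1]
          have := h.2
          unfold mwuBeta at this
          unfold mwuX
          linarith
        have h4 : (w' ^ (p - 2)) ^ (2 / (p - 2)) ≤ mwuX m p ^ (2 / (p - 2)) :=
          Real.rpow_le_rpow (by positivity) h3 (div_nonneg (by norm_num) (by linarith))
        rw [← Real.rpow_mul hw'0.le, mul_div_cancel₀ _ hne, Real.rpow_two, mwuX,
          ← Real.rpow_mul hm'.le] at h4
        refine h4.trans (le_of_eq ?_)
        congr 1
        have : 3 * p - 2 ≠ 0 := by linarith
        field_simp
      have e3 : w' ^ p = w' ^ (p - 2) * w' ^ 2 := by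
        have := abs_rpow_eq_mul_sq (p := p) hw'0.ne'
        rwa [abs_of_pos hw'0] at this
      have e4 : mwuRho m p ^ 2 ≤ δ e ^ 2 := by
        have := h.1
        gcongr
      -- Since `δ ≥ ρ` on a doubled coordinate, its resistance is charged to its share of the
      -- energy.
      have e5 : w e ^ (p - 2) ≤ w e ^ (p - 2) * δ e ^ 2 / mwuRho m p ^ 2 := by
        rw [le_div_iff₀ (by positivity)]
        gcongr
      calc w' ^ p = 2 * w e ^ (p - 2) * w' ^ 2 := by rw [e3, e1]
        _ ≤ 2 * (w e ^ (p - 2) * δ e ^ 2 / mwuRho m p ^ 2) * (m : ℝ) ^ (2 / (3 * p - 2)) := by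
          gcongr
        _ = b * (w e ^ (p - 2) * δ e ^ 2) := by rw [hb]; ring
        _ ≤ _ := by
          have : 0 ≤ w e ^ p := by positivity
          linarith
    · have : 0 ≤ b * (w e ^ (p - 2) * δ e ^ 2) := by positivity
      linarith
  have h2 : ∑ e, widthUpdate p w δ e ^ p ≤ ∑ e, w e ^ p + b * energyBound m p := by
    refine (Finset.sum_le_sum fun e _ => h1 e).trans ?_
    rw [Finset.sum_add_distrib, ← Finset.mul_sum]
    gcongr
  refine h2.trans ?_
  have hT : (0 : ℝ) ≤ mwuT m p := Nat.cast_nonneg _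
  rw [add_le_add_iff_left, le_div_iff₀ (by linarith)]
  have h3 : (mwuT m p : ℝ) + 1 ≤ 3 * mwuX m p := by
    linarith [mwuT_lt hm p, one_le_mwuX hm hp]
  have hG := energyGrowth_le_mul_mwuX hm hp hpm
  have hG0 := energyGrowth_pos p
  have key := rpow_mul_sq_mwuX_eq hm hp
  have e6 : b * energyBound m p * mwuX m p ^ 2 = 4 * energyGrowth p * m := by
    rw [hb, energyBound]
    field_simp
    linear_combination 4 * key
  have h4 : b * energyBound m p = 4 * energyGrowth p * m / mwuX m p ^ 2 := by
    rw [← e6]; field_simp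
  calc b * energyBound m p * (mwuT m p + 1)
      ≤ b * energyBound m p * (3 * mwuX m p) := by
        have := energyBound_pos hm p
        gcongr
    _ = 12 * energyGrowth p * m / mwuX m p := by rw [h4]; field_simp; ring
    _ ≤ 200 * mwuX m p * m / mwuX m p := by gcongr
    _ = 200 * m := by field_simp

/-- A width reduction step doubles coordinates that carry much of the energy. -/
theorem le_sum_widthUpdate_sub {m : ℕ} (hm : 0 < m) {p : ℝ} (hp : 2 ≤ p) {w δ : Fin m → ℝ}
    (hw : ∀ e, 1 ≤ w e) (hδ : ∀ e, 0 ≤ δ e)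
    (hE : ∑ e, w e ^ (p - 2) * δ e ^ 2 ≤ energyBound m p) (hτ : mwuTau m p < lpPow p δ) :
    2 * energyBound m p / mwuX m p ≤
      ∑ e, (widthUpdate p w δ e ^ (p - 2) - w e ^ (p - 2)) * δ e ^ 2 := by
  classical
  have hm' : (0 : ℝ) < m := by exact_mod_cast hm
  have h0 : 0 < p := by linarith
  have hX := mwuX_pos hm p
  have hρ := mwuRho_pos hm p
  have hτ0 := mwuTau_pos hm p
  have hG0 := energyGrowth_pos p
  have hY0 : (0 : ℝ) < (m : ℝ) ^ ((p - 2) / p) := by positivity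
  have hβ : 0 < mwuBeta m p := half_pos hX
  have hr : ∀ e, 1 ≤ w e ^ (p - 2) := fun e => Real.one_le_rpow (hw e) (by linarith)
  set H := Finset.univ.filter fun e => mwuRho m p ≤ δ e ∧ w e ^ (p - 2) ≤ mwuBeta m p with hH
  have e1 : ∀ e, δ e ^ p = (δ e ^ 2) ^ (p / 2) := by
    intro e
    rw [← Real.rpow_two, ← Real.rpow_mul (hδ e)]
    congr 1; field_simp
  -- Weights are at least `1`, so doubling a resistance adds at least `δ²` to the energy.
  have hgain : ∑ e ∈ H, δ e ^ 2 ≤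
      ∑ e, (widthUpdate p w δ e ^ (p - 2) - w e ^ (p - 2)) * δ e ^ 2 := by
    rw [hH, Finset.sum_filter]
    refine Finset.sum_le_sum fun e _ => ?_
    unfold widthUpdate
    split_ifs with h
    · rw [rpow_two_mul_rpow (two_lt_of_rpow_le_mwuBeta hp h.2) (by linarith [hw e])]
      nlinarith [mul_le_mul_of_nonneg_right (hr e) (sq_nonneg (δ e))]
    · simp
  -- A coordinate outside `H` is either narrower than `ρ` or heavier than `β`. Each kind contributes
  -- at most `τ/4`, which leaves at least `τ/2` for `H`.
  have hsplit : lpPow p δ ≤ ∑ e ∈ H, δ e ^ p + (mwuRho m p ^ (p - 2) * energyBound m p +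
      (energyBound m p / mwuBeta m p) ^ (p / 2)) := by
    have h1 : ∀ e, δ e ^ p ≤ (if mwuRho m p ≤ δ e ∧ w e ^ (p - 2) ≤ mwuBeta m p then δ e ^ p else 0)
        + (mwuRho m p ^ (p - 2) * (w e ^ (p - 2) * δ e ^ 2) +
          (w e ^ (p - 2) * δ e ^ 2 / mwuBeta m p) ^ (p / 2)) := by
      intro e
      have hwe : 0 < w e := by linarith [hw e]
      have a1 : 0 ≤ mwuRho m p ^ (p - 2) * (w e ^ (p - 2) * δ e ^ 2) := by positivity
      have a2 : 0 ≤ (w e ^ (p - 2) * δ e ^ 2 / mwuBeta m p) ^ (p / 2) := by positivity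
      split_ifs with h
      · linarith
      · rw [not_and_or, not_le, not_le] at h
        rcases h with h | h
        · have a3 : δ e ^ p ≤ mwuRho m p ^ (p - 2) * (w e ^ (p - 2) * δ e ^ 2) := by
            rcases (hδ e).eq_or_lt with hd | hd
            · rw [← hd, Real.zero_rpow h0.ne']; simp
            · have := abs_rpow_eq_mul_sq (p := p) hd.ne'
              rw [abs_of_pos hd] at this
              rw [this]
              have a4 : δ e ^ (p - 2) ≤ mwuRho m p ^ (p - 2) :=
                Real.rpow_le_rpow hd.le h.le (by linarith)
              have a5 : δ e ^ 2 ≤ w e ^ (p - 2) * δ e ^ 2 :=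
                le_mul_of_one_le_left (sq_nonneg _) (hr e)
              gcongr
          linarith
        · have a3 : δ e ^ p ≤ (w e ^ (p - 2) * δ e ^ 2 / mwuBeta m p) ^ (p / 2) := by
            rw [e1]
            refine Real.rpow_le_rpow (sq_nonneg _) ?_ (by linarith)
            rw [le_div_iff₀ hβ, mul_comm]
            gcongr
          linarith
    have h2 : lpPow p δ = ∑ e, δ e ^ p :=
      Finset.sum_congr rfl fun e _ => by rw [abs_of_nonneg (hδ e)]
    rw [h2]
    refine (Finset.sum_le_sum fun e _ => h1 e).trans ?_
    rw [Finset.sum_add_distrib, Finset.sum_add_distrib, ← Finset.mul_sum, hH, Finset.sum_filter]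
    have h3 : ∑ e, (w e ^ (p - 2) * δ e ^ 2 / mwuBeta m p) ^ (p / 2) ≤
        (energyBound m p / mwuBeta m p) ^ (p / 2) := by
      have hnn : ∀ e, 0 ≤ w e ^ (p - 2) * δ e ^ 2 / mwuBeta m p := fun e => by
        have hwe : 0 < w e := by linarith [hw e]
        positivity
      refine (sum_rpow_le_rpow_sum _ (fun e _ => hnn e) (by linarith)).trans ?_
      refine Real.rpow_le_rpow (Finset.sum_nonneg fun e _ => hnn e) ?_ (by linarith)
      rw [← Finset.sum_div]
      gcongr
    gcongr
  have b1 : mwuRho m p ^ (p - 2) * energyBound m p ≤ mwuTau m p / 4 := by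
    have h1 := mwuRho_rpow_mul hm hp
    have h2 : 8 * energyGrowth p ≤ 32 ^ p := by
      have h3 := energyGrowth_le_rpow hp
      have h4 : (16 : ℝ) ^ p = 16 ^ (p - 2) * 256 := by
        rw [show (256 : ℝ) = 16 ^ (2 : ℝ) by norm_num, ← Real.rpow_add (by norm_num)]
        congr 1; ring
      have h5 : (16 : ℝ) ^ p ≤ 32 ^ p := Real.rpow_le_rpow (by norm_num) (by norm_num) h0.le
      have h6 : (0 : ℝ) < 16 ^ (p - 2) := by positivity
      linarith
    calc mwuRho m p ^ (p - 2) * energyBound m p = 2 * energyGrowth p * (mwuTau m p / 32 ^ p) := by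
          rw [← h1, energyBound]; ring
      _ ≤ 2 * (32 ^ p / 8) * (mwuTau m p / 32 ^ p) := by gcongr; linarith
      _ = mwuTau m p / 4 := by field_simp; norm_num
  have b2 : (energyBound m p / mwuBeta m p) ^ (p / 2) ≤ mwuTau m p / 4 := by
    have h1 : energyBound m p / mwuBeta m p =
        4 * energyGrowth p * ((m : ℝ) ^ ((p - 2) / p) / mwuX m p) := by
      have : mwuBeta m p = mwuX m p / 2 := rfl
      rw [this, energyBound]
      field_simp
      norm_num
    rw [h1, Real.mul_rpow (by positivity) (by positivity), rpow_div_mwuX_rpow hm hp,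
      Real.mul_rpow (by norm_num) hG0.le, energyGrowth_rpow hp]
    have h2 : (4 : ℝ) ^ (p / 2) = 2 ^ p := by
      rw [show (4 : ℝ) = 2 ^ (2 : ℝ) by norm_num, ← Real.rpow_mul (by norm_num)]
      congr 1; field_simp
    have h3 : (32 : ℝ) ^ p = 2 ^ p * (16 ^ (p - 2) * 256) := by
      rw [show (256 : ℝ) = 16 ^ (2 : ℝ) by norm_num, ← Real.rpow_add (by norm_num),
        sub_add_cancel, ← Real.mul_rpow (by norm_num) (by norm_num)]
      norm_num
    rw [h2, h3]
    have h4 : (0 : ℝ) < 16 ^ (p - 2) := by positivity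
    have h5 : (0 : ℝ) < 2 ^ p := by positivity
    have : 2 ^ p * 16 ^ (p - 2) * (mwuTau m p / (2 ^ p * (16 ^ (p - 2) * 256))) = mwuTau m p / 256 := by
      field_simp
    rw [this]
    linarith
  have hHτ : mwuTau m p / 2 ≤ ∑ e ∈ H, δ e ^ p := by linarith
  -- As `p/2 ≥ 1`, the sum of the `p/2`-th powers of `δ²` is at most the `p/2`-th power of their
  -- sum.
  have hfin : (mwuTau m p / 2) ^ (2 / p) ≤ ∑ e ∈ H, δ e ^ 2 := by
    have hS : 0 ≤ ∑ e ∈ H, δ e ^ 2 := Finset.sum_nonneg fun e _ => sq_nonneg _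
    have h1 : mwuTau m p / 2 ≤ (∑ e ∈ H, δ e ^ 2) ^ (p / 2) := by
      refine hHτ.trans ?_
      simp only [e1]
      exact sum_rpow_le_rpow_sum _ (fun e _ => sq_nonneg _) (by linarith)
    have h2 := Real.rpow_le_rpow (by positivity) h1 (by positivity : 0 ≤ 2 / p)
    rwa [← Real.rpow_mul hS, show p / 2 * (2 / p) = 1 by field_simp, Real.rpow_one] at h2
  refine le_trans ?_ (hfin.trans hgain)
  have h1 : mwuTau m p = (1024 * ((m : ℝ) ^ ((p - 2) / p) / mwuX m p)) ^ (p / 2) := by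
    rw [Real.mul_rpow (by norm_num) (by positivity), rpow_div_mwuX_rpow hm hp,
      show (1024 : ℝ) = 32 ^ (2 : ℝ) by norm_num, ← Real.rpow_mul (by norm_num),
      show 2 * (p / 2) = p by field_simp]
    field_simp
  rw [Real.div_rpow hτ0.le (by norm_num), h1, ← Real.rpow_mul (by positivity),
    show p / 2 * (2 / p) = 1 by field_simp, Real.rpow_one, le_div_iff₀ (by positivity), energyBound]
  have h2 := energyGrowth_mul_two_rpow_le hp
  calc 2 * (2 * (energyGrowth p * (m : ℝ) ^ ((p - 2) / p))) / mwuX m p * 2 ^ (2 / p)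
      = 4 * (energyGrowth p * 2 ^ (2 / p)) * ((m : ℝ) ^ ((p - 2) / p) / mwuX m p) := by ring
    _ ≤ 4 * 256 * ((m : ℝ) ^ ((p - 2) / p) / mwuX m p) := by gcongr
    _ = _ := by norm_num

/-! ### The energy minimized by the oracle -/

theorem dotProduct_transpose_diagonal_mulVec {m n : ℕ} (N : Matrix (Fin m) (Fin n) ℝ)
    (D : Fin m → ℝ) (u v : Fin n → ℝ) :
    u ⬝ᵥ (N.transpose * Matrix.diagonal D * N) *ᵥ v = ∑ e, D e * (N *ᵥ u) e * (N *ᵥ v) e := by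
  rw [← Matrix.mulVec_mulVec, ← Matrix.mulVec_mulVec, Matrix.dotProduct_mulVec,
    Matrix.vecMul_transpose]
  simp only [dotProduct, Matrix.mulVec_diagonal]
  exact Finset.sum_congr rfl fun e _ => by ring

theorem isSymm_transpose_diagonal {m n : ℕ} (N : Matrix (Fin m) (Fin n) ℝ) (D : Fin m → ℝ) :
    (N.transpose * Matrix.diagonal D * N).IsSymm := by
  simp [Matrix.IsSymm, Matrix.transpose_mul, Matrix.mul_assoc]

/-- The energy minimized by the oracle, in units of `ζ^(2/p)`. -/
noncomputable def mwuEnergy {m n : ℕ} (R : Matrix (Fin n) (Fin n) ℝ)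
    (N : Matrix (Fin m) (Fin n) ℝ) (ζ p : ℝ) (w : Fin m → ℝ) (Δ : Fin n → ℝ) : ℝ :=
  (m : ℝ) ^ ((p - 2) / p) * (Δ ⬝ᵥ R *ᵥ Δ) / ζ +
    ∑ e, w e ^ (p - 2) * (|(N *ᵥ Δ) e| / ζ ^ (1 / p)) ^ 2

theorem dotProduct_oracle_mulVec {m n : ℕ} (R : Matrix (Fin n) (Fin n) ℝ)
    (N : Matrix (Fin m) (Fin n) ℝ) {ζ p : ℝ} (hζ : 0 < ζ) (hp : 2 ≤ p) (w : Fin m → ℝ)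
    (Δ : Fin n → ℝ) :
    Δ ⬝ᵥ ((((m : ℝ) ^ ((p - 2) / p) * ζ ^ (-((p - 2) / p))) • R
      + N.transpose * Matrix.diagonal (fun e => w e ^ (p - 2)) * N) *ᵥ Δ) =
      ζ ^ (2 / p) * mwuEnergy R N ζ p w Δ := by
  have h0 : p ≠ 0 := by linarith
  rw [Matrix.add_mulVec, dotProduct_add, dotProduct_transpose_diagonal_mulVec, Matrix.smul_mulVec,
    dotProduct_smul, smul_eq_mul, mwuEnergy, mul_add, Finset.mul_sum]
  have e1 : ζ ^ (-((p - 2) / p)) = ζ ^ (2 / p) / ζ := by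
    rw [← Real.rpow_sub_one hζ.ne']
    congr 1
    field_simp
    ring
  have e2 : ζ ^ (2 / p) = (ζ ^ (1 / p)) ^ 2 := by
    rw [← Real.rpow_two, ← Real.rpow_mul hζ.le]
    congr 1
    field_simp
  congr 1
  · rw [e1]; ring
  · refine Finset.sum_congr rfl fun e _ => ?_
    have : ζ ^ (1 / p) ≠ 0 := by positivity
    rw [e2, div_pow, sq_abs]
    field_simp

theorem returns_mwuOracle (S : LinearSolver) {m n : ℕ} {ι : Type} [Fintype ι]
    (C : Matrix ι (Fin n) ℝ) {R : Matrix (Fin n) (Fin n) ℝ} (N : Matrix (Fin m) (Fin n) ℝ)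
    (c : ι → ℝ) {ζ p : ℝ} {w : Fin m → ℝ} (hR : R.IsSymm) (hRpos : ∀ v, 0 ≤ v ⬝ᵥ R *ᵥ v)
    (hζ : 0 < ζ) (hp : 2 ≤ p) (hw : ∀ e, 0 ≤ w e) :
    Returns (mwuOracle S C R N c ζ p w) (fun o =>
      (∀ Δ, o = some Δ → C *ᵥ Δ = c ∧ ∀ Δ', C *ᵥ Δ' = c →
        mwuEnergy R N ζ p w Δ' = mwuEnergy R N ζ p w Δ + mwuEnergy R N ζ p w (Δ' - Δ)) ∧
      (o = none → ∀ Δ, C *ᵥ Δ ≠ c)) 1 := by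
  refine (returns_quadMin S C c ?_ ?_).mono ?_ le_rfl
  · exact (hR.smul _).add (isSymm_transpose_diagonal N _)
  · intro v
    rw [dotProduct_oracle_mulVec R N hζ hp]
    have := hRpos v
    unfold mwuEnergy
    have : 0 ≤ ∑ e, w e ^ (p - 2) * (|(N *ᵥ v) e| / ζ ^ (1 / p)) ^ 2 :=
      Finset.sum_nonneg fun e _ => by have := hw e; positivity
    positivity
  · rintro o ⟨h1, h2⟩
    refine ⟨fun Δ hΔ => ⟨(h1 Δ hΔ).1, fun Δ' hΔ' => ?_⟩, h2⟩
    have h3 := (h1 Δ hΔ).2 Δ' hΔ'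
    rw [dotProduct_oracle_mulVec R N hζ hp, dotProduct_oracle_mulVec R N hζ hp,
      dotProduct_oracle_mulVec R N hζ hp, ← mul_add] at h3
    exact mul_left_cancel₀ (by positivity) h3

theorem lpPow_abs_div {m : ℕ} {ζ p : ℝ} (hζ : 0 < ζ) (hp : 0 < p) (v : Fin m → ℝ) :
    lpPow p (fun e => |v e| / ζ ^ (1 / p)) = lpPow p v / ζ := by
  rw [lpPow, lpPow, Finset.sum_div]
  refine Finset.sum_congr rfl fun e _ => ?_
  rw [abs_div, abs_abs, Real.div_rpow (abs_nonneg _) (abs_nonneg _),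
    abs_of_pos (by positivity : 0 < ζ ^ (1 / p)), ← Real.rpow_mul hζ.le,
    one_div_mul_cancel hp.ne', Real.rpow_one]

/-- `ζ` is an upper bound for both terms of the objective at some feasible point. -/
def FeasibleScale {m n : ℕ} {ι : Type} (C : Matrix ι (Fin n) ℝ)
    (R : Matrix (Fin n) (Fin n) ℝ) (N : Matrix (Fin m) (Fin n) ℝ) (c : ι → ℝ) (ζ p : ℝ) : Prop :=
  ∃ Δ, C *ᵥ Δ = c ∧ Δ ⬝ᵥ R *ᵥ Δ ≤ ζ ∧ lpPow p (N *ᵥ Δ) ≤ ζ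

/-- The quadratic part is at most `m^((p-2)/p)`, and Hölder bounds the weighted part by the
potential to the power `(p-2)/p`; `energyBound` is twice the larger of the two bounds. -/
theorem mwuEnergy_le_energyBound {m n : ℕ} {R : Matrix (Fin n) (Fin n) ℝ}
    {N : Matrix (Fin m) (Fin n) ℝ} {ζ p : ℝ} {w : Fin m → ℝ} {Δ : Fin n → ℝ} (hζ : 0 < ζ)
    (hp : 2 ≤ p) (hw : ∀ e, 0 < w e) (hΦ : ∑ e, w e ^ p ≤ 256 * m)
    (hΔ : Δ ⬝ᵥ R *ᵥ Δ ≤ ζ) (hΔ' : lpPow p (N *ᵥ Δ) ≤ ζ) :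
    mwuEnergy R N ζ p w Δ ≤ energyBound m p := by
  have h0 : 0 < p := by linarith
  have hexp : 0 ≤ (p - 2) / p := div_nonneg (by linarith) h0.le
  have hY : 0 ≤ (m : ℝ) ^ ((p - 2) / p) := by positivity
  have hG : 1 ≤ energyGrowth p := Real.one_le_rpow (by norm_num) hexp
  have h1 : (m : ℝ) ^ ((p - 2) / p) * (Δ ⬝ᵥ R *ᵥ Δ) / ζ ≤ (m : ℝ) ^ ((p - 2) / p) := by
    rw [div_le_iff₀ hζ]
    gcongr
  have h2 := sum_rpow_sub_two_mul_sq_le hp (v := fun e => |(N *ᵥ Δ) e| / ζ ^ (1 / p)) hw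
  rw [lpPow_abs_div hζ h0] at h2
  have h3 : (lpPow p (N *ᵥ Δ) / ζ) ^ (2 / p) ≤ 1 :=
    Real.rpow_le_one (div_nonneg (lpPow_nonneg _ _) hζ.le) ((div_le_one hζ).2 hΔ') (by positivity)
  have hS : 0 ≤ ∑ e, w e ^ p := Finset.sum_nonneg fun e _ => by have := hw e; positivity
  have h4 : (∑ e, w e ^ p) ^ ((p - 2) / p) ≤ energyGrowth p * (m : ℝ) ^ ((p - 2) / p) := by
    rw [energyGrowth, ← Real.mul_rpow (by norm_num) (Nat.cast_nonneg _)]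
    exact Real.rpow_le_rpow hS hΦ hexp
  have h5 : (∑ e, w e ^ p) ^ ((p - 2) / p) * (lpPow p (N *ᵥ Δ) / ζ) ^ (2 / p) ≤
      (∑ e, w e ^ p) ^ ((p - 2) / p) := mul_le_of_le_one_right (by positivity) h3
  unfold mwuEnergy energyBound
  nlinarith

/-! ### The loop of the multiplicative weight update solver -/

/-- This is the triangle inequality for the seminorm of `R`, without square roots: nonnegativity at
`i y - x` bounds the cross term. The case `i = 0` is separate because the argument divides by `i`.
-/
theorem quadForm_add_le {n : ℕ} {R : Matrix (Fin n) (Fin n) ℝ} (hR : R.IsSymm)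
    (hRpos : ∀ v, 0 ≤ v ⬝ᵥ R *ᵥ v) {x y : Fin n → ℝ} {i : ℕ} {B : ℝ}
    (hx : x ⬝ᵥ R *ᵥ x ≤ i ^ 2 * B) (hy : y ⬝ᵥ R *ᵥ y ≤ B) (hx0 : i = 0 → x = 0) :
    (x + y) ⬝ᵥ R *ᵥ (x + y) ≤ ((i + 1 : ℕ) : ℝ) ^ 2 * B := by
  rcases Nat.eq_zero_or_pos i with rfl | hi
  · simpa [hx0 rfl] using hy
  · have hi' : (0 : ℝ) < i := by exact_mod_cast hi
    have h1 := hRpos ((i : ℝ) • y - x)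
    have h2 := hR.dotProduct_mulVec_comm x y
    simp only [Matrix.mulVec_sub, Matrix.mulVec_add, Matrix.mulVec_smul, dotProduct_sub,
      sub_dotProduct, dotProduct_add, add_dotProduct, smul_dotProduct, dotProduct_smul,
      smul_eq_mul] at h1 ⊢
    refine le_of_mul_le_mul_left ?_ hi'
    push_cast
    rw [h2] at h1 ⊢
    nlinarith [mul_le_mul_of_nonneg_left hy (by positivity : (0 : ℝ) ≤ i * (i + 1)),
      mul_le_mul_of_nonneg_left hx (by positivity : (0 : ℝ) ≤ i + 1)]

/-- Invariant of the loop if `ζ` is large enough. -/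
structure MWUInvariant {m n : ℕ} {ι : Type} (C : Matrix ι (Fin n) ℝ)
    (R : Matrix (Fin n) (Fin n) ℝ) (N : Matrix (Fin m) (Fin n) ℝ) (c : ι → ℝ) (ζ p : ℝ)
    (s : MWUState m n) : Prop where
  one_le : ∀ e, 1 ≤ s.w e
  sum_le : ∑ e, s.w e ^ p ≤ m + s.i * (17 * m / mwuT m p) + s.k * (200 * m / (mwuT m p + 1))
  le_energy : ∀ Δ, C *ᵥ Δ = c → s.k * (energyBound m p / mwuX m p) ≤ mwuEnergy R N ζ p s.w Δ
  feasible : ¬ s.infeasible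
  k_le : s.k ≤ mwuT m p
  le_weight : ∀ e, mwuAlpha m p * (|(N *ᵥ s.x) e| / ζ ^ (1 / p)) ≤ s.w e
  quad_le : s.x ⬝ᵥ R *ᵥ s.x ≤ s.i ^ 2 * (512 * ζ)

/-- The total `m + 17m + 200m` is below `256m`. The count `k = T + 1` is admitted because the bound
is applied right after a width step, before `k ≤ T` is known again. -/
theorem sum_rpow_le_of_counts {m : ℕ} (p : ℝ) {i k : ℕ} (hi : i ≤ mwuT m p)
    (hk : k ≤ mwuT m p + 1) {Φ : ℝ}
    (h : Φ ≤ m + i * (17 * m / mwuT m p) + k * (200 * m / (mwuT m p + 1))) : Φ ≤ 256 * m := by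
  have hm : (0 : ℝ) ≤ m := Nat.cast_nonneg m
  have hi' : (i : ℝ) ≤ mwuT m p := by exact_mod_cast hi
  have hk' : (k : ℝ) ≤ mwuT m p + 1 := by exact_mod_cast hk
  have h1 : i * (17 * m / mwuT m p : ℝ) ≤ 17 * m := by
    rcases Nat.eq_zero_or_pos (mwuT m p) with h0 | h0
    · simp [h0]
    · have h0' : (0 : ℝ) < mwuT m p := by exact_mod_cast h0
      calc i * (17 * m / mwuT m p : ℝ) ≤ mwuT m p * (17 * m / mwuT m p) := by gcongr
        _ = 17 * m := by field_simp
  have h2 : k * (200 * m / (mwuT m p + 1) : ℝ) ≤ 200 * m := by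
    have h0' : (0 : ℝ) < mwuT m p + 1 := by positivity
    calc k * (200 * m / (mwuT m p + 1) : ℝ) ≤ (mwuT m p + 1) * (200 * m / (mwuT m p + 1)) := by
          gcongr
      _ = 200 * m := by field_simp
  linarith

/-- Growing weights only raise the energy, so its lower bound survives. The weights grow by `α`
times the normalized `|N Δ|`, so by the triangle inequality they keep dominating the accumulated
iterate. -/
theorem MWUInvariant.primal {m n : ℕ} {ι : Type} {C : Matrix ι (Fin n) ℝ}
    {R : Matrix (Fin n) (Fin n) ℝ} {N : Matrix (Fin m) (Fin n) ℝ} {c : ι → ℝ} {ζ p : ℝ}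
    {s : MWUState m n} (hI : MWUInvariant C R N c ζ p s) (hm : 0 < m) (hR : R.IsSymm)
    (hRpos : ∀ v, 0 ≤ v ⬝ᵥ R *ᵥ v) (hζ : 0 < ζ) (hp : 2 ≤ p) (hi : s.i < mwuT m p)
    (hx : s.i = 0 → s.x = 0) {Δ : Fin n → ℝ} (hE : mwuEnergy R N ζ p s.w Δ ≤ energyBound m p)
    (hτ : lpPow p (N *ᵥ Δ) ≤ mwuTau m p * ζ) :
    MWUInvariant C R N c ζ p { s with
        w := fun e => s.w e + mwuAlpha m p * |N.mulVec Δ e| / ζ ^ (1 / p)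
        x := s.x + Δ
        i := s.i + 1 } := by
  have hm' : (0 : ℝ) < m := by exact_mod_cast hm
  have h0 : 0 < p := by linarith
  have hα := mwuAlpha_pos hm hp
  have hw0 : ∀ e, 0 < s.w e := fun e => by linarith [hI.one_le e]
  have hζp : 0 < ζ ^ (1 / p) := by positivity
  set δ : Fin m → ℝ := fun e => |(N *ᵥ Δ) e| / ζ ^ (1 / p) with hδ
  have hδ0 : ∀ e, 0 ≤ δ e := fun e => by positivity
  have hw' : (fun e => s.w e + mwuAlpha m p * |N.mulVec Δ e| / ζ ^ (1 / p)) =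
      fun e => s.w e + mwuAlpha m p * δ e := by
    funext e; rw [hδ, mul_div_assoc]
  rw [hw']
  have hsum0 : 0 ≤ ∑ e, s.w e ^ (p - 2) * δ e ^ 2 :=
    Finset.sum_nonneg fun e _ => by have := hw0 e; positivity
  have hquad0 : 0 ≤ (m : ℝ) ^ ((p - 2) / p) * (Δ ⬝ᵥ R *ᵥ Δ) / ζ := by
    have := hRpos Δ
    positivity
  have hE1 : ∑ e, s.w e ^ (p - 2) * δ e ^ 2 ≤ energyBound m p := by
    unfold mwuEnergy at hE; linarith
  have hE2 : Δ ⬝ᵥ R *ᵥ Δ ≤ 512 * ζ := by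
    have h1 : (m : ℝ) ^ ((p - 2) / p) * (Δ ⬝ᵥ R *ᵥ Δ) / ζ ≤ energyBound m p := by
      unfold mwuEnergy at hE; linarith
    rw [div_le_iff₀ hζ, energyBound] at h1
    have h2 : (0 : ℝ) < (m : ℝ) ^ ((p - 2) / p) := by positivity
    refine le_of_mul_le_mul_left (h1.trans ?_) h2
    have := energyGrowth_le hp
    calc 2 * (energyGrowth p * (m : ℝ) ^ ((p - 2) / p)) * ζ ≤ 2 * (256 * (m : ℝ) ^ ((p - 2) / p)) * ζ := by
          gcongr
      _ = _ := by ring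
  have hτ' : lpPow p δ ≤ mwuTau m p := by
    rw [hδ, lpPow_abs_div hζ h0, div_le_iff₀ hζ]
    exact hτ
  have hΦ := sum_rpow_le_of_counts p hi.le (hI.k_le.trans (Nat.le_succ _)) hI.sum_le
  exact
    { one_le := fun e => by
        have h1 := hI.one_le e
        have h2 : 0 ≤ mwuAlpha m p * δ e := mul_nonneg hα.le (hδ0 e)
        change 1 ≤ s.w e + mwuAlpha m p * δ e
        linarith
      sum_le := by
        refine (sum_rpow_primal_le hm hp hw0 hδ0 hΦ hE1 hτ').trans ?_
        have := hI.sum_le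
        push_cast
        linarith
      le_energy := fun Δ' hΔ' => by
        refine (hI.le_energy Δ' hΔ').trans ?_
        unfold mwuEnergy
        gcongr with e
        · exact (hw0 e).le
        · have h2 : 0 ≤ mwuAlpha m p * δ e := mul_nonneg hα.le (hδ0 e)
          change s.w e ≤ s.w e + mwuAlpha m p * δ e
          linarith
      feasible := hI.feasible
      k_le := hI.k_le
      le_weight := fun e => by
        have h1 := hI.le_weight e
        change mwuAlpha m p * (|(N *ᵥ (s.x + Δ)) e| / ζ ^ (1 / p)) ≤ s.w e + mwuAlpha m p * δ e
        have h2 : |(N *ᵥ (s.x + Δ)) e| / ζ ^ (1 / p) ≤ |(N *ᵥ s.x) e| / ζ ^ (1 / p) + δ e := by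
          rw [hδ, ← add_div, Matrix.mulVec_add, Pi.add_apply]
          gcongr
          exact abs_add_le _ _
        nlinarith [mul_le_mul_of_nonneg_left h2 hα.le]
      quad_le := quadForm_add_le hR hRpos hI.quad_le hE2 hx }

/-- A width step raises the energy of every feasible point by at least `energyBound / X`, whereas a
feasible point of scale `ζ` has energy at most `energyBound`. Hence the number of width steps never
exceeds `X ≤ T`. -/
theorem MWUInvariant.width {m n : ℕ} {ι : Type} {C : Matrix ι (Fin n) ℝ}
    {R : Matrix (Fin n) (Fin n) ℝ} {N : Matrix (Fin m) (Fin n) ℝ} {c : ι → ℝ} {ζ p : ℝ}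
    {s : MWUState m n} (hI : MWUInvariant C R N c ζ p s) (hm : 0 < m)
    (hRpos : ∀ v, 0 ≤ v ⬝ᵥ R *ᵥ v) (hζ : 0 < ζ) (hp : 2 ≤ p)
    (hpm : (p - 2) * p ≤ (p - 2) * Real.log m) (hfeas : FeasibleScale C R N c ζ p)
    (hi : s.i ≤ mwuT m p) {Δ : Fin n → ℝ} (hC : C *ᵥ Δ = c)
    (hmin : ∀ Δ', C *ᵥ Δ' = c →
        mwuEnergy R N ζ p s.w Δ' = mwuEnergy R N ζ p s.w Δ + mwuEnergy R N ζ p s.w (Δ' - Δ))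
    (hE : mwuEnergy R N ζ p s.w Δ ≤ energyBound m p)
    (hτ : mwuTau m p * ζ < lpPow p (N *ᵥ Δ)) :
    MWUInvariant C R N c ζ p { s with
        w := widthUpdate p s.w (fun e => |(N *ᵥ Δ) e| / ζ ^ (1 / p))
        k := s.k + 1 } := by
  have hm' : (0 : ℝ) < m := by exact_mod_cast hm
  have h0 : 0 < p := by linarith
  have hw0 : ∀ e, 0 < s.w e := fun e => by linarith [hI.one_le e]
  have hζp : 0 < ζ ^ (1 / p) := by positivity
  set δ : Fin m → ℝ := fun e => |(N *ᵥ Δ) e| / ζ ^ (1 / p) with hδ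
  have hδ0 : ∀ e, 0 ≤ δ e := fun e => by positivity
  have hw1 : ∀ e, s.w e ≤ widthUpdate p s.w δ e := fun e => widthUpdate_ge hp (hw0 e).le
  have hquad0 : ∀ v, 0 ≤ (m : ℝ) ^ ((p - 2) / p) * (v ⬝ᵥ R *ᵥ v) / ζ := fun v => by
    have := hRpos v
    positivity
  have hE1 : ∑ e, s.w e ^ (p - 2) * δ e ^ 2 ≤ energyBound m p := by
    have := hquad0 Δ
    unfold mwuEnergy at hE; linarith
  have hτ' : mwuTau m p < lpPow p δ := by
    rw [hδ, lpPow_abs_div hζ h0, lt_div_iff₀ hζ]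
    exact hτ
  have hsum : ∑ e, widthUpdate p s.w δ e ^ p ≤
      m + s.i * (17 * m / mwuT m p) + ((s.k + 1 : ℕ) : ℝ) * (200 * m / (mwuT m p + 1)) := by
    refine (sum_rpow_widthUpdate_le hm hp hpm hw0 hE1).trans ?_
    have := hI.sum_le
    push_cast
    linarith
  have hX := mwuX_pos hm p
  have hE0 := energyBound_pos hm p
  have hgain := le_sum_widthUpdate_sub hm hp hI.one_le hδ0 hE1 hτ'
  have hener : ∀ Δ', C *ᵥ Δ' = c → ((s.k + 1 : ℕ) : ℝ) * (energyBound m p / mwuX m p) ≤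
      mwuEnergy R N ζ p (widthUpdate p s.w δ) Δ' := by
    intro Δ' hΔ'
    have h1 := hI.le_energy Δ hC
    have h2 := hmin Δ' hΔ'
    have h3 : mwuEnergy R N ζ p (widthUpdate p s.w δ) Δ' = mwuEnergy R N ζ p s.w Δ' +
        ∑ e, (widthUpdate p s.w δ e ^ (p - 2) - s.w e ^ (p - 2)) *
          (|(N *ᵥ Δ') e| / ζ ^ (1 / p)) ^ 2 := by
      unfold mwuEnergy
      rw [add_assoc, ← Finset.sum_add_distrib]
      congr 1
      exact Finset.sum_congr rfl fun e _ => by ring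
    -- A feasible `Δ'` pays either for its distance to the minimizer `Δ` or for the added
    -- resistance: `a² ≤ 2(a' - a)² + 2a'²`, and the increase `g` is at most the old resistance. So
    -- half of the gain at `Δ` carries over to all feasible points, and the new minimizer is not
    -- needed.
    have h4 : ∑ e, (widthUpdate p s.w δ e ^ (p - 2) - s.w e ^ (p - 2)) * δ e ^ 2 ≤
        2 * (mwuEnergy R N ζ p s.w (Δ' - Δ) +
          ∑ e, (widthUpdate p s.w δ e ^ (p - 2) - s.w e ^ (p - 2)) *
          (|(N *ᵥ Δ') e| / ζ ^ (1 / p)) ^ 2) := by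
      have h5 := hquad0 (Δ' - Δ)
      have h6 : ∑ e, (widthUpdate p s.w δ e ^ (p - 2) - s.w e ^ (p - 2)) * δ e ^ 2 ≤
          2 * (∑ e, s.w e ^ (p - 2) * (|(N *ᵥ (Δ' - Δ)) e| / ζ ^ (1 / p)) ^ 2 +
          ∑ e, (widthUpdate p s.w δ e ^ (p - 2) - s.w e ^ (p - 2)) *
          (|(N *ᵥ Δ') e| / ζ ^ (1 / p)) ^ 2) := by
        rw [← Finset.sum_add_distrib, Finset.mul_sum]
        refine Finset.sum_le_sum fun e _ => ?_
        have h7 : 0 ≤ widthUpdate p s.w δ e ^ (p - 2) - s.w e ^ (p - 2) ∧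
            widthUpdate p s.w δ e ^ (p - 2) - s.w e ^ (p - 2) ≤ s.w e ^ (p - 2) := by
          have hr : 0 < s.w e ^ (p - 2) := by have := hw0 e; positivity
          unfold widthUpdate
          split_ifs with h
          · rw [rpow_two_mul_rpow (two_lt_of_rpow_le_mwuBeta hp h.2) (hw0 e).le]
            constructor <;> linarith
          · rw [sub_self]
            exact ⟨le_rfl, hr.le⟩
        set g := widthUpdate p s.w δ e ^ (p - 2) - s.w e ^ (p - 2)
        simp only [hδ, Matrix.mulVec_sub, Pi.sub_apply, div_pow, sq_abs]
        set a := (N *ᵥ Δ) e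
        set a' := (N *ᵥ Δ') e
        have h8 : g * a ^ 2 ≤ 2 * (s.w e ^ (p - 2) * (a' - a) ^ 2 + g * a' ^ 2) := by
          have h9 : g * (a' - a) ^ 2 ≤ s.w e ^ (p - 2) * (a' - a) ^ 2 :=
            mul_le_mul_of_nonneg_right h7.2 (sq_nonneg _)
          nlinarith [mul_nonneg h7.1 (sq_nonneg (2 * a' - a))]
        calc g * (a ^ 2 / (ζ ^ (1 / p)) ^ 2) = g * a ^ 2 / (ζ ^ (1 / p)) ^ 2 := by ring
          _ ≤ 2 * (s.w e ^ (p - 2) * (a' - a) ^ 2 + g * a' ^ 2) / (ζ ^ (1 / p)) ^ 2 := by gcongr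
          _ = _ := by ring
      unfold mwuEnergy
      linarith
    rw [h3, h2]
    have h10 : 2 * energyBound m p / mwuX m p = 2 * (energyBound m p / mwuX m p) := by ring
    rw [h10] at hgain
    push_cast
    linarith
  have hk : s.k + 1 ≤ mwuT m p := by
    obtain ⟨Δ₀, hC₀, hq₀, hl₀⟩ := hfeas
    have hΦ' := sum_rpow_le_of_counts p hi (Nat.succ_le_succ hI.k_le) hsum
    have hle := mwuEnergy_le_energyBound (R := R) (N := N) hζ hp
      (fun e => (hw0 e).trans_le (hw1 e)) hΦ' hq₀ hl₀
    have h1 := (hener Δ₀ hC₀).trans hle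
    have h2 : ((s.k + 1 : ℕ) : ℝ) ≤ mwuX m p := by
      rw [← mul_div_assoc, div_le_iff₀ hX, mul_comm] at h1
      exact le_of_mul_le_mul_left h1 hE0
    exact_mod_cast h2.trans (mwuX_le_mwuT m p)
  exact
    { one_le := fun e => (hI.one_le e).trans (hw1 e)
      sum_le := hsum
      le_energy := hener
      feasible := hI.feasible
      k_le := hk
      le_weight := fun e => (hI.le_weight e).trans (hw1 e)
      quad_le := hI.quad_le }

open scoped Classical in
/-- Rank function of the loop. -/
noncomputable def mwuRank {m n : ℕ} (p : ℝ) (s : MWUState m n) : ℝ :=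
  (mwuT m p - s.i) + (mwuT m p - s.k) + if s.infeasible then 0 else 1

/-- Feasibility of the partial sums and the decrease of the rank hold for every guess `ζ`; the
quantitative invariant is claimed only when some feasible point has scale `ζ`. -/
theorem returns_mwuStep (S : LinearSolver) {m n : ℕ} {ι : Type} [Fintype ι]
    (C : Matrix ι (Fin n) ℝ) {R : Matrix (Fin n) (Fin n) ℝ} (N : Matrix (Fin m) (Fin n) ℝ)
    (c : ι → ℝ) {ζ p : ℝ} (hm : 0 < m) (hR : R.IsSymm) (hRpos : ∀ v, 0 ≤ v ⬝ᵥ R *ᵥ v)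
    (hζ : 0 < ζ) (hp : 2 ≤ p) (hpm : (p - 2) * p ≤ (p - 2) * Real.log m) {s : MWUState m n}
    (hw : ∀ e, 1 ≤ s.w e) (hx : C *ᵥ s.x = (s.i : ℝ) • c) (hx0 : s.i = 0 → s.x = 0)
    (hI : FeasibleScale C R N c ζ p → MWUInvariant C R N c ζ p s)
    (hcond : ¬ s.infeasible ∧ s.i < mwuT m p ∧ s.k ≤ mwuT m p) :
    Returns (mwuStep S C R N c ζ p s) (fun s' =>
      ((∀ e, 1 ≤ s'.w e) ∧ C *ᵥ s'.x = (s'.i : ℝ) • c ∧ (s'.i = 0 → s'.x = 0) ∧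
        s'.i ≤ mwuT m p ∧ (FeasibleScale C R N c ζ p → MWUInvariant C R N c ζ p s')) ∧
      mwuRank p s' ≤ mwuRank p s - 1) 1 := by
  classical
  have h0 : 0 < p := by linarith
  have hw0 : ∀ e, 0 < s.w e := fun e => by linarith [hw e]
  have hζp : 0 < ζ ^ (1 / p) := by positivity
  have hα := mwuAlpha_pos hm hp
  obtain ⟨hinf, hi, hk⟩ := hcond
  refine (Returns.bind (c₁ := 1) (c₂ := 0)
    (returns_mwuOracle S C N c hR hRpos hζ hp fun e => (hw0 e).le) ?_).mono (fun _ h => h)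
    (by norm_num)
  rintro (_ | Δ) ⟨h1, h2⟩
  · refine Returns.pure ⟨⟨hw, hx, hx0, hi.le, fun hf => ?_⟩, ?_⟩
    · obtain ⟨Δ₀, hC₀, -⟩ := hf
      exact absurd hC₀ (h2 rfl Δ₀)
    · simp [mwuRank, hinf]
  · obtain ⟨hC, hmin⟩ := h1 Δ rfl
    have hE : FeasibleScale C R N c ζ p → mwuEnergy R N ζ p s.w Δ ≤ energyBound m p := by
      intro hf
      have hI := hI hf
      obtain ⟨Δ₀, hC₀, hq₀, hl₀⟩ := hf
      have h3 := mwuEnergy_le_energyBound (R := R) (N := N) hζ hp hw0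
        (sum_rpow_le_of_counts p hi.le (hk.trans (Nat.le_succ _)) hI.sum_le) hq₀ hl₀
      rw [hmin Δ₀ hC₀] at h3
      have h4 : 0 ≤ mwuEnergy R N ζ p s.w (Δ₀ - Δ) := by
        have h5 := hRpos (Δ₀ - Δ)
        have h6 : 0 ≤ ∑ e, s.w e ^ (p - 2) * (|(N *ᵥ (Δ₀ - Δ)) e| / ζ ^ (1 / p)) ^ 2 :=
          Finset.sum_nonneg fun e _ => by have := hw0 e; positivity
        unfold mwuEnergy
        positivity
      linarith
    dsimp only
    split_ifs with hτ
    · refine Returns.pure ⟨⟨fun e => ?_, ?_, ?_, hi, fun hf =>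
        (hI hf).primal hm hR hRpos hζ hp hi hx0 (hE hf) hτ⟩, ?_⟩
      · have h3 : 0 ≤ mwuAlpha m p * |N.mulVec Δ e| / ζ ^ (1 / p) := by positivity
        have := hw e
        change 1 ≤ s.w e + mwuAlpha m p * |N.mulVec Δ e| / ζ ^ (1 / p)
        linarith
      · simp only [Matrix.mulVec_add, hx, hC]
        push_cast
        rw [add_smul, one_smul]
      · simp
      · simp only [mwuRank, hinf, if_false]
        push_cast
        linarith
    · have hw' : (fun e =>
          if mwuRho m p * ζ ^ (1 / p) ≤ |N.mulVec Δ e| ∧ s.w e ^ (p - 2) ≤ mwuBeta m p then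
            (2 : ℝ) ^ (1 / (p - 2)) * s.w e
          else s.w e) = widthUpdate p s.w (fun e => |(N *ᵥ Δ) e| / ζ ^ (1 / p)) := by
        funext e
        simp only [widthUpdate, le_div_iff₀ hζp]
      rw [hw']
      refine Returns.pure ⟨⟨fun e => (hw e).trans (widthUpdate_ge
        (δ := fun e => |(N *ᵥ Δ) e| / ζ ^ (1 / p)) hp (hw0 e).le), hx, hx0, hi.le,
        fun hf => (hI hf).width hm hRpos hζ hp hpm hf hi.le hC hmin (hE hf) (not_le.1 hτ)⟩, ?_⟩
      simp only [mwuRank, hinf, if_false]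
      push_cast
      linarith

/-- The multiplicative weight update solver terminates after `O(T)` calls; its output is `0` or
feasible, and nearly optimal if `ζ` is large enough. -/
theorem returns_mwuSolver (S : LinearSolver) {m n : ℕ} {ι : Type} [Fintype ι]
    (C : Matrix ι (Fin n) ℝ) {R : Matrix (Fin n) (Fin n) ℝ} (N : Matrix (Fin m) (Fin n) ℝ)
    (c : ι → ℝ) {ζ p : ℝ} (hm : 0 < m) (hR : R.IsSymm) (hRpos : ∀ v, 0 ≤ v ⬝ᵥ R *ᵥ v)
    (hζ : 0 < ζ) (hp : 2 ≤ p) (hpm : (p - 2) * p ≤ (p - 2) * Real.log m) :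
    Returns (mwuSolver S C R N c ζ p) (fun Δ => (Δ = 0 ∨ C *ᵥ Δ = c) ∧
      (FeasibleScale C R N c ζ p → C *ᵥ Δ = c ∧ Δ ⬝ᵥ R *ᵥ Δ ≤ 512 * ζ ∧
        lpPow p (N *ᵥ Δ) ≤ 256 * (64 * p) ^ p * ζ)) (6 * mwuX m p) := by
  have hm' : (0 : ℝ) < m := by exact_mod_cast hm
  have h0 : 0 < p := by linarith
  have hα := mwuAlpha_pos hm hp
  have hζp : 0 < ζ ^ (1 / p) := by positivity
  have hT := mwuT_pos hm p
  have hT' : (0 : ℝ) < mwuT m p := by exact_mod_cast hT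
  have hcost : 1 * ((2 * mwuT m p + 1 : ℝ) + 1) + 0 ≤ 6 * mwuX m p := by
    have h1 := mwuT_lt hm p
    have h2 := one_le_mwuX hm hp
    linarith
  have hloop := Returns.whileLoop
    (cond := fun s : MWUState m n => ¬ s.infeasible ∧ s.i < mwuT m p ∧ s.k ≤ mwuT m p)
    (body := mwuStep S C R N c ζ p)
    (s := { w := fun _ => 1, x := 0, i := 0, k := 0, infeasible := False })
    (fun s => (∀ e, 1 ≤ s.w e) ∧ C *ᵥ s.x = (s.i : ℝ) • c ∧ (s.i = 0 → s.x = 0) ∧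
        s.i ≤ mwuT m p ∧ (FeasibleScale C R N c ζ p → MWUInvariant C R N c ζ p s))
    (mwuRank p) (c := 1) (B := 2 * mwuT m p + 1) zero_le_one (by positivity) ?_ ?_ ?_ ?_
  · refine (hloop.bind (c₂ := 0) ?_).mono (fun _ h => h) hcost
    rintro s ⟨⟨hw, hx, hx0, hi, hI⟩, hc⟩
    refine Returns.pure ⟨?_, fun hf => ?_⟩
    · split_ifs with hiT
      · right
        rw [Matrix.mulVec_smul, hx, hiT, smul_smul, inv_mul_cancel₀ hT'.ne', one_smul]
      · exact Or.inl rfl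
    · have hI := hI hf
      -- For a good `ζ` the loop cannot end by infeasibility or by too many width steps, so all
      -- primal steps were made.
      have hiT : s.i = mwuT m p := by
        by_contra hne
        exact hc ⟨hI.feasible, lt_of_le_of_ne hi hne, hI.k_le⟩
      rw [if_pos hiT]
      refine ⟨?_, ?_, ?_⟩
      · rw [Matrix.mulVec_smul, hx, hiT, smul_smul, inv_mul_cancel₀ hT'.ne', one_smul]
      · have h1 := hI.quad_le
        rw [hiT] at h1
        rw [Matrix.mulVec_smul, dotProduct_smul, smul_dotProduct, smul_eq_mul, smul_eq_mul,
          ← mul_assoc, ← mul_inv, inv_mul_le_iff₀ (by positivity), ← sq]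
        exact h1
      · rw [Matrix.mulVec_smul, lpPow_smul, abs_of_pos (by positivity)]
        have hΦ := sum_rpow_le_of_counts p hi (hI.k_le.trans (Nat.le_succ _)) hI.sum_le
        have h1 : mwuAlpha m p ^ p * (lpPow p (N *ᵥ s.x) / ζ) ≤ 256 * m := by
          rw [← lpPow_abs_div hζ h0, lpPow, Finset.mul_sum]
          refine (Finset.sum_le_sum fun e _ => ?_).trans hΦ
          rw [← Real.mul_rpow hα.le (abs_nonneg _), abs_of_nonneg (by positivity)]
          exact Real.rpow_le_rpow (by positivity) (hI.le_weight e) h0.le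
        -- The choice of `α` gives `m^(1/p) ≤ 64 p α T`, which cancels the `m` in the potential
        -- bound after division by `(α T)^p`.
        have h2 : (m : ℝ) ≤ (64 * p) ^ p * (mwuAlpha m p ^ p * (mwuT m p : ℝ) ^ p) := by
          rw [← Real.mul_rpow hα.le hT'.le, ← Real.mul_rpow (by positivity) (by positivity)]
          have h3 : (m : ℝ) ^ (1 / p) ≤ 64 * p * (mwuAlpha m p * mwuT m p) := by
            have h4 := mul_mwuAlpha_mul_mwuX hm hp
            have h5 := mul_le_mul_of_nonneg_left (mwuX_le_mwuT m p)
              (by positivity : 0 ≤ p * mwuAlpha m p)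
            linarith
          have h4 := Real.rpow_le_rpow (by positivity) h3 h0.le
          rwa [← Real.rpow_mul hm'.le, one_div_mul_cancel h0.ne', Real.rpow_one] at h4
        have hL := lpPow_nonneg p (N *ᵥ s.x)
        have hTp : (0 : ℝ) < (mwuT m p : ℝ) ^ p := by positivity
        have hαp : 0 < mwuAlpha m p ^ p := by positivity
        rw [Real.inv_rpow hT'.le, inv_mul_le_iff₀ hTp]
        rw [← mul_div_assoc, div_le_iff₀ hζ] at h1
        refine le_of_mul_le_mul_left (h1.trans ?_) hαp
        calc 256 * m * ζ ≤ 256 * ((64 * p) ^ p * (mwuAlpha m p ^ p * (mwuT m p : ℝ) ^ p)) * ζ := by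
              gcongr
          _ = _ := by ring
  · rintro s - ⟨hinf, hi, hk⟩
    have hi' : (s.i : ℝ) ≤ mwuT m p := by exact_mod_cast hi.le
    have hk' : (s.k : ℝ) ≤ mwuT m p := by exact_mod_cast hk
    simp only [mwuRank, hinf, if_false]
    linarith
  · rintro s ⟨hw, hx, hx0, -, hI⟩ hcond
    exact returns_mwuStep S C N c hm hR hRpos hζ hp hpm hw hx hx0 hI hcond
  · refine ⟨fun e => le_rfl, by simp, fun _ => rfl, Nat.zero_le _, fun hf => ?_⟩
    exact
      { one_le := fun e => le_rfl
        sum_le := by simp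
        le_energy := fun Δ _ => by
          have h1 := hRpos Δ
          simp only [Nat.cast_zero, zero_mul, mwuEnergy, Real.one_rpow, one_mul]
          positivity
        feasible := not_false
        k_le := Nat.zero_le _
        le_weight := fun e => by simp
        quad_le := by simp }
  · simp only [mwuRank, if_false]
    push_cast
    linarith

/-! ### The residual problem -/

theorem dotProduct_resGrad {m n : ℕ} (N : Matrix (Fin m) (Fin n) ℝ) (p : ℝ) (x Δ : Fin n → ℝ) :
    resGrad N p x ⬝ᵥ Δ = ∑ e, |(N *ᵥ x) e| ^ (p - 2) * (N *ᵥ x) e * (N *ᵥ Δ) e := by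
  rw [resGrad, dotProduct_comm, Matrix.dotProduct_mulVec, Matrix.vecMul_transpose, dotProduct_comm]
  rfl

theorem dotProduct_resQuad_mulVec {m n : ℕ} (N : Matrix (Fin m) (Fin n) ℝ) (p : ℝ)
    (x Δ : Fin n → ℝ) :
    Δ ⬝ᵥ resQuad N p x *ᵥ Δ = 2 * ∑ e, |(N *ᵥ x) e| ^ (p - 2) * (N *ᵥ Δ) e ^ 2 := by
  rw [resQuad, Matrix.smul_mulVec, dotProduct_smul, dotProduct_transpose_diagonal_mulVec,
    smul_eq_mul]
  congr 1
  exact Finset.sum_congr rfl fun e _ => by ring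

theorem resQuad_isSymm {m n : ℕ} (N : Matrix (Fin m) (Fin n) ℝ) (p : ℝ) (x : Fin n → ℝ) :
    (resQuad N p x).IsSymm := (isSymm_transpose_diagonal N _).smul _

theorem resQuad_nonneg {m n : ℕ} (N : Matrix (Fin m) (Fin n) ℝ) (p : ℝ) (x Δ : Fin n → ℝ) :
    0 ≤ Δ ⬝ᵥ resQuad N p x *ᵥ Δ := by
  rw [dotProduct_resQuad_mulVec]
  exact mul_nonneg two_pos.le (Finset.sum_nonneg fun e _ => by positivity)

theorem resObj_eq_sum {m n : ℕ} (N : Matrix (Fin m) (Fin n) ℝ) (p : ℝ) (x Δ : Fin n → ℝ) :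
    resObj N p x Δ = ∑ e, (|(N *ᵥ x) e| ^ (p - 2) * (N *ᵥ x) e * (N *ᵥ Δ) e
      - 2 * (|(N *ᵥ x) e| ^ (p - 2) * (N *ᵥ Δ) e ^ 2) - |(N *ᵥ Δ) e| ^ p) := by
  rw [resObj, dotProduct_resGrad, dotProduct_resQuad_mulVec, lpPow, Finset.sum_sub_distrib,
    Finset.sum_sub_distrib, Finset.mul_sum]

theorem resObj_smul {m n : ℕ} (N : Matrix (Fin m) (Fin n) ℝ) (p : ℝ) (x Δ : Fin n → ℝ) (t : ℝ) :
    resObj N p x (t • Δ) = t * (resGrad N p x ⬝ᵥ Δ) - t ^ 2 * (Δ ⬝ᵥ resQuad N p x *ᵥ Δ)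
      - |t| ^ p * lpPow p (N *ᵥ Δ) := by
  rw [resObj, Matrix.mulVec_smul, Matrix.mulVec_smul, lpPow_smul, dotProduct_smul, dotProduct_smul,
    smul_dotProduct, smul_eq_mul, smul_eq_mul, smul_eq_mul]
  ring

/-- The residual objective bounds the progress of a refinement step from below. -/
theorem resObj_le {m n : ℕ} (N : Matrix (Fin m) (Fin n) ℝ) {p : ℝ} (hp : 2 ≤ p)
    (x Δ : Fin n → ℝ) :
    resObj N p x Δ ≤ lpPow p (N *ᵥ x) - lpPow p (N *ᵥ (x - p⁻¹ • Δ)) := by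
  have h0 : 0 < p := by linarith
  rw [resObj_eq_sum, lpPow, lpPow, ← Finset.sum_sub_distrib]
  refine Finset.sum_le_sum fun e _ => ?_
  rw [Matrix.mulVec_sub, Matrix.mulVec_smul, Pi.sub_apply, Pi.smul_apply, smul_eq_mul]
  set a := (N *ᵥ x) e
  set δ := (N *ᵥ Δ) e
  have h := abs_add_rpow_le hp a (-(p⁻¹ * δ))
  have e1 : p ^ p * |-(p⁻¹ * δ)| ^ p = |δ| ^ p := by
    rw [← Real.mul_rpow h0.le (abs_nonneg _), abs_neg, abs_mul, abs_of_pos (inv_pos.2 h0),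
      mul_inv_cancel_left₀ h0.ne']
  rw [e1, ← sub_eq_add_neg] at h
  have e2 : p * (|a| ^ (p - 2) * a * -(p⁻¹ * δ)) = -(|a| ^ (p - 2) * a * δ) := by field_simp
  have e3 : 2 * p ^ 2 * (|a| ^ (p - 2) * (-(p⁻¹ * δ)) ^ 2) = 2 * (|a| ^ (p - 2) * δ ^ 2) := by
    field_simp
  rw [e2, e3] at h
  linarith

/-- The residual problem captures a `1 / (16 p)` fraction of the possible progress. -/
theorem sub_le_resObj {m n : ℕ} (N : Matrix (Fin m) (Fin n) ℝ) {p : ℝ} (hp : 2 ≤ p)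
    (x y : Fin n → ℝ) :
    lpPow p (N *ᵥ x) - lpPow p (N *ᵥ y) ≤ 16 * p * resObj N p x ((16 : ℝ)⁻¹ • (x - y)) := by
  rw [resObj_eq_sum, lpPow, lpPow, ← Finset.sum_sub_distrib, Finset.mul_sum]
  refine Finset.sum_le_sum fun e _ => ?_
  rw [Matrix.mulVec_smul, Matrix.mulVec_sub, Pi.smul_apply, Pi.sub_apply, smul_eq_mul]
  set a := (N *ᵥ x) e
  set b := (N *ᵥ y) e
  have h := le_abs_add_rpow hp a (b - a)
  have e1 : |(b - a) / 16| = |16⁻¹ * (a - b)| := by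
    rw [← abs_neg]; congr 1; ring
  rw [e1, add_sub_cancel] at h
  linarith

/-- A certificate that the residual problem at `x` has value of order `ζ`. -/
def ResidualScale {d m n : ℕ} (A : Matrix (Fin d) (Fin n) ℝ) (N : Matrix (Fin m) (Fin n) ℝ)
    (p : ℝ) (x : Fin n → ℝ) (ζ : ℝ) : Prop :=
  ∃ Δ, A *ᵥ Δ = 0 ∧ resGrad N p x ⬝ᵥ Δ = ζ / 2 ∧ Δ ⬝ᵥ resQuad N p x *ᵥ Δ ≤ ζ ∧
    lpPow p (N *ᵥ Δ) ≤ ζ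

/-- On a ray with a direction of positive value, some point has its higher order terms bounded by
its value. -/
theorem exists_ray_point {G Q P p : ℝ} (hp : 2 ≤ p) (hQ : 0 ≤ Q) (hP : 0 ≤ P)
    (hpos : 0 < G - Q - P) :
    ∃ t : ℝ, 0 < t ∧ t ≤ 1 ∧ G - Q - P ≤ G * t - Q * t ^ 2 - P * t ^ p ∧
      2 * (Q * t ^ 2 + P * t ^ p) ≤ G * t := by
  have h0 : 0 < p := by linarith
  have hcont : ContinuousOn (fun t : ℝ => G * t - Q * t ^ 2 - P * t ^ p) (Set.Icc 0 1) := by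
    have : Continuous fun t : ℝ => t ^ p := Real.continuous_rpow_const h0.le
    fun_prop
  obtain ⟨t, ht, hmax⟩ := isCompact_Icc.exists_isMaxOn ⟨1, by simp⟩ hcont
  have h1 : G - Q - P ≤ G * t - Q * t ^ 2 - P * t ^ p := by
    have := hmax (show (1 : ℝ) ∈ Set.Icc 0 1 by simp)
    simpa using this
  have htpos : 0 < t := by
    rcases ht.1.eq_or_lt with h | h
    · rw [← h, Real.zero_rpow h0.ne'] at h1
      simp at h1
      linarith
    · exact h
  refine ⟨t, htpos, ht.2, h1, ?_⟩
  set H := Q * t ^ 2 + P * t ^ p with hH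
  by_contra! hlt
  have hH0 : 0 < H := by
    have : 0 ≤ H := by positivity
    rcases this.eq_or_lt with h | h
    · linarith
    · exact h
  have hGt : H < G * t := by linarith
  -- If the higher order terms exceeded half of `G t`, shrinking `t` by the maximizer `l < 1` of `l
  -- ↦ l G t - l² H` would improve on the maximum, because `l^p ≤ l²`.
  set l := G * t / H / 2 with hl
  have hl0 : 0 < l := by
    have : 0 < G * t := hH0.trans hGt
    positivity
  have hl1 : l < 1 := by
    rw [hl, div_div, div_lt_one (by positivity)]
    linarith
  have h2 := hmax (show l * t ∈ Set.Icc (0 : ℝ) 1 from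
    ⟨by positivity, by nlinarith [ht.2]⟩)
  simp only [Set.mem_ofPred_eq] at h2
  rw [Real.mul_rpow hl0.le htpos.le] at h2
  have h3 : l ^ p ≤ l ^ 2 := by
    rw [← Real.rpow_two]
    exact Real.rpow_le_rpow_of_exponent_ge hl0 hl1.le hp
  have h4 : P * (l ^ p * t ^ p) ≤ P * (l ^ 2 * t ^ p) := by gcongr
  have h5 : (1 - l) * ((1 + l) * H - G * t) ≤ 0 := by
    rw [hH]; nlinarith
  have h6 : G * t = 2 * l * H := by rw [hl]; field_simp
  have h7 : 0 < (1 - l) * ((1 + l) * H - G * t) := by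
    rw [h6]
    have : (1 - l) * ((1 + l) * H - 2 * l * H) = (1 - l) ^ 2 * H := by ring
    rw [this]
    have : 0 < 1 - l := by linarith
    positivity
  linarith

/-- If `ν` bounds the suboptimality of `x` up to a factor of `2`, then one of the scales
`ν, ν/2, …` above `ν/(32p)` fits the residual problem at `x`. -/
theorem exists_residualScale {d m n : ℕ} (A : Matrix (Fin d) (Fin n) ℝ)
    (N : Matrix (Fin m) (Fin n) ℝ) {p : ℝ} (hp : 2 ≤ p) {x y : Fin n → ℝ} {ν : ℝ} (hν : 0 < ν)
    (hle : ∀ z, A *ᵥ z = A *ᵥ x → lpPow p (N *ᵥ x) - lpPow p (N *ᵥ z) ≤ ν)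
    (hy : A *ᵥ y = A *ᵥ x) (hlt : ν / 2 < lpPow p (N *ᵥ x) - lpPow p (N *ᵥ y)) :
    ∃ j : ℕ, ν / (32 * p) < ν / 2 ^ j ∧ ResidualScale A N p x (ν / 2 ^ j) := by
  have h0 : 0 < p := by linarith
  set Δ := (16 : ℝ)⁻¹ • (x - y) with hΔ
  have hAΔ : A *ᵥ Δ = 0 := by rw [hΔ, Matrix.mulVec_smul, Matrix.mulVec_sub, hy]; simp
  set G := resGrad N p x ⬝ᵥ Δ
  set Q := Δ ⬝ᵥ resQuad N p x *ᵥ Δ with hQdef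
  set P := lpPow p (N *ᵥ Δ) with hPdef
  have hQ : 0 ≤ Q := resQuad_nonneg N p x Δ
  have hP : 0 ≤ P := lpPow_nonneg _ _
  have hres : ∀ t : ℝ, 0 ≤ t → resObj N p x (t • Δ) = G * t - Q * t ^ 2 - P * t ^ p := by
    intro t ht
    rw [resObj_smul, abs_of_nonneg ht]
    ring
  have hlow : ν / (32 * p) < G - Q - P := by
    have h1 := sub_le_resObj N hp x y
    have h2 := hres 1 zero_le_one
    simp only [one_smul, mul_one, one_pow, Real.one_rpow] at h2
    rw [← hΔ, h2] at h1
    rw [div_lt_iff₀ (by positivity)]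
    linarith
  have hνp : 0 < ν / (32 * p) := by positivity
  obtain ⟨t, ht0, ht1, hopt, hhalf⟩ := exists_ray_point hp hQ hP (hνp.trans hlow)
  set opt := G * t - Q * t ^ 2 - P * t ^ p with hoptdef
  have hoptν : opt ≤ ν := by
    rw [hoptdef, ← hres t ht0.le]
    refine (resObj_le N hp x (t • Δ)).trans (hle _ ?_)
    rw [Matrix.mulVec_sub, Matrix.mulVec_smul, Matrix.mulVec_smul, hAΔ]
    simp
  have hopt0 : 0 < opt := by linarith
  -- Choose the dyadic scale with `ζ/2 < opt ≤ ζ`. The higher order terms are at most half the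
  -- linear one, hence at most `opt ≤ ζ`.
  obtain ⟨j, hj1, hj2⟩ := exists_nat_pow_near ((one_le_div hopt0).2 hoptν) (one_lt_two (α := ℝ))
  have hζ : opt ≤ ν / 2 ^ j := by
    rw [le_div_iff₀ hopt0] at hj1
    rw [le_div_iff₀ (by positivity)]
    linarith
  have hζ2 : ν / 2 ^ j / 2 < opt := by
    rw [div_lt_iff₀ hopt0, pow_succ] at hj2
    rw [div_div, div_lt_iff₀ (by positivity)]
    linarith
  set ζ := ν / 2 ^ j
  have hζ0 : 0 < ζ := by linarith
  have hpart1 : 0 ≤ Q * t ^ 2 := by positivity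
  have hpart2 : 0 ≤ P * t ^ p := by positivity
  have hGt : opt ≤ G * t := by linarith
  have hGt0 : 0 < G * t := by linarith
  -- A further shrinking by `θ ≤ 1` sets the linear term to exactly `ζ/2` and only decreases the
  -- other terms.
  set θ := ζ / 2 / (G * t) with hθ
  have hθ0 : 0 < θ := by positivity
  have hθ1 : θ ≤ 1 := by rw [hθ, div_le_one hGt0]; linarith
  refine ⟨j, by linarith, (θ * t) • Δ, ?_, ?_, ?_, ?_⟩
  · rw [Matrix.mulVec_smul, hAΔ, smul_zero]
  · rw [dotProduct_smul, smul_eq_mul]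
    change θ * t * G = ζ / 2
    have : θ * (G * t) = ζ / 2 := div_mul_cancel₀ _ hGt0.ne'
    linarith
  · rw [Matrix.mulVec_smul, dotProduct_smul, smul_dotProduct, smul_eq_mul, smul_eq_mul, ← hQdef]
    have : θ ^ 2 ≤ 1 := pow_le_one₀ hθ0.le hθ1
    nlinarith [mul_le_of_le_one_left hpart1 this]
  · rw [Matrix.mulVec_smul, lpPow_smul, abs_of_pos (by positivity), Real.mul_rpow hθ0.le ht0.le,
      ← hPdef]
    have : θ ^ p ≤ 1 := Real.rpow_le_one hθ0.le hθ1 h0.le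
    nlinarith [mul_le_of_le_one_left hpart2 this]

/-! ### The residual solvers -/

/-- The hypothesis `hin` transfers a certificate at scale `ζ` to the norm used by the inner solver,
and `hout` transfers its output back. Keeping the best vector makes every good scale count, without
knowing which one it is. -/
theorem returns_residualSearch (S : LinearSolver) {d m n : ℕ} (A : Matrix (Fin d) (Fin n) ℝ)
    (N : Matrix (Fin m) (Fin n) ℝ) {p : ℝ} (x : Fin n → ℝ) {ν q : ℝ}
    (Ntil : ℝ → Matrix (Fin m) (Fin n) ℝ) {scale κ : ℝ} (hm : 0 < m) (hp : 2 ≤ p) (hν : 0 < ν)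
    (hq : 2 ≤ q) (hqm : (q - 2) * q ≤ (q - 2) * Real.log m)
    (hin : ∀ ζ Δ, 0 < ζ → lpPow p (N *ᵥ Δ) ≤ ζ → lpPow q (Ntil ζ *ᵥ Δ) ≤ ζ)
    (hout : ∀ ζ Δ, 0 < ζ → resGrad N p x ⬝ᵥ Δ = ζ / 2 → Δ ⬝ᵥ resQuad N p x *ᵥ Δ ≤ 512 * ζ →
      lpPow q (Ntil ζ *ᵥ Δ) ≤ 256 * (64 * q) ^ q * ζ → ζ / κ ≤ resObj N p x (scale • Δ)) :
    Returns (residualSearch S A N p x ν q Ntil scale) (fun Δ => A *ᵥ Δ = 0 ∧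
      ∀ j : ℕ, ν / (32 * p) < ν / 2 ^ j → ResidualScale A N p x (ν / 2 ^ j) →
        ν / 2 ^ j / κ ≤ resObj N p x Δ)
      (6 * mwuX m q * (Real.logb 2 (32 * p) + 1)) := by
  classical
  have h0 : 0 < p := by linarith
  have hCmul : ∀ Δ, Matrix.fromRows A (Matrix.replicateRow Unit (resGrad N p x)) *ᵥ Δ =
      Sum.elim (A *ᵥ Δ) (fun _ => resGrad N p x ⬝ᵥ Δ) := by
    intro Δ
    rw [Matrix.fromRows_mulVec]
    rfl
  have hC : ∀ Δ ζ, Matrix.fromRows A (Matrix.replicateRow Unit (resGrad N p x)) *ᵥ Δ =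
      Sum.elim (0 : Fin d → ℝ) (fun _ => ζ / 2) ↔ A *ᵥ Δ = 0 ∧ resGrad N p x ⬝ᵥ Δ = ζ / 2 := by
    intro Δ ζ
    rw [hCmul]
    constructor
    · intro h
      exact ⟨funext fun i => by simpa using congrFun h (Sum.inl i), by
        simpa using congrFun h (Sum.inr ())⟩
    · rintro ⟨h1, h2⟩
      rw [h1, h2]
  have hloop := Returns.whileLoop
    (cond := fun s : ℝ × (Fin n → ℝ) => ν / (32 * p) < s.1)
    (body := fun s => do
      let Δ ← mwuSolver S
        (Matrix.fromRows A (Matrix.replicateRow Unit (resGrad N p x))) (resQuad N p x) (Ntil s.1)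
        (Sum.elim 0 (fun _ => s.1 / 2)) s.1 q
      pure (s.1 / 2,
        if resObj N p x s.2 < resObj N p x (scale • Δ) then scale • Δ else s.2))
    (s := (ν, 0))
    (fun s => ∃ j : ℕ, s.1 = ν / 2 ^ j ∧ A *ᵥ s.2 = 0 ∧ ∀ i < j, ν / (32 * p) < ν / 2 ^ i →
      ResidualScale A N p x (ν / 2 ^ i) → ν / 2 ^ i / κ ≤ resObj N p x s.2)
    (fun s => Real.logb 2 (32 * p / ν * s.1)) (c := 6 * mwuX m q) (B := Real.logb 2 (32 * p))
    (by have := mwuX_pos hm q; positivity)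
    (Real.logb_nonneg one_lt_two (by linarith)) ?_ ?_ ?_ ?_
  · refine (hloop.bind (c₂ := 0) ?_).mono (fun _ h => h) (by rw [add_zero])
    rintro s ⟨⟨j, hj, hA, hI⟩, hc⟩
    refine Returns.pure ⟨hA, fun i hi hsc => hI i ?_ hi hsc⟩
    by_contra! hji
    refine hc (hi.trans_le ?_)
    rw [hj]
    gcongr
    norm_num
  · rintro s - hcond
    refine Real.logb_nonneg one_lt_two ?_
    rw [div_lt_iff₀ (by positivity)] at hcond
    rw [div_mul_eq_mul_div, one_le_div hν]
    linarith
  · rintro s ⟨j, hj, hA, hI⟩ hcond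
    have hζ : 0 < s.1 := by rw [hj]; positivity
    refine (Returns.bind (c₂ := 0) (returns_mwuSolver S _ (Ntil s.1) _ hm
      (resQuad_isSymm N p x) (resQuad_nonneg N p x) hζ hq hqm) ?_).mono (fun _ h => h)
      (by rw [add_zero])
    rintro Δ ⟨hΔ, hfeas⟩
    have hAΔ : A *ᵥ (scale • Δ) = 0 := by
      rw [Matrix.mulVec_smul]
      rcases hΔ with rfl | hΔ
      · simp
      · rw [((hC _ _).1 hΔ).1, smul_zero]
    have hge : ∀ b, (b = if resObj N p x s.2 < resObj N p x (scale • Δ) then scale • Δ else s.2) →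
        resObj N p x s.2 ≤ resObj N p x b ∧ resObj N p x (scale • Δ) ≤ resObj N p x b ∧
        A *ᵥ b = 0 := by
      rintro b rfl
      split_ifs with h
      · exact ⟨h.le, le_rfl, hAΔ⟩
      · exact ⟨le_rfl, not_lt.1 h, hA⟩
    obtain ⟨hb1, hb2, hb3⟩ := hge _ rfl
    refine Returns.pure ⟨⟨j + 1, by rw [hj, pow_succ, div_div], hb3, fun i hi hi2 hsc => ?_⟩, ?_⟩
    · rcases Nat.lt_succ_iff_lt_or_eq.1 hi with hi | rfl
      · exact (hI i hi hi2 hsc).trans hb1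
      · refine le_trans ?_ hb2
        obtain ⟨Δ', g1, g2, g3, g4⟩ := hsc
        rw [← hj] at g2 g3 g4 ⊢
        obtain ⟨k1, k2, k3⟩ := hfeas ⟨Δ', (hC _ _).2 ⟨g1, g2⟩, g3, hin _ _ hζ g4⟩
        exact hout _ _ hζ ((hC _ _).1 k1).2 k2 k3
    · have : 32 * p / ν * (s.1 / 2) = 32 * p / ν * s.1 / 2 := by ring
      simp only [this]
      rw [Real.logb_div (by positivity) two_ne_zero, Real.logb_self_eq_one one_lt_two]
  · exact ⟨0, by simp, by simp, by simp⟩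
  · simp only [div_mul_cancel₀ _ hν.ne', le_refl]

/-- Scaling down a solution of large norm solves the residual problem approximately. -/
theorem le_resObj_smul {m n : ℕ} (N : Matrix (Fin m) (Fin n) ℝ) {p : ℝ}
    {x Δ : Fin n → ℝ} {ζ s : ℝ} (hs : 0 < s) (hs' : 4096 * s ≤ 1) (hζ : 0 < ζ)
    (h1 : resGrad N p x ⬝ᵥ Δ = ζ / 2) (h2 : Δ ⬝ᵥ resQuad N p x *ᵥ Δ ≤ 512 * ζ)
    (h3 : s ^ p * lpPow p (N *ᵥ Δ) ≤ s * ζ / 8) :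
    s * ζ / 4 ≤ resObj N p x (s • Δ) := by
  rw [resObj_smul, h1, abs_of_pos hs]
  have h4 : s ^ 2 * (Δ ⬝ᵥ resQuad N p x *ᵥ Δ) ≤ s * ζ / 8 := by
    calc s ^ 2 * (Δ ⬝ᵥ resQuad N p x *ᵥ Δ) ≤ s ^ 2 * (512 * ζ) := by gcongr
      _ = s * ζ / 8 * (4096 * s) := by ring
      _ ≤ s * ζ / 8 * 1 := by gcongr
      _ = s * ζ / 8 := by ring
  linarith

theorem le_two_rpow {p : ℝ} (hp : 0 ≤ p) : p ≤ 2 ^ p := by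
  rcases le_total p 1 with h | h
  · exact h.trans (Real.one_le_rpow (by norm_num) hp)
  · have := one_add_mul_self_le_rpow_one_add (s := 1) (by norm_num) h
    norm_num at this
    linarith

theorem returns_residualSolver (S : LinearSolver) {d m n : ℕ} (A : Matrix (Fin d) (Fin n) ℝ)
    (N : Matrix (Fin m) (Fin n) ℝ) {p : ℝ} (x : Fin n → ℝ) {ν : ℝ} (hm : 0 < m) (hp : 2 ≤ p)
    (hν : 0 < ν) (hpm : p ≤ Real.log m) :
    Returns (residualSolver S A N p x ν) (fun Δ => A *ᵥ Δ = 0 ∧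
      ∀ j : ℕ, ν / (32 * p) < ν / 2 ^ j → ResidualScale A N p x (ν / 2 ^ j) →
        ν / 2 ^ j / (2 ^ 32 * p) ≤ resObj N p x Δ)
      (6 * mwuX m p * (Real.logb 2 (32 * p) + 1)) := by
  have h0 : 0 < p := by linarith
  refine returns_residualSearch S A N x _ hm hp hν hp ?_ (fun _ _ _ h => h) ?_
  · exact mul_le_mul_of_nonneg_left hpm (by linarith)
  intro ζ Δ hζ h1 h2 h3
  have hs : 0 < (2 ^ 30 * p)⁻¹ := by positivity
  refine le_trans (le_of_eq ?_) (le_resObj_smul N hs ?_ hζ h1 h2 ?_)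
  · field_simp; norm_num
  · rw [← div_eq_mul_inv, div_le_one (by positivity)]
    linarith
  · have e1 : (2 ^ 30 * p)⁻¹ ^ p * (256 * (64 * p) ^ p * ζ) = 256 * (2 : ℝ) ^ (-24 * p) * ζ := by
      have : (2 ^ 30 * p)⁻¹ ^ p * (64 * p) ^ p = (2 : ℝ) ^ (-24 * p) := by
        rw [← Real.mul_rpow hs.le (by positivity), Real.rpow_mul (by norm_num)]
        congr 1
        rw [show (-24 : ℝ) = ((-24 : ℤ) : ℝ) by norm_num, Real.rpow_intCast]
        field_simp
        norm_num
      rw [← this]; ring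
    refine (mul_le_mul_of_nonneg_left h3 (by positivity)).trans ?_
    rw [e1]
    -- The scale `2^(-30)/p` turns the loss `(64p)^p` into `2^(-24p)`, which for `p ≥ 2` also
    -- absorbs the constants and the factor `p ≤ 2^p`.
    have h4 : (2 : ℝ) ^ (41 : ℝ) * p * 2 ^ (-24 * p) ≤ 1 := by
      calc (2 : ℝ) ^ (41 : ℝ) * p * 2 ^ (-24 * p) ≤ 2 ^ (41 : ℝ) * 2 ^ p * 2 ^ (-24 * p) := by
            gcongr
            exact le_two_rpow h0.le
        _ = 2 ^ (41 - 23 * p) := by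
            rw [← Real.rpow_add (by norm_num), ← Real.rpow_add (by norm_num)]
            congr 1; ring
        _ ≤ 1 := Real.rpow_le_one_of_one_le_of_nonpos (by norm_num) (by linarith)
    have e2 : (2 ^ 30 * p)⁻¹ * ζ / 8 = ζ / (2 ^ 33 * p) := by field_simp; norm_num
    rw [e2, le_div_iff₀ (by positivity)]
    norm_num at h4
    have e3 : (2 : ℝ) ^ (-24 * p) = 2 ^ (-(24 * p)) := by congr 1; ring
    rw [e3]
    have h5 : 256 * (2 : ℝ) ^ (-(24 * p)) * ζ * (2 ^ 33 * p) =
        (2199023255552 * p * 2 ^ (-(24 * p))) * ζ := by ring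
    rw [h5]
    exact mul_le_of_le_one_left hζ.le h4

/-! ### The norm `log m` in place of `p` -/

theorem two_le_logExp (m : ℕ) : 2 ≤ logExp m := le_max_left _ _

theorem logExp_le {m : ℕ} {p : ℝ} (hp : 2 ≤ p) (hpm : Real.log m ≤ p) : logExp m ≤ p :=
  max_le hp hpm

theorem logExp_sub_two_mul_le (m : ℕ) : (logExp m - 2) * logExp m ≤ (logExp m - 2) * Real.log m := by
  unfold logExp
  rcases le_total (Real.log m) 2 with h | h
  · rw [max_eq_left h]; simp
  · rw [max_eq_right h]

theorem rpow_div_logExp_le {m : ℕ} (hm : 0 < m) {p : ℝ} (hp : 0 ≤ p) :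
    (m : ℝ) ^ (p / logExp m) ≤ 4 ^ p := by
  have hm' : (0 : ℝ) < m := by exact_mod_cast hm
  have hq : 0 < logExp m := two_pos.trans_le (two_le_logExp m)
  have h1 : (m : ℝ) ^ (1 / logExp m) ≤ 4 := by
    rw [Real.rpow_def_of_pos hm']
    have h2 : Real.log m * (1 / logExp m) ≤ 1 := by
      rw [mul_one_div, div_le_one hq]
      exact le_max_right _ _
    have := Real.exp_one_lt_d9
    linarith [Real.exp_le_exp.2 h2]
  calc (m : ℝ) ^ (p / logExp m) = ((m : ℝ) ^ (1 / logExp m)) ^ p := by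
        rw [← Real.rpow_mul hm'.le]; congr 1; field_simp
    _ ≤ 4 ^ p := Real.rpow_le_rpow (by positivity) h1 hp

/-- In the output bound of the logarithmic solver a spare factor `1/m²` has to pay for `1/q`. -/
theorem logExp_le_sq {m : ℕ} (hm : 2 ≤ m) : logExp m ≤ (m : ℝ) ^ 2 := by
  have hm' : (2 : ℝ) ≤ m := by exact_mod_cast hm
  have h1 := Real.log_le_sub_one_of_pos (by linarith : (0 : ℝ) < m)
  exact max_le (by nlinarith) (by nlinarith)

/-- The factor between `N` and the matrix given to the solver for the norm `log m`. -/
noncomputable def logScale (m : ℕ) (p ζ : ℝ) : ℝ :=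
  (4 : ℝ) ^ (-(1 / logExp m)) * ζ ^ (1 / logExp m - 1 / p) * (m : ℝ) ^ (min (1 / p - 1 / logExp m) 0)

theorem lpPow_logScale_smul {m n : ℕ} (hm : 0 < m) {p ζ : ℝ} (hp : 2 ≤ p) (hpm : Real.log m ≤ p)
    (hζ : 0 < ζ) (N : Matrix (Fin m) (Fin n) ℝ) (Δ : Fin n → ℝ) :
    lpPow (logExp m) ((logScale m p ζ • N) *ᵥ Δ) =
      ζ ^ (1 - logExp m / p) * (m : ℝ) ^ (logExp m / p - 1) * lpPow (logExp m) (N *ᵥ Δ) / 4 := by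
  have hm' : (0 : ℝ) < m := by exact_mod_cast hm
  have h0 : 0 < p := by linarith
  have hq : 0 < logExp m := two_pos.trans_le (two_le_logExp m)
  have hqp := logExp_le hp hpm
  -- Here `q ≤ p`, so the first argument is the smaller one.
  have hmin : min (1 / p - 1 / logExp m) 0 = 1 / p - 1 / logExp m :=
    min_eq_left (sub_nonpos.2 (one_div_le_one_div_of_le hq hqp))
  rw [Matrix.smul_mulVec, lpPow_smul, logScale, hmin, abs_of_pos (by positivity)]
  set q := logExp m
  rw [Real.mul_rpow (by positivity) (by positivity), Real.mul_rpow (by positivity) (by positivity),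
    ← Real.rpow_mul (by norm_num), ← Real.rpow_mul hζ.le, ← Real.rpow_mul hm'.le]
  have e1 : -(1 / q) * q = -1 := by field_simp
  have e2 : (1 / q - 1 / p) * q = 1 - q / p := by field_simp
  have e3 : (1 / p - 1 / q) * q = q / p - 1 := by field_simp
  rw [e1, e2, e3, Real.rpow_neg_one]
  ring

/-- Comparing the `q`- and `p`-norms costs `m^(1/q - 1/p)`, which the scaling of the matrix cancels;
a factor `1/4` is left over. -/
theorem lpPow_logScale_smul_le {m n : ℕ} (hm : 0 < m) {p ζ : ℝ} (hp : 2 ≤ p)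
    (hpm : Real.log m ≤ p) (hζ : 0 < ζ) {N : Matrix (Fin m) (Fin n) ℝ} {Δ : Fin n → ℝ}
    (h : lpPow p (N *ᵥ Δ) ≤ ζ) : lpPow (logExp m) ((logScale m p ζ • N) *ᵥ Δ) ≤ ζ := by
  have hm' : (0 : ℝ) < m := by exact_mod_cast hm
  have h0 : 0 < p := by linarith
  have hq : 0 < logExp m := two_pos.trans_le (two_le_logExp m)
  have hqp := logExp_le hp hpm
  rw [lpPow_logScale_smul hm hp hpm hζ]
  set q := logExp m
  set Lq := lpPow q (N *ᵥ Δ) with hLq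
  have hLq0 : 0 ≤ Lq := lpPow_nonneg _ _
  have h1 : Lq ^ (p / q) ≤ (m : ℝ) ^ (p / q - 1) * ζ :=
    (rpow_lpPow_le_mul_lpPow hq hqp _).trans (mul_le_mul_of_nonneg_left h (by positivity))
  have h2 : Lq ≤ (m : ℝ) ^ (1 - q / p) * ζ ^ (q / p) := by
    have h3 := Real.rpow_le_rpow (by positivity) h1 (by positivity : 0 ≤ q / p)
    rw [← Real.rpow_mul hLq0, Real.mul_rpow (by positivity) hζ.le, ← Real.rpow_mul hm'.le,
      show p / q * (q / p) = 1 by field_simp, Real.rpow_one,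
      show (p / q - 1) * (q / p) = 1 - q / p by field_simp] at h3
    exact h3
  have e : ζ ^ (1 - q / p) * (m : ℝ) ^ (q / p - 1) * ((m : ℝ) ^ (1 - q / p) * ζ ^ (q / p)) = ζ := by
    have e1 : (m : ℝ) ^ (q / p - 1) * (m : ℝ) ^ (1 - q / p) = 1 := by
      rw [← Real.rpow_add hm']; simp
    have e2 : ζ ^ (1 - q / p) * ζ ^ (q / p) = ζ := by
      rw [← Real.rpow_add hζ]; simp
    calc _ = ζ ^ (1 - q / p) * ζ ^ (q / p) * ((m : ℝ) ^ (q / p - 1) * (m : ℝ) ^ (1 - q / p)) := by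
          ring
      _ = ζ := by rw [e1, e2, mul_one]
  have h4 := mul_le_mul_of_nonneg_left h2
    (by positivity : 0 ≤ ζ ^ (1 - q / p) * (m : ℝ) ^ (q / p - 1))
  rw [e] at h4
  linarith

/-- The `p`-norm is at most the `q`-norm, so the only loss on the way back is the scaling itself, a
factor `m^(p/q - 1) ≤ 4^p / m`. -/
theorem lpPow_le_of_logScale {m n : ℕ} (hm : 0 < m) {p ζ B : ℝ} (hp : 2 ≤ p)
    (hpm : Real.log m ≤ p) (hζ : 0 < ζ) (hB : 0 ≤ B) {N : Matrix (Fin m) (Fin n) ℝ} {Δ : Fin n → ℝ}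
    (h : lpPow (logExp m) ((logScale m p ζ • N) *ᵥ Δ) ≤ B * ζ) :
    lpPow p (N *ᵥ Δ) ≤ (4 * B) ^ (p / logExp m) * (m : ℝ) ^ (p / logExp m - 1) * ζ := by
  have hm' : (0 : ℝ) < m := by exact_mod_cast hm
  have h0 : 0 < p := by linarith
  have hq : 0 < logExp m := two_pos.trans_le (two_le_logExp m)
  have hqp := logExp_le hp hpm
  rw [lpPow_logScale_smul hm hp hpm hζ] at h
  have hL := lpPow_le_rpow_lpPow hq hqp (N *ᵥ Δ)
  set q := logExp m
  set Lq := lpPow q (N *ᵥ Δ) with hLq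
  have hLq0 : 0 ≤ Lq := lpPow_nonneg _ _
  have e1 : (m : ℝ) ^ (q / p - 1) * (m : ℝ) ^ (1 - q / p) = 1 := by
    rw [← Real.rpow_add hm']; simp
  have e2 : ζ ^ (1 - q / p) * ζ ^ (q / p) = ζ := by
    rw [← Real.rpow_add hζ]; simp
  have h2 : Lq ≤ 4 * B * (ζ ^ (q / p) * (m : ℝ) ^ (1 - q / p)) := by
    refine le_of_mul_le_mul_left ?_
      (by positivity : 0 < ζ ^ (1 - q / p) * (m : ℝ) ^ (q / p - 1))
    calc ζ ^ (1 - q / p) * (m : ℝ) ^ (q / p - 1) * Lq ≤ 4 * (B * ζ) := by linarith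
      _ = 4 * B * (ζ ^ (1 - q / p) * ζ ^ (q / p) * ((m : ℝ) ^ (q / p - 1) * (m : ℝ) ^ (1 - q / p))) := by
        rw [e1, e2]; ring
      _ = _ := by ring
  refine hL.trans ((Real.rpow_le_rpow hLq0 h2 (by positivity)).trans (le_of_eq ?_))
  rw [Real.mul_rpow (x := 4 * B) (by positivity) (by positivity),
    Real.mul_rpow (x := ζ ^ (q / p)) (by positivity) (by positivity),
    ← Real.rpow_mul hζ.le, ← Real.rpow_mul hm'.le, show q / p * (p / q) = 1 by field_simp,
    Real.rpow_one, show (1 - q / p) * (p / q) = p / q - 1 by field_simp]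
  ring

theorem returns_logResidualSolver (S : LinearSolver) {d m n : ℕ} (A : Matrix (Fin d) (Fin n) ℝ)
    (N : Matrix (Fin m) (Fin n) ℝ) {p : ℝ} (x : Fin n → ℝ) {ν : ℝ} (hm : 2 ≤ m) (hp : 2 ≤ p)
    (hν : 0 < ν) (hpm : Real.log m ≤ p) :
    Returns (logResidualSolver S A N p x ν) (fun Δ => A *ᵥ Δ = 0 ∧
      ∀ j : ℕ, ν / (32 * p) < ν / 2 ^ j → ResidualScale A N p x (ν / 2 ^ j) →
        ν / 2 ^ j / (2 ^ 32 * logExp m * (m : ℝ) ^ (1 / (p - 1))) ≤ resObj N p x Δ)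
      (6 * mwuX m (logExp m) * (Real.logb 2 (32 * p) + 1)) := by
  have hm0 : 0 < m := by linarith
  have hm' : (0 : ℝ) < m := by exact_mod_cast hm0
  have hm1 : (1 : ℝ) ≤ m := by exact_mod_cast hm0
  have h0 : 0 < p := by linarith
  have h2q := two_le_logExp m
  refine returns_residualSearch S A N x (fun ζ => logScale m p ζ • N) hm0 hp hν h2q
    (logExp_sub_two_mul_le m) (fun ζ Δ hζ h => lpPow_logScale_smul_le hm0 hp hpm hζ h) ?_
  intro ζ Δ hζ h1 h2 h3
  have hL := lpPow_le_of_logScale hm0 hp hpm hζ (by positivity) h3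
  have hmq := rpow_div_logExp_le hm0 h0.le
  have hqm2 := logExp_le_sq hm
  set q := logExp m
  have hq : 0 < q := by linarith
  set u := (m : ℝ) ^ (1 / (p - 1)) with hu
  have hu0 : 0 < u := by positivity
  have hu1 : 1 ≤ u := Real.one_le_rpow hm1 (one_div_nonneg.2 (by linarith))
  have hs : (2 ^ 30 * q)⁻¹ * (m : ℝ) ^ (-(1 / (p - 1))) = (2 ^ 30 * q)⁻¹ * u⁻¹ := by
    rw [Real.rpow_neg hm'.le]
  rw [hs]
  have hs0 : 0 < (2 ^ 30 * q)⁻¹ * u⁻¹ := by positivity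
  refine le_trans (le_of_eq ?_) (le_resObj_smul N hs0 ?_ hζ h1 h2 ?_)
  · field_simp; norm_num
  · rw [← mul_inv, ← div_eq_mul_inv, div_le_one (by positivity)]
    nlinarith [mul_le_mul hu1 h2q zero_le_two hu0.le]
  -- The exponent `1/(p-1)` makes the `p`-th power of the scale smaller than the scale by exactly
  -- `m`. With the `1/m` from the change of norm this gives the spare `1/m²`.
  · have hup : u⁻¹ ^ p = u⁻¹ * (m : ℝ)⁻¹ := by
      rw [hu, ← Real.rpow_neg hm'.le, ← Real.rpow_neg_one (m : ℝ), ← Real.rpow_mul hm'.le,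
        ← Real.rpow_add hm']
      congr 1
      have : p - 1 ≠ 0 := by linarith
      field_simp
      ring
    have e0 : ((64 * q) ^ q) ^ (p / q) = (64 * q) ^ p := by
      rw [← Real.rpow_mul (by positivity)]
      congr 1; field_simp
    have e1 : (4 * (256 * (64 * q) ^ q)) ^ (p / q) = 1024 ^ (p / q) * (64 * q) ^ p := by
      rw [← e0, ← Real.mul_rpow (by norm_num) (by positivity)]
      congr 1; ring
    have e2 : (2 ^ 30 * q)⁻¹ ^ p * (64 * q) ^ p = (2 : ℝ) ^ (-24 * p) := by
      rw [← Real.mul_rpow (by positivity) (by positivity), Real.rpow_mul (by norm_num)]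
      congr 1
      rw [show (-24 : ℝ) = ((-24 : ℤ) : ℝ) by norm_num, Real.rpow_intCast]
      field_simp
      norm_num
    have h4 : (1024 : ℝ) ^ (p / q) ≤ 2 ^ (5 * p) := by
      rw [show (1024 : ℝ) = 2 ^ (10 : ℝ) by norm_num, ← Real.rpow_mul (by norm_num)]
      refine Real.rpow_le_rpow_of_exponent_le (by norm_num) ?_
      have : p / q ≤ p / 2 := div_le_div_of_nonneg_left h0.le (by norm_num) h2q
      linarith
    have h5 : (m : ℝ) ^ (p / q) ≤ 2 ^ (2 * p) := by
      refine hmq.trans (le_of_eq ?_)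
      rw [show (4 : ℝ) = 2 ^ (2 : ℝ) by norm_num, ← Real.rpow_mul (by norm_num)]
    have h6 : 2 ^ (33 : ℝ) * ((2 : ℝ) ^ (-24 * p) * 2 ^ (5 * p) * 2 ^ (2 * p)) ≤ 1 := by
      rw [← Real.rpow_add (by norm_num), ← Real.rpow_add (by norm_num),
        ← Real.rpow_add (by norm_num)]
      exact Real.rpow_le_one_of_one_le_of_nonpos (by norm_num) (by linarith)
    rw [Real.mul_rpow (by positivity) (by positivity), hup]
    refine (mul_le_mul_of_nonneg_left hL (by positivity)).trans ?_
    rw [e1, Real.rpow_sub_one hm'.ne']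
    calc (2 ^ 30 * q)⁻¹ ^ p * (u⁻¹ * (m : ℝ)⁻¹) *
          (1024 ^ (p / q) * (64 * q) ^ p * ((m : ℝ) ^ (p / q) / m) * ζ)
        = u⁻¹ * ζ * (((2 ^ 30 * q)⁻¹ ^ p * (64 * q) ^ p) * 1024 ^ (p / q) * (m : ℝ) ^ (p / q)) /
          (m : ℝ) ^ 2 := by field_simp
      _ ≤ u⁻¹ * ζ * ((2 : ℝ) ^ (-24 * p) * 2 ^ (5 * p) * 2 ^ (2 * p)) / q := by
          rw [e2]
          gcongr
      _ ≤ u⁻¹ * ζ * (1 / 2 ^ (33 : ℝ)) / q := by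
          gcongr
          rw [le_div_iff₀ (by positivity)]
          linarith
      _ = (2 ^ 30 * q)⁻¹ * u⁻¹ * ζ / 8 := by
          rw [mul_inv]; norm_num; field_simp; norm_num

theorem resApprox_pos {m : ℕ} (hm : 0 < m) {p : ℝ} (hp : 2 ≤ p) : 0 < resApprox m p := by
  have hm' : (0 : ℝ) < m := by exact_mod_cast hm
  have h0 : 0 < p := by linarith
  have hq : 0 < logExp m := two_pos.trans_le (two_le_logExp m)
  unfold resApprox
  split_ifs <;> positivity

/-! ### Iterative refinement -/

/-- The infimum of `‖N y‖_p^p` over the solutions of `A y = b`. -/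
noncomputable def lpOpt {d m n : ℕ} (A : Matrix (Fin d) (Fin n) ℝ) (N : Matrix (Fin m) (Fin n) ℝ)
    (b : Fin d → ℝ) (p : ℝ) : ℝ := sInf ((fun y => lpPow p (N *ᵥ y)) '' {y | A *ᵥ y = b})

theorem lpOpt_le {d m n : ℕ} {A : Matrix (Fin d) (Fin n) ℝ} (N : Matrix (Fin m) (Fin n) ℝ)
    {b : Fin d → ℝ} (p : ℝ) {y : Fin n → ℝ} (hy : A *ᵥ y = b) :
    lpOpt A N b p ≤ lpPow p (N *ᵥ y) := by
  refine csInf_le ⟨0, ?_⟩ ⟨y, hy, rfl⟩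
  rintro _ ⟨z, -, rfl⟩
  exact lpPow_nonneg _ _

theorem lpOpt_nonneg {d m n : ℕ} (A : Matrix (Fin d) (Fin n) ℝ) (N : Matrix (Fin m) (Fin n) ℝ)
    (b : Fin d → ℝ) (p : ℝ) : 0 ≤ lpOpt A N b p := by
  refine Real.sInf_nonneg ?_
  rintro _ ⟨z, -, rfl⟩
  exact lpPow_nonneg _ _

/-- Near-minimizers suffice throughout, so attainment of the infimum is not needed. -/
theorem exists_lpPow_lt {d m n : ℕ} {A : Matrix (Fin d) (Fin n) ℝ} {N : Matrix (Fin m) (Fin n) ℝ}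
    {b : Fin d → ℝ} {p v : ℝ} {x : Fin n → ℝ} (hx : A *ᵥ x = b) (h : lpOpt A N b p < v) :
    ∃ y, A *ᵥ y = b ∧ lpPow p (N *ᵥ y) < v := by
  obtain ⟨_, ⟨y, hy, rfl⟩, hlt⟩ := exists_lt_of_csInf_lt (Set.Nonempty.image _ ⟨x, hx⟩) h
  exact ⟨y, hy, hlt⟩

theorem Returns.ite_bind {α β : Type} {a : Prop} {dec : Decidable a} {x y : Comp α}
    {f : α → Comp β} {P : α → Prop} {Q : β → Prop} {c₁ c₂ : ℝ}
    (h : Returns (@ite _ a dec x y) P c₁) (hf : ∀ a, P a → Returns (f a) Q c₂) :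
    Returns (@ite _ a dec (x >>= f) (y >>= f)) Q (c₁ + c₂) := by
  split_ifs at h ⊢
  · exact h.bind hf
  · exact h.bind hf

/-- The residual solver chosen by the iterative refinement makes progress unless `ν` exceeds twice
the suboptimality of `x`. -/
theorem returns_chosenResidualSolver (S : LinearSolver) {d m n : ℕ} (A : Matrix (Fin d) (Fin n) ℝ)
    (N : Matrix (Fin m) (Fin n) ℝ) {p : ℝ} {x : Fin n → ℝ} {ν : ℝ} (hm : 2 ≤ m) (hp : 2 ≤ p)
    (hν : 0 < ν) (hx : lpPow p (N *ᵥ x) - lpOpt A N (A *ᵥ x) p ≤ ν) {dec : Decidable (Real.log m ≤ p)} :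
    Returns (@ite _ (Real.log m ≤ p) dec (logResidualSolver S A N p x ν) (residualSolver S A N p x ν))
      (fun Δ => A *ᵥ Δ = 0 ∧ (resObj N p x Δ < ν / (32 * p * resApprox m p) →
        lpPow p (N *ᵥ x) - lpOpt A N (A *ᵥ x) p ≤ ν / 2))
      (6 * mwuX m p * (Real.logb 2 (32 * p) + 1)) := by
  have hm0 : 0 < m := by linarith
  have h0 : 0 < p := by linarith
  have hlog : 0 ≤ Real.logb 2 (32 * p) := Real.logb_nonneg one_lt_two (by linarith)
  have key : ∀ Δ, (∀ j : ℕ, ν / (32 * p) < ν / 2 ^ j → ResidualScale A N p x (ν / 2 ^ j) →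
      ν / 2 ^ j / resApprox m p ≤ resObj N p x Δ) →
      resObj N p x Δ < ν / (32 * p * resApprox m p) →
        lpPow p (N *ᵥ x) - lpOpt A N (A *ᵥ x) p ≤ ν / 2 := by
    intro Δ h hlt
    by_contra! hgt
    obtain ⟨y, hy, hylt⟩ := exists_lpPow_lt (A := A) (N := N) (b := A *ᵥ x) (p := p)
      (v := lpPow p (N *ᵥ x) - ν / 2) rfl (by linarith)
    obtain ⟨j, hj1, hj2⟩ := exists_residualScale A N hp hν
      (fun z hz => by linarith [lpOpt_le N p hz]) hy (by linarith)
    have h1 := h j hj1 hj2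
    have hκ := resApprox_pos hm0 hp
    have h2 : ν / (32 * p * resApprox m p) < ν / 2 ^ j / resApprox m p := by
      rw [← div_div]
      gcongr
    linarith
  split_ifs with hpm
  · refine (returns_logResidualSolver S A N x hm hp hν hpm).mono (fun Δ hΔ => ⟨hΔ.1, key Δ ?_⟩) ?_
    · rw [resApprox, if_pos hpm]
      exact hΔ.2
    · have := mwuX_mono hm0 (two_le_logExp m) (logExp_le hp hpm)
      gcongr
  · refine (returns_residualSolver S A N x hm0 hp hν (not_le.1 hpm).le).mono
      (fun Δ hΔ => ⟨hΔ.1, key Δ ?_⟩) le_rfl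
    rw [resApprox, if_neg hpm]
    exact hΔ.2

/-- Iterative refinement reaches additive accuracy `ε`. -/
theorem returns_lpSolver (S : LinearSolver) {d m n : ℕ} (A : Matrix (Fin d) (Fin n) ℝ)
    (N : Matrix (Fin m) (Fin n) ℝ) {p ε M : ℝ} {x₀ : Fin n → ℝ} (hm : 2 ≤ m) (hp : 2 ≤ p)
    (hε : 0 ≤ ε) (hM : 1 ≤ M) (hM' : lpPow p (N *ᵥ x₀) ≤ M * ε) :
    Returns (lpSolver S A N p ε x₀)
      (fun x => A *ᵥ x = A *ᵥ x₀ ∧ ∀ y, A *ᵥ y = A *ᵥ x₀ → lpPow p (N *ᵥ x) ≤ lpPow p (N *ᵥ y) + ε)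
      (6 * mwuX m p * (Real.logb 2 (32 * p) + 1) *
        ((32 * p * resApprox m p + 1) * (1 + Real.logb 2 M))) := by
  classical
  have hm0 : 0 < m := by linarith
  have h0 : 0 < p := by linarith
  have hκ := resApprox_pos hm0 hp
  set D := 32 * p * resApprox m p with hD
  have hD0 : 0 < D := by positivity
  set F := lpOpt A N (A *ᵥ x₀) p with hF
  have hF0 : 0 ≤ F := lpOpt_nonneg _ _ _ _
  have hlog : 0 ≤ Real.logb 2 (32 * p) := Real.logb_nonneg one_lt_two (by linarith)
  have hlogM : 0 ≤ Real.logb 2 M := Real.logb_nonneg one_lt_two hM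
  have hX := mwuX_pos hm0 p
  have hloop := Returns.whileLoop
    (cond := fun s : (Fin n → ℝ) × ℝ => ε < s.2)
    (body := fun s => do
      let Δ ← if Real.log m ≤ p then logResidualSolver S A N p s.1 s.2
        else residualSolver S A N p s.1 s.2
      pure (if s.2 / (32 * p * resApprox m p) ≤ resObj N p s.1 Δ then (s.1 - p⁻¹ • Δ, s.2)
        else (s.1, s.2 / 2)))
    (s := (x₀, lpPow p (N *ᵥ x₀)))
    (fun s => A *ᵥ s.1 = A *ᵥ x₀ ∧ lpPow p (N *ᵥ s.1) - F ≤ s.2 ∧ s.2 ≤ M * ε)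
    -- A successful step removes at least `ν/D` from the gap, so the first term drops by one.
    -- Halving `ν` happens only when the gap is at most `ν/2`; it raises the first term by at most
    -- `D/2` and lowers the second by `D + 1`.
    (fun s => D * ((lpPow p (N *ᵥ s.1) - F) / s.2) + (D + 1) * Real.logb 2 (s.2 / ε))
    (c := 6 * mwuX m p * (Real.logb 2 (32 * p) + 1)) (B := D + (D + 1) * Real.logb 2 M)
    (by positivity) (by positivity) ?_ ?_ ?_ ?_
  · refine (hloop.bind (c₂ := 0) (Q := fun x => A *ᵥ x = A *ᵥ x₀ ∧ ∀ y, A *ᵥ y = A *ᵥ x₀ →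
      lpPow p (N *ᵥ x) ≤ lpPow p (N *ᵥ y) + ε) ?_).mono (fun _ h => h) (le_of_eq (by ring))
    rintro s ⟨⟨hA, hs, -⟩, hc⟩
    refine Returns.pure ⟨hA, fun y hy => ?_⟩
    have := lpOpt_le N p hy
    linarith
  · rintro s ⟨hA, hs, hsM⟩ hcond
    have hs2 : 0 < s.2 := lt_of_le_of_lt hε hcond
    -- If `ε = 0`, the invariant `ν ≤ M ε` forces `ν ≤ 0` and the loop does not run.
    have hε0 : 0 < ε := by
      rcases hε.eq_or_lt with h | h
      · rw [← h] at hsM; linarith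
      · exact h
    have h1 : 0 ≤ lpPow p (N *ᵥ s.1) - F := by linarith [lpOpt_le N p hA]
    have h2 : 0 ≤ Real.logb 2 (s.2 / ε) :=
      Real.logb_nonneg one_lt_two ((one_le_div hε0).2 hcond.le)
    positivity
  · rintro s ⟨hA, hs, hsM⟩ hcond
    have hs2 : 0 < s.2 := lt_of_le_of_lt hε hcond
    have hε0 : 0 < ε := by
      rcases hε.eq_or_lt with h | h
      · rw [← h] at hsM; linarith
      · exact h
    have h1 : 0 ≤ lpPow p (N *ᵥ s.1) - F := by linarith [lpOpt_le N p hA]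
    refine (Returns.ite_bind (c₂ := 0) (returns_chosenResidualSolver S A N (x := s.1) hm hp hs2
      (by rw [hA]; exact hs)) ?_).mono (fun _ h => h) (by rw [add_zero])
    rintro Δ ⟨hAΔ, hΔ⟩
    rw [hA] at hΔ
    refine Returns.pure ?_
    split_ifs with hprog
    · have hA' : A *ᵥ (s.1 - p⁻¹ • Δ) = A *ᵥ x₀ := by
        rw [Matrix.mulVec_sub, Matrix.mulVec_smul, hAΔ, smul_zero, sub_zero, hA]
      have h2 := resObj_le N hp s.1 Δ
      have h3 : s.2 / D ≤ lpPow p (N *ᵥ s.1) - lpPow p (N *ᵥ (s.1 - p⁻¹ • Δ)) := hprog.trans h2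
      have h4 : 0 ≤ s.2 / D := by positivity
      refine ⟨⟨hA', by simp only; linarith, hsM⟩, ?_⟩
      simp only
      have h5 : D * ((lpPow p (N *ᵥ (s.1 - p⁻¹ • Δ)) - F) / s.2) ≤
          D * ((lpPow p (N *ᵥ s.1) - F) / s.2) - 1 := by
        have h6 : D * ((lpPow p (N *ᵥ s.1) - F) / s.2) - 1 =
            D * ((lpPow p (N *ᵥ s.1) - F - s.2 / D) / s.2) := by field_simp
        rw [h6]
        exact mul_le_mul_of_nonneg_left (div_le_div_of_nonneg_right (by linarith) hs2.le) hD0.le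
      linarith
    · have h2 := hΔ (not_le.1 hprog)
      refine ⟨⟨hA, h2, by simp only; linarith⟩, ?_⟩
      simp only
      have h3 : Real.logb 2 (s.2 / 2 / ε) = Real.logb 2 (s.2 / ε) - 1 := by
        rw [div_right_comm, Real.logb_div (by positivity) two_ne_zero,
          Real.logb_self_eq_one one_lt_two]
      have h4 : (lpPow p (N *ᵥ s.1) - F) / (s.2 / 2) ≤ (lpPow p (N *ᵥ s.1) - F) / s.2 + 1 / 2 := by
        have h5 : (lpPow p (N *ᵥ s.1) - F) / (s.2 / 2) =
          (lpPow p (N *ᵥ s.1) - F) / s.2 + (lpPow p (N *ᵥ s.1) - F) / s.2 := by ring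
        have h6 : (lpPow p (N *ᵥ s.1) - F) / s.2 ≤ 1 / 2 := by
          rw [div_le_iff₀ hs2]; linarith
        linarith
      rw [h3]
      nlinarith [mul_le_mul_of_nonneg_left h4 hD0.le]
  · exact ⟨rfl, by simp only; linarith, hM'⟩
  · simp only
    have hL := lpPow_nonneg p (N *ᵥ x₀)
    have h1 : (lpPow p (N *ᵥ x₀) - F) / lpPow p (N *ᵥ x₀) ≤ 1 :=
      div_le_one_of_le₀ (by linarith) hL
    have h2 : Real.logb 2 (lpPow p (N *ᵥ x₀) / ε) ≤ Real.logb 2 M := by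
      rcases hL.eq_or_lt with h | h
      · rw [← h]; simpa using hlogM
      · have hε0 : 0 < ε := by
          rcases hε.eq_or_lt with h' | h'
          · rw [← h'] at hM'; linarith
          · exact h'
        exact Real.logb_le_logb_of_le one_lt_two (by positivity) ((div_le_iff₀ hε0).2 hM')
    nlinarith [mul_le_mul_of_nonneg_left h1 hD0.le]

/-! ### The number of calls made by iterative refinement -/

theorem log_two_le_log {x : ℝ} (hx : 2 ≤ x) : 0.69 ≤ Real.log x := by
  have h1 := Real.log_two_gt_d9
  have h2 := Real.log_le_log two_pos hx
  norm_num at h1 ⊢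
  linarith

/-- For `p ≥ log m`, `p ≤ 2(p-1)` gives `m^(1/(p-1)) ≤ e² < 8`; otherwise `p` itself is below `log
m`. -/
theorem resApprox_le {m : ℕ} (hm : 2 ≤ m) {p : ℝ} (hp : 2 ≤ p) :
    resApprox m p ≤ 2 ^ 37 * Real.log m := by
  have hm2 : (2 : ℝ) ≤ m := by exact_mod_cast hm
  have hm' : (0 : ℝ) < m := by linarith
  have hlog := log_two_le_log hm2
  unfold resApprox
  split_ifs with hpm
  · have h1 : (m : ℝ) ^ (1 / (p - 1)) ≤ 8 := by
      rw [Real.rpow_def_of_pos hm']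
      have h2 : Real.log m * (1 / (p - 1)) ≤ 2 := by
        rw [mul_one_div, div_le_iff₀ (by linarith)]
        linarith
      have h3 : Real.exp 2 = Real.exp 1 ^ 2 := by rw [← Real.exp_nat_mul]; norm_num
      have h4 := Real.exp_one_lt_d9
      have h5 : Real.exp 1 ^ 2 ≤ 2.75 ^ 2 := by
        have := Real.exp_pos 1
        gcongr
        linarith
      norm_num at h5
      linarith [Real.exp_le_exp.2 h2]
    have h6 : logExp m ≤ 3 * Real.log m := max_le (by linarith) (by linarith)
    have h7 := two_le_logExp m
    calc 2 ^ 32 * logExp m * (m : ℝ) ^ (1 / (p - 1)) ≤ 2 ^ 32 * (3 * Real.log m) * 8 := by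
          gcongr
      _ ≤ 2 ^ 37 * Real.log m := by nlinarith
  · push Not at hpm
    nlinarith

/-- The cost of an iterative refinement for an exponent at most `p`, up to a logarithm of the
accuracy. -/
noncomputable def refineCost (m : ℕ) (p : ℝ) : ℝ :=
  6 * mwuX m p * (Real.logb 2 (32 * p) + 1) * (2 ^ 43 * p * Real.log m)

theorem returns_lpSolver_of_le (S : LinearSolver) {d m n : ℕ} (A : Matrix (Fin d) (Fin n) ℝ)
    (N : Matrix (Fin m) (Fin n) ℝ) {k p ε M : ℝ} {x₀ : Fin n → ℝ} (hm : 2 ≤ m) (hk : 2 ≤ k)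
    (hkp : k ≤ p) (hε : 0 ≤ ε) (hM : 1 ≤ M) (hM' : lpPow k (N *ᵥ x₀) ≤ M * ε) :
    Returns (lpSolver S A N k ε x₀)
      (fun x => A *ᵥ x = A *ᵥ x₀ ∧ ∀ y, A *ᵥ y = A *ᵥ x₀ → lpPow k (N *ᵥ x) ≤ lpPow k (N *ᵥ y) + ε)
      (refineCost m p * (1 + Real.logb 2 M)) := by
  refine (returns_lpSolver S A N hm hk hε hM hM').mono (fun _ h => h) ?_
  have hm0 : 0 < m := by linarith
  have hm2 : (2 : ℝ) ≤ m := by exact_mod_cast hm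
  have hlog := log_two_le_log hm2
  have h1 : 32 * k * resApprox m k + 1 ≤ 2 ^ 43 * p * Real.log m := by
    have h2 := resApprox_le hm hk
    calc 32 * k * resApprox m k + 1 ≤ 32 * k * (2 ^ 37 * Real.log m) + 1 := by gcongr
      _ = 2 ^ 42 * k * Real.log m + 1 := by ring
      _ ≤ 2 ^ 43 * k * Real.log m := by nlinarith
      _ ≤ 2 ^ 43 * p * Real.log m := by gcongr
  have h2 := mwuX_mono hm0 hk hkp
  have h3 : Real.logb 2 (32 * k) ≤ Real.logb 2 (32 * p) :=
    Real.logb_le_logb_of_le one_lt_two (by linarith) (by linarith)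
  have h4 : 0 ≤ Real.logb 2 (32 * k) := Real.logb_nonneg one_lt_two (by linarith)
  have h5 : 0 ≤ Real.logb 2 M := Real.logb_nonneg one_lt_two hM
  have h6 := (mwuX_pos hm0 k).le
  have h7 := (resApprox_pos hm0 hk).le
  unfold refineCost
  rw [← mul_assoc]
  have h8 := (mwuX_pos hm0 p).le
  have h9 : 0 ≤ 6 * mwuX m p * (Real.logb 2 (32 * p) + 1) :=
    mul_nonneg (by positivity) (by linarith)
  gcongr

theorem refineCost_nonneg {m : ℕ} (hm : 2 ≤ m) {p : ℝ} (hp : 2 ≤ p) : 0 ≤ refineCost m p := by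
  have hm2 : (2 : ℝ) ≤ m := by exact_mod_cast hm
  have := log_two_le_log hm2
  have := mwuX_pos (by linarith : 0 < m) p
  have : 0 ≤ Real.logb 2 (32 * p) := Real.logb_nonneg one_lt_two (by linarith)
  unfold refineCost
  positivity

/-! ### The homotopy -/

/-- A `2`-approximate solution for the norm `r` is a `2^(p/r) m^(p/r-1)`-approximate solution for
the norm `p ≥ r`. -/
theorem lpPow_le_of_approx {m : ℕ} {r p : ℝ} (hr : 0 < r) (hrp : r ≤ p) {u v : Fin m → ℝ}
    (h : lpPow r u ≤ 2 * lpPow r v) :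
    lpPow p u ≤ 2 ^ (p / r) * ((m : ℝ) ^ (p / r - 1) * lpPow p v) := by
  have h0 : 0 < p := hr.trans_le hrp
  calc lpPow p u ≤ lpPow r u ^ (p / r) := lpPow_le_rpow_lpPow hr hrp u
    _ ≤ (2 * lpPow r v) ^ (p / r) :=
        Real.rpow_le_rpow (lpPow_nonneg _ _) h (by positivity)
    _ = 2 ^ (p / r) * lpPow r v ^ (p / r) := Real.mul_rpow two_pos.le (lpPow_nonneg _ _)
    _ ≤ _ := by
        have := rpow_lpPow_le_mul_lpPow hr hrp v
        gcongr

theorem dotProduct_transpose_mul_mulVec {m n : ℕ} (N : Matrix (Fin m) (Fin n) ℝ) (v : Fin n → ℝ) :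
    v ⬝ᵥ (N.transpose * N) *ᵥ v = lpPow 2 (N *ᵥ v) := by
  rw [← Matrix.mulVec_mulVec, Matrix.dotProduct_mulVec, Matrix.vecMul_transpose]
  simp only [dotProduct, lpPow, Real.rpow_two, sq, abs_mul_abs_self]

theorem returns_leastSquares (S : LinearSolver) {d m n : ℕ} (A : Matrix (Fin d) (Fin n) ℝ)
    (N : Matrix (Fin m) (Fin n) ℝ) {b : Fin d → ℝ} (hb : ∃ y, A *ᵥ y = b) :
    Returns (quadMin S (N.transpose * N) A b) (fun o => A *ᵥ (o.getD 0) = b ∧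
      ∀ y, A *ᵥ y = b → lpPow 2 (N *ᵥ (o.getD 0)) ≤ lpPow 2 (N *ᵥ y)) 1 := by
  refine (returns_quadMin S A b ?_ ?_).mono ?_ le_rfl
  · simp [Matrix.IsSymm, Matrix.transpose_mul]
  · intro v
    rw [dotProduct_transpose_mul_mulVec]
    exact lpPow_nonneg _ _
  · rintro (_ | x) ⟨h1, h2⟩
    · obtain ⟨y, hy⟩ := hb
      exact absurd hy (h2 rfl y)
    · obtain ⟨h3, h4⟩ := h1 x rfl
      refine ⟨h3, fun y hy => ?_⟩
      have h5 := h4 y hy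
      simp only [dotProduct_transpose_mul_mulVec] at h5
      have := lpPow_nonneg 2 (N *ᵥ (y - x))
      simp only [Option.getD_some]
      linarith

theorem two_pow_floor_le {p : ℝ} (hp : 0 < p) : (2 : ℝ) ^ ⌊Real.logb 2 p - 1⌋ ≤ p / 2 := by
  rw [← Real.rpow_intCast]
  calc (2 : ℝ) ^ ((⌊Real.logb 2 p - 1⌋ : ℤ) : ℝ) ≤ 2 ^ (Real.logb 2 p - 1) :=
        Real.rpow_le_rpow_of_exponent_le one_le_two (Int.floor_le _)
    _ = p / 2 := by
        rw [Real.rpow_sub_one two_ne_zero, Real.rpow_logb two_pos (by norm_num) hp]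

/-- When the loop stops before the exponent `2^(j+2)`, `log₂ p < j + 3`: the last treated exponent
`2^(j+1)` is within a factor `4` of `p`. -/
theorem le_of_two_pow_floor_lt {p : ℝ} (hp : 0 < p) {j : ℕ}
    (h : (2 : ℝ) ^ ⌊Real.logb 2 p - 1⌋ < 2 ^ (j + 2)) : p ≤ 4 * 2 ^ (j + 1) := by
  have h1 : ⌊Real.logb 2 p - 1⌋ < ((j + 2 : ℕ) : ℤ) := by
    rw [← zpow_natCast] at h
    exact (zpow_lt_zpow_iff_right₀ one_lt_two).1 h
  have h2 : Real.logb 2 p - 1 < ((j + 2 : ℕ) : ℤ) := Int.floor_lt.1 h1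
  have h3 : Real.logb 2 p - 1 < j + 2 := by
    have : Real.logb 2 p - 1 < ((j + 2 : ℕ) : ℝ) := by exact_mod_cast h2
    push_cast at this
    exact this
  have h4 : p ≤ 2 ^ ((j + 3 : ℕ) : ℝ) := by
    rw [← Real.logb_le_iff_le_rpow one_lt_two hp]
    push_cast
    linarith
  rw [Real.rpow_natCast] at h4
  exact h4.trans (le_of_eq (by ring))

theorem returns_startSolution (S : LinearSolver) {d m n : ℕ} (A : Matrix (Fin d) (Fin n) ℝ)
    (N : Matrix (Fin m) (Fin n) ℝ) {b : Fin d → ℝ} {p : ℝ} (hm : 2 ≤ m) (hp : 2 ≤ p)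
    (hb : ∃ y, A *ᵥ y = b) :
    Returns (startSolution S A N b p) (fun x => A *ᵥ x = b ∧
      ∀ y, A *ᵥ y = b → lpPow p (N *ᵥ x) ≤ 16 * (m : ℝ) ^ 3 * lpPow p (N *ᵥ y))
      (1 + refineCost m p * (1 + Real.logb 2 (4 * m)) * (Real.logb 2 p + 1)) := by
  classical
  have hm2 : (2 : ℝ) ≤ m := by exact_mod_cast hm
  have h0 : 0 < p := by linarith
  have hcost := refineCost_nonneg hm hp
  have hlog4 : 0 ≤ Real.logb 2 (4 * m) := Real.logb_nonneg one_lt_two (by linarith)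
  have hlogp : 0 ≤ Real.logb 2 p := Real.logb_nonneg one_lt_two (by linarith)
  refine Returns.bind (returns_leastSquares S A N hb) ?_
  rintro o ⟨ho1, ho2⟩
  have hloop := Returns.whileLoop
    (cond := fun s : (Fin n → ℝ) × ℝ => s.2 ≤ (2 : ℝ) ^ ⌊Real.logb 2 p - 1⌋)
    (body := fun s => do
      let x ← lpSolver S A N s.2 (lpPow s.2 (N.mulVec s.1) / (4 * m)) s.1
      pure (x, 2 * s.2))
    (s := (o.getD 0, 4))
    -- The state holds the next exponent `2^(j+2)`, while the current point is a `2`-approximation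
    -- for the previous one, `2^(j+1)`; `j = 0` is the least squares start.
    (fun s => ∃ j : ℕ, s.2 = 2 ^ (j + 2) ∧ A *ᵥ s.1 = b ∧ (2 : ℝ) ^ (j + 1) ≤ p ∧
      ∀ y, A *ᵥ y = b → lpPow (2 ^ (j + 1)) (N *ᵥ s.1) ≤ 2 * lpPow (2 ^ (j + 1)) (N *ᵥ y))
    (fun s => Real.logb 2 p - Real.logb 2 s.2)
    (c := refineCost m p * (1 + Real.logb 2 (4 * m))) (B := Real.logb 2 p)
    (by positivity) hlogp ?_ ?_ ?_ ?_
  · refine (hloop.bind (c₂ := 0) ?_).mono (fun _ h => h) (by rw [add_zero])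
    rintro s ⟨⟨j, hj, hA, hjp, happ⟩, hc⟩
    refine Returns.pure ⟨hA, fun y hy => ?_⟩
    rw [not_le, hj] at hc
    have hr : (0 : ℝ) < 2 ^ (j + 1) := by positivity
    refine (lpPow_le_of_approx hr hjp (happ y hy)).trans ?_
    -- The exponent ratio `4` turns a `2`-approximation into a factor `2^4 m^(4-1)`.
    have h4 : p / 2 ^ (j + 1) ≤ 4 := by
      rw [div_le_iff₀ hr]
      exact le_of_two_pow_floor_lt h0 hc
    have hL := lpPow_nonneg p (N *ᵥ y)
    have h5 : (2 : ℝ) ^ (p / 2 ^ (j + 1)) ≤ 16 := by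
      calc (2 : ℝ) ^ (p / 2 ^ (j + 1)) ≤ 2 ^ (4 : ℝ) :=
            Real.rpow_le_rpow_of_exponent_le one_le_two h4
        _ = 16 := by norm_num
    have h6 : (m : ℝ) ^ (p / 2 ^ (j + 1) - 1) ≤ (m : ℝ) ^ 3 := by
      rw [← Real.rpow_natCast (m : ℝ) 3]
      refine Real.rpow_le_rpow_of_exponent_le (by linarith) ?_
      push_cast
      linarith
    rw [mul_assoc]
    gcongr
  · rintro s ⟨j, hj, -⟩ hcond
    have h1 : 0 < s.2 := by rw [hj]; positivity
    have h2 := two_pow_floor_le h0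
    have := Real.logb_le_logb_of_le one_lt_two h1 (by linarith : s.2 ≤ p)
    linarith
  · rintro s ⟨j, hj, hA, hjp, happ⟩ hcond
    have h2 := two_pow_floor_le h0
    have hs4 : 2 ≤ s.2 := by
      rw [hj, pow_succ]
      have : (1 : ℝ) ≤ 2 ^ (j + 1) := one_le_pow₀ one_le_two
      linarith
    have hsp : s.2 ≤ p := by linarith
    have hL := lpPow_nonneg s.2 (N *ᵥ s.1)
    refine (Returns.bind (c₂ := 0) (returns_lpSolver_of_le S A N (M := 4 * m) hm hs4 hsp
      (by positivity) (by linarith) (le_of_eq ?_)) ?_).mono (fun _ h => h) (by rw [add_zero])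
    · field_simp
    rintro x ⟨hx1, hx2⟩
    rw [hA] at hx1 hx2
    refine Returns.pure ⟨⟨j + 1, ?_, hx1, ?_, fun y hy => ?_⟩, ?_⟩
    · simp only [hj]; ring
    · rw [← hj]; exact hsp
    · rw [show j + 1 + 1 = j + 2 by rfl, ← hj]
      have hr : (0 : ℝ) < 2 ^ (j + 1) := by positivity
      have hs2 : s.2 = 2 * 2 ^ (j + 1) := by rw [hj]; ring
      have h3 := lpPow_le_of_approx hr (by linarith : (2 : ℝ) ^ (j + 1) ≤ s.2) (happ y hy)
      rw [show s.2 / 2 ^ (j + 1) = 2 by rw [hs2]; field_simp,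
        show (2 : ℝ) - 1 = 1 by norm_num, Real.rpow_one] at h3
      -- Doubling the exponent costs `2² m`, so the additive accuracy is at most the value of any
      -- competitor and the output is again a `2`-approximation.
      have h4 : lpPow s.2 (N *ᵥ s.1) / (4 * m) ≤ lpPow s.2 (N *ᵥ y) := by
        rw [div_le_iff₀ (by positivity)]
        norm_num at h3
        linarith
      have := hx2 y hy
      linarith
    · simp only
      rw [Real.logb_mul two_ne_zero (by linarith), Real.logb_self_eq_one one_lt_two]
      linarith
  · refine ⟨0, by norm_num, ho1, by simpa using hp, fun y hy => ?_⟩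
    have := ho2 y hy
    have := lpPow_nonneg 2 (N *ᵥ y)
    simp only [zero_add, pow_one]
    linarith
  · have : 0 ≤ Real.logb 2 (4 : ℝ) := Real.logb_nonneg one_lt_two (by norm_num)
    simp only
    linarith

/-- The whole algorithm computes a `(1 + ε)`-approximate solution. -/
theorem returns_pureLpSolver (S : LinearSolver) {d m n : ℕ} (A : Matrix (Fin d) (Fin n) ℝ)
    (N : Matrix (Fin m) (Fin n) ℝ) {b : Fin d → ℝ} {p ε : ℝ} (hm : 2 ≤ m) (hp : 2 ≤ p)
    (hε : 0 < ε) (hb : ∃ y, A *ᵥ y = b) :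
    Returns (pureLpSolver S A N b p ε) (fun x => A *ᵥ x = b ∧
      ∀ y, A *ᵥ y = b → lpPow p (N *ᵥ x) ≤ (1 + ε) * lpPow p (N *ᵥ y))
      (1 + refineCost m p * (1 + Real.logb 2 (4 * m)) * (Real.logb 2 p + 1) +
        refineCost m p * (1 + Real.logb 2 (16 * (m : ℝ) ^ 3 / min ε 1))) := by
  have hm2 : (2 : ℝ) ≤ m := by exact_mod_cast hm
  have hmin : 0 < min ε 1 := lt_min hε one_pos
  refine Returns.bind (returns_startSolution S A N hm hp hb) ?_
  rintro x₀ ⟨hx₀, happ⟩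
  have hL := lpPow_nonneg p (N *ᵥ x₀)
  have hM : 1 ≤ 16 * (m : ℝ) ^ 3 / min ε 1 := by
    rw [one_le_div hmin]
    have h1 : (1 : ℝ) ≤ (m : ℝ) ^ 3 := one_le_pow₀ (by linarith)
    linarith [min_le_right ε 1]
  refine (returns_lpSolver_of_le S A N hm hp le_rfl (by positivity) hM ?_).mono ?_ le_rfl
  · have e : 16 * (m : ℝ) ^ 3 / min ε 1 * (ε * lpPow p (N.mulVec x₀) / (16 * (m : ℝ) ^ 3)) =
        ε / min ε 1 * lpPow p (N *ᵥ x₀) := by field_simp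
    rw [e]
    exact le_mul_of_one_le_left hL ((one_le_div hmin).2 (min_le_left _ _))
  · rintro x ⟨h1, h2⟩
    rw [hx₀] at h1 h2
    refine ⟨h1, fun y hy => (h2 y hy).trans ?_⟩
    have h3 : ε * lpPow p (N.mulVec x₀) / (16 * (m : ℝ) ^ 3) ≤ ε * lpPow p (N *ᵥ y) := by
      rw [div_le_iff₀ (by positivity), mul_assoc]
      refine mul_le_mul_of_nonneg_left ((happ y hy).trans (le_of_eq (by ring))) hε.le
    linarith

/-! ### The total number of calls -/

theorem logb_two_le {x : ℝ} (hx : 1 ≤ x) : Real.logb 2 x ≤ 1.45 * Real.log x := by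
  have h1 := Real.log_two_gt_d9
  have h2 := Real.log_nonneg hx
  rw [Real.logb, div_le_iff₀ (Real.log_pos one_lt_two)]
  norm_num at h1 ⊢
  nlinarith

theorem pureLpSolver_cost_le {m : ℕ} {p ε : ℝ} (hm : 2 ≤ m) (hp : 2 ≤ p) (hε : 0 < ε) :
    1 + refineCost m p * (1 + Real.logb 2 (4 * m)) * (Real.logb 2 p + 1) +
      refineCost m p * (1 + Real.logb 2 (16 * (m : ℝ) ^ 3 / min ε 1)) ≤
    2 ^ 55 * (p * (m : ℝ) ^ ((p - 2) / (3 * p - 2)) * Real.log p ^ 2 * Real.log m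
            * Real.log (m / min ε 1)) := by
  have hm2 : (2 : ℝ) ≤ m := by exact_mod_cast hm
  have hmin : 0 < min ε 1 := lt_min hε one_pos
  have hmin1 : min ε 1 ≤ 1 := min_le_right _ _
  have hlm := log_two_le_log hm2
  have hlp := log_two_le_log hp
  have hcost := refineCost_nonneg hm hp
  set L := Real.log (m / min ε 1) with hL
  have hmL : Real.log m ≤ L := by
    refine Real.log_le_log (by linarith) ?_
    rw [le_div_iff₀ hmin]
    nlinarith
  have hX : 1 ≤ mwuX m p := one_le_mwuX (by linarith) hp
  change _ ≤ 2 ^ 55 * (p * mwuX m p * Real.log p ^ 2 * Real.log m * L)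
  have hlog2 : Real.log 2 ≤ 0.7 := by have := Real.log_two_lt_d9; linarith
  have b1 : 1 + Real.logb 2 (4 * m) ≤ 7 * L := by
    have h1 := logb_two_le (by linarith : (1 : ℝ) ≤ 4 * m)
    have h2 : Real.log (4 * m) = 2 * Real.log 2 + Real.log m := by
      rw [Real.log_mul (by norm_num) (by linarith), show (4 : ℝ) = 2 ^ 2 by norm_num, Real.log_pow]
      push_cast; ring
    linarith
  have b2 : Real.logb 2 p + 1 ≤ 3 * Real.log p := by
    have h1 := logb_two_le (by linarith : (1 : ℝ) ≤ p)
    linarith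
  have b3 : 1 + Real.logb 2 (16 * (m : ℝ) ^ 3 / min ε 1) ≤ 12 * L := by
    have h3 : (1 : ℝ) ≤ (m : ℝ) ^ 3 := one_le_pow₀ (by linarith)
    have h1 := logb_two_le (x := 16 * (m : ℝ) ^ 3 / min ε 1) (by
      rw [one_le_div hmin]; linarith)
    have h2 : Real.log (16 * (m : ℝ) ^ 3 / min ε 1) = 4 * Real.log 2 + 2 * Real.log m + L := by
      rw [hL, Real.log_div (by positivity) hmin.ne', Real.log_div (by positivity) hmin.ne',
        Real.log_mul (by norm_num) (by positivity), Real.log_pow,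
        show (16 : ℝ) = 2 ^ 4 by norm_num, Real.log_pow]
      push_cast; ring
    linarith
  have b4 : Real.logb 2 (32 * p) + 1 ≤ 11 * Real.log p := by
    have h1 := logb_two_le (by linarith : (1 : ℝ) ≤ 32 * p)
    have h2 : Real.log (32 * p) = 5 * Real.log 2 + Real.log p := by
      rw [Real.log_mul (by norm_num) (by linarith), show (32 : ℝ) = 2 ^ 5 by norm_num, Real.log_pow]
      push_cast; ring
    linarith
  have hL0 : 0.69 ≤ L := hlm.trans hmL
  have b5 : refineCost m p ≤ 6 * mwuX m p * (11 * Real.log p) * (2 ^ 43 * p * Real.log m) := by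
    unfold refineCost
    gcongr
  set Z := p * mwuX m p * Real.log p ^ 2 * Real.log m * L with hZ
  -- All factors are bounded away from zero for `m, p ≥ 2`, so the single least squares call is
  -- absorbed.
  have b6 : 1 ≤ 4 * Z := by
    have h1 : (2 : ℝ) * 1 ≤ p * mwuX m p := by gcongr
    have h2 : (0.69 : ℝ) ^ 2 ≤ Real.log p ^ 2 := by gcongr
    have h3 : (2 * 1) * 0.69 ^ 2 * 0.69 * 0.69 ≤ Z := by
      rw [hZ]; gcongr
    norm_num at h3
    linarith
  have b7 : refineCost m p * (1 + Real.logb 2 (4 * m)) * (Real.logb 2 p + 1) +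
      refineCost m p * (1 + Real.logb 2 (16 * (m : ℝ) ^ 3 / min ε 1)) ≤
      refineCost m p * (39 * L * Real.log p) := by
    have h1 : (1 + Real.logb 2 (4 * m)) * (Real.logb 2 p + 1) ≤ 7 * L * (3 * Real.log p) := by
      have : 0 ≤ Real.logb 2 p := Real.logb_nonneg one_lt_two (by linarith)
      gcongr
    have h2 : 12 * L ≤ 18 * L * Real.log p := by nlinarith
    calc _ = refineCost m p * ((1 + Real.logb 2 (4 * m)) * (Real.logb 2 p + 1) +
          (1 + Real.logb 2 (16 * (m : ℝ) ^ 3 / min ε 1))) := by ring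
      _ ≤ _ := by gcongr; linarith
  -- The constant `2574 = 6 · 11 · 39` is below `2^12`, which leaves room for the extra `4 Z` under
  -- `2^55`.
  have b8 : refineCost m p * (39 * L * Real.log p) ≤ 2574 * 2 ^ 43 * Z := by
    calc _ ≤ 6 * mwuX m p * (11 * Real.log p) * (2 ^ 43 * p * Real.log m) *
          (39 * L * Real.log p) := by gcongr
      _ = 2574 * 2 ^ 43 * Z := by rw [hZ]; ring
  linarith

theorem mainTheorem8 (c : ℝ) :
    ∃ K : ℝ, 0 < K ∧
      ∀ (d n m : ℕ) (A : Matrix (Fin d) (Fin n) ℝ) (N : Matrix (Fin m) (Fin n) ℝ) (b : Fin d → ℝ)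
        (p ε : ℝ) (S : LinearSolver),
        2 ≤ m → (∃ y, A.mulVec y = b) → 2 ≤ p → p ≤ (m : ℝ) ^ c → 0 < ε →
        ∃ (x : Fin n → ℝ) (t : ℕ),
          (x, t) ∈ pureLpSolver S A N b p ε 0 ∧
          A.mulVec x = b ∧
          (∀ y, A.mulVec y = b → lpPow p (N.mulVec x) ≤ (1 + ε) * lpPow p (N.mulVec y)) ∧
          (t : ℝ) ≤ K * (p * (m : ℝ) ^ ((p - 2) / (3 * p - 2)) * Real.log p ^ 2 * Real.log m
            * Real.log (m / min ε 1)) := by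
  refine ⟨2 ^ 55, by positivity, fun d n m A N b p ε S hm hb hp _ hε => ?_⟩
  obtain ⟨x, t, h1, ⟨h2, h3⟩, h4⟩ := returns_pureLpSolver S A N hm hp hε hb 0
  refine ⟨x, t, h1, h2, h3, ?_⟩
  rw [Nat.cast_zero, zero_add] at h4
  exact h4.trans (pureLpSolver_cost_le hm hp hε)
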